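/- Let $K$ be an algebraically closed field of characteristic $2$. Let $2\mathcal{B}$ be the quiver with two vertices $0,1$, a loop $\alpha$ at $0$, a loop $\eta$ at $1$, an arrow $\beta\colon 0\to 1$ and an arrow $\gamma\colon 1\to 0$; paths are written from left to right. For integers $k,s\ge 1$ and $c\in K$ let $SD(2\mathcal{B})_1^{k,s}(c)$ be the quotient of the path algebra $K(2\mathcal{B})$ by the relations $$\gamma\beta=0,\quad \eta\gamma=0,\quad \beta\eta=0,\quad \alpha^2=(\beta\gamma\alpha)^{k-1}\beta\gamma+c(\alpha\beta\gamma)^k,\quad \eta^s=(\gamma\alpha\beta)^k,\quad (\alpha\beta\gamma)^k=(\beta\gamma\alpha)^k,$$ and let $SD(2\mathcal{B})_2^{k,s}(c)$ be its quotient by the relations $$\beta\eta=(\alpha\beta\gamma)^{k-1}\alpha\beta,\quad \eta\gamma=(\gamma\alpha\beta)^{k-1}\gamma\alpha,\quad \gamma\beta=\eta^{s-1},\quad \alpha^2=c(\alpha\beta\gamma)^k,\quad \beta\eta^2=0,\quad \eta^2\gamma=0,$$ where $\eta^0$ means the trivial path at $1$. Two $K$-algebras $A$ and $B$ are called stably equivalent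 of Morita type if there are an $A$-$B$-bimodule $M$ and a $B$-$A$-bimodule $N$ (with $K$ acting centrally), each finitely generated projective as a left module and as a right module, a projective $A$-$A$-bimodule $P$ and a projective $B$-$B$-bimodule $Q$ such that $M\otimes_B N\simeq A\oplus P$ and $N\otimes_A M\simeq B\oplus Q$ as bimodules. 1. Let $k,s\ge 1$ be integers such that if $k=2$ then $s\ge 3$ is odd, and if $s=2$ then $k\ge 3$ is odd. Then $SD(2\mathcal{B})_1^{k,s}(0)$ and $SD(2\mathcal{B})_1^{k,s}(1)$ are not stably equivalent of Morita type. 2. Let $k,s\ge 1$ be odd integers. Then $SD(2\mathcal{B})_2^{k,s}(0)$ and $SD(2\mathcal{B})_2^{k,s}(1)$ are not stably equivalent of Morita type. -/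

import Mathlib

open scoped TensorProduct

universe u

/-- The vertices and arrows of the quiver `2B`: two vertices `e0`, `e1`, a loop `α` at `e0`,
a loop `η` at `e1`, an arrow `β : e0 ⟶ e1` and an arrow `γ : e1 ⟶ e0`. -/
inductive Gen2B : Type
  | e0 | e1 | α | β | γ | η

section PathAlgebra

variable (K : Type u) [Field K]

open FreeAlgebra Gen2B in
/-- The defining relations of the path algebra of the quiver `2B`, with paths written from left to
right: the trivial paths `e0`, `e1` are orthogonal idempotents with sum `1`, and each arrow
`x : i ⟶ j` satisfies `ei * x = x = x * ej`. -/
inductive PathRel2B : FreeAlgebra K Gen2B → FreeAlgebra K Gen2B → Prop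
  | e0_e0 : PathRel2B (ι K e0 * ι K e0) (ι K e0)
  | e1_e1 : PathRel2B (ι K e1 * ι K e1) (ι K e1)
  | e0_e1 : PathRel2B (ι K e0 * ι K e1) 0
  | e1_e0 : PathRel2B (ι K e1 * ι K e0) 0
  | e0_add_e1 : PathRel2B (ι K e0 + ι K e1) 1
  | e0_α : PathRel2B (ι K e0 * ι K α) (ι K α)
  | α_e0 : PathRel2B (ι K α * ι K e0) (ι K α)
  | e0_β : PathRel2B (ι K e0 * ι K β) (ι K β)
  | β_e1 : PathRel2B (ι K β * ι K e1) (ι K β)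
  | e1_γ : PathRel2B (ι K e1 * ι K γ) (ι K γ)
  | γ_e0 : PathRel2B (ι K γ * ι K e0) (ι K γ)
  | e1_η : PathRel2B (ι K e1 * ι K η) (ι K η)
  | η_e1 : PathRel2B (ι K η * ι K e1) (ι K η)

/-- The path algebra over `K` of the quiver `2B`. -/
abbrev PathAlg2B : Type u := RingQuot (PathRel2B K)

/-- The class of a vertex or an arrow in the path algebra of the quiver `2B`. -/
noncomputable def PathAlg2B.of (x : Gen2B) : PathAlg2B K :=
  RingQuot.mkAlgHom K (PathRel2B K) (FreeAlgebra.ι K x)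

namespace PathAlg2B

/-- The trivial path at the second vertex. -/
noncomputable def e1 : PathAlg2B K := of K Gen2B.e1

/-- The loop at the first vertex. -/
noncomputable def α : PathAlg2B K := of K Gen2B.α

/-- The arrow from the first to the second vertex. -/
noncomputable def β : PathAlg2B K := of K Gen2B.β

/-- The arrow from the second to the first vertex. -/
noncomputable def γ : PathAlg2B K := of K Gen2B.γ

/-- The loop at the second vertex. -/
noncomputable def η : PathAlg2B K := of K Gen2B.η

end PathAlg2B

open PathAlg2B in
/-- The relations of `SD(2B)₁^{k,s}(c)`. -/
inductive SD2BOneRel (k s : ℕ) (c : K) : PathAlg2B K → PathAlg2B K → Prop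
  | γβ : SD2BOneRel k s c (γ K * β K) 0
  | ηγ : SD2BOneRel k s c (η K * γ K) 0
  | βη : SD2BOneRel k s c (β K * η K) 0
  | αα : SD2BOneRel k s c (α K ^ 2)
      ((β K * γ K * α K) ^ (k - 1) * (β K * γ K) + c • (α K * β K * γ K) ^ k)
  | η_pow : SD2BOneRel k s c (η K ^ s) ((γ K * α K * β K) ^ k)
  | socle : SD2BOneRel k s c ((α K * β K * γ K) ^ k) ((β K * γ K * α K) ^ k)

/-- The algebra `SD(2B)₁^{k,s}(c)`, meant for `k, s ≥ 1`. -/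
abbrev SD2BOne (k s : ℕ) (c : K) : Type u := RingQuot (SD2BOneRel K k s c)

open PathAlg2B in
/-- The relations of `SD(2B)₂^{k,s}(c)`. The power `η ^ (s - 1)` is a path at the second vertex;
the factor `e1` only matters for `s = 1`, where this path is the trivial one. -/
inductive SD2BTwoRel (k s : ℕ) (c : K) : PathAlg2B K → PathAlg2B K → Prop
  | βη : SD2BTwoRel k s c (β K * η K) ((α K * β K * γ K) ^ (k - 1) * (α K * β K))
  | ηγ : SD2BTwoRel k s c (η K * γ K) ((γ K * α K * β K) ^ (k - 1) * (γ K * α K))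
  | γβ : SD2BTwoRel k s c (γ K * β K) (e1 K * η K ^ (s - 1))
  | αα : SD2BTwoRel k s c (α K ^ 2) (c • (α K * β K * γ K) ^ k)
  | βηη : SD2BTwoRel k s c (β K * η K ^ 2) 0
  | ηηγ : SD2BTwoRel k s c (η K ^ 2 * γ K) 0

/-- The algebra `SD(2B)₂^{k,s}(c)`, meant for `k, s ≥ 1`. -/
abbrev SD2BTwo (k s : ℕ) (c : K) : Type u := RingQuot (SD2BTwoRel K k s c)

end PathAlgebra

section StableEquivalence

variable (K : Type u) [Field K]

/-- An `A`-`B`-bimodule over `K`: commuting left actions of `A` and `Bᵐᵒᵖ` (the latter is the right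
action of `B`), both inducing the same given action of `K`. -/
structure KBimod (A B : Type u) [Ring A] [Algebra K A] [Ring B] [Algebra K B] where
  carrier : Type u
  [addCommGroup : AddCommGroup carrier]
  [module : Module K carrier]
  [leftModule : Module A carrier]
  [rightModule : Module Bᵐᵒᵖ carrier]
  [leftTower : IsScalarTower K A carrier]
  [rightTower : IsScalarTower K Bᵐᵒᵖ carrier]
  [commute : SMulCommClass A Bᵐᵒᵖ carrier]

attribute [instance] KBimod.addCommGroup KBimod.module KBimod.leftModule KBimod.rightModule
  KBimod.leftTower KBimod.rightTower KBimod.commute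

variable {K} {A B C : Type u} [Ring A] [Algebra K A] [Ring B] [Algebra K B] [Ring C] [Algebra K C]

namespace KBimod

/-- `M` is finitely generated and projective as a left module and as a right module. -/
def IsBiprojective (M : KBimod K A B) : Prop :=
  Module.Finite A M.carrier ∧ Module.Projective A M.carrier ∧
    Module.Finite Bᵐᵒᵖ M.carrier ∧ Module.Projective Bᵐᵒᵖ M.carrier

attribute [local instance] TensorProduct.Algebra.module in
/-- `P` is projective as a bimodule, that is, as a module over `A ⊗ Bᵐᵒᵖ`, on which `a ⊗ op b` acts
by `p ↦ a p b`. -/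
def IsProjective (P : KBimod K A B) : Prop :=
  Module.Projective (A ⊗[K] Bᵐᵒᵖ) P.carrier

/-- The subspace of `M ⊗[K] N` spanned by the elements `m b ⊗ n - m ⊗ b n`. -/
def balancedRel (M : KBimod K A B) (N : KBimod K B C) :
    Submodule K (M.carrier ⊗[K] N.carrier) :=
  Submodule.span K {x | ∃ (m : M.carrier) (b : B) (n : N.carrier),
    x = (MulOpposite.op b • m) ⊗ₜ[K] n - m ⊗ₜ[K] (b • n)}

/-- The tensor product `M ⊗_B N`, as a vector space over `K`. -/
abbrev BalancedTensor (M : KBimod K A B) (N : KBimod K B C) : Type u :=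
  (M.carrier ⊗[K] N.carrier) ⧸ balancedRel M N

/-- The class of `m ⊗ n` in `M ⊗_B N`. -/
def tmul (M : KBimod K A B) (N : KBimod K B C) (m : M.carrier) (n : N.carrier) :
    BalancedTensor M N :=
  Submodule.Quotient.mk (m ⊗ₜ[K] n)

/-- `M ⊗_B N ≅ A ⊕ P` as `A`-`A`-bimodules: there is a `K`-linear bijection that is compatible with
the left and the right action of `A`. Here `A` acts on `M ⊗_B N` by `a (m ⊗ n) a' = a m ⊗ n a'`, so
that it is enough to ask for compatibility on the elements `m ⊗ n`, which span `M ⊗_B N`. -/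
def TensorIsoRegularAdd (M : KBimod K A B) (N : KBimod K B A) (P : KBimod K A A) : Prop :=
  ∃ φ : BalancedTensor M N ≃ₗ[K] A × P.carrier,
    (∀ (a : A) (m : M.carrier) (n : N.carrier),
      φ (tmul M N (a • m) n) = a • φ (tmul M N m n)) ∧
    ∀ (a : A) (m : M.carrier) (n : N.carrier),
      φ (tmul M N m (MulOpposite.op a • n)) = MulOpposite.op a • φ (tmul M N m n)

end KBimod

variable (K A B) in
/-- `A` and `B` are stably equivalent of Morita type. -/
def StablyEquivalentOfMoritaType : Prop :=
  ∃ (M : KBimod K A B) (N : KBimod K B A) (P : KBimod K A A) (Q : KBimod K B B),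
    M.IsBiprojective ∧ N.IsBiprojective ∧ P.IsProjective ∧ Q.IsProjective ∧
      KBimod.TensorIsoRegularAdd M N P ∧ KBimod.TensorIsoRegularAdd N M Q

end StableEquivalence

/-! In characteristic two, squaring is additive modulo the commutator space `[A, A]`, so the
elements whose square lies in `[A, A]` form a subspace, `squareKernel`. Each argument compares this
space, possibly refined by the action of the centre and by differentials `z dx`, for `c = 0` and `c
= 1`.

Transfer. A bimodule `M` that is finitely generated projective on the right gives a trace map `A →
B`: take matrices of left multiplications with respect to a dual basis. It respects commutators and,
modulo commutators, squares. The same matrices act on symbols `a db`, that is, on `A ⊗ A` modulo the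
Hochschild boundary. Projective bimodules contribute nothing to traces of elements of `squareKernel`
or to the symbols `z dx` with `z` central. Indeed, a map factoring through `X ⊗ B`, with `X` a
finite-dimensional `A`-module, reduces these quantities to matrices over `K`. There the square of a
trace is the trace of the square, and scalars have zero differential (`mem_traceNull_of_tensor`). A
central `z` of `A` acts on `M` like some central `z'` of `B`, up to a map of this kind
(`exists_central_transfer`). Hence a stable equivalence of Morita type yields a `StableTransfer`: an
isomorphism of the quotients `squareKernel / [ , ]`, compatible with centres, and a map on
differentials from which every `z dx` can be recovered.

Invariants. Let `nilCentral` be the central elements acting nilpotently on `squareKernel / [ , ]`,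
and `secondSocle` the part killed by products of two of them. Both are respected by transfer.

Computation. Apart from `SD(2B)₂` with `s = 1`, the algebras fit one pattern, `SDModel`, with a
symmetrizing form `f`. Modulo commutators they are spanned by the vertices, `α`, and powers of `αβγ`
and `η`, and `f (α * α) = c`. If `k ≠ 2` and `s ≠ 2`, the class of `α` contributes to `secondSocle`
for `c = 0` but cannot occur for `c = 1`, so the dimensions differ (`SDModel.isEmpty_transfer`).

If `k = 2` or `s = 2`, for `c = 1` the square of `α` can be cancelled by that of `αβγ` or of `η`, so
`α + αβγ` or `α + η` enters `secondSocle`. Then differentials decide. For `c = 0` and fixed `y` in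
`secondSocle`, all `z dy` with `z` in `nilCentral` lie on one line (`exists_cdiff_secondSocle`); for
`c = 1` two derivations show that two such differentials are independent
(`isEmpty_transfer_of_derivations`).

For `SD(2B)₂` with `s = 1`, `γβ` is the vertex `e1` and `βγ` is an idempotent; there the dimension
of `squareKernel` modulo commutators already drops from `c = 0` to `c = 1`
(`IsIdempotentModel.isEmpty_transfer`). -/

open MulOpposite

/-! ### Commutators, squares and differentials in characteristic two. -/

section TracesAndDifferentials

variable (K : Type u) [Field K]

/-- The subspace spanned by the commutators of an algebra. -/
def commutatorSpan (A : Type u) [Ring A] [Algebra K A] : Submodule K A :=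
  Submodule.span K {x | ∃ a b : A, x = a * b - b * a}

/-- The image of the Hochschild boundary `A ⊗ A ⊗ A → A ⊗ A`. -/
def boundarySpan (A : Type u) [Ring A] [Algebra K A] : Submodule K (A ⊗[K] A) :=
  Submodule.span K {x | ∃ a b c : A,
    x = (a * b) ⊗ₜ[K] c - a ⊗ₜ[K] (b * c) + (c * a) ⊗ₜ[K] b}

/-- The noncommutative differentials of an algebra modulo commutators. -/
abbrev CyclicDiff (A : Type u) [Ring A] [Algebra K A] : Type u := (A ⊗[K] A) ⧸ boundarySpan K A

/-- The class of `a ⊗ b`, to be thought of as `a db`. -/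
noncomputable def cdiff {A : Type u} [Ring A] [Algebra K A] : A →ₗ[K] A →ₗ[K] CyclicDiff K A :=
  (TensorProduct.mk K A A).compr₂ (boundarySpan K A).mkQ

variable {K} {A B : Type u} [Ring A] [Algebra K A] [Ring B] [Algebra K B]

theorem mul_sub_mul_mem_commutatorSpan (a b : A) : a * b - b * a ∈ commutatorSpan K A :=
  Submodule.subset_span ⟨a, b, rfl⟩

theorem cdiff_mul (a b c : A) : cdiff K a (b * c) = cdiff K (a * b) c + cdiff K (c * a) b := by
  have h : (a * b) ⊗ₜ[K] c - a ⊗ₜ[K] (b * c) + (c * a) ⊗ₜ[K] b ∈ boundarySpan K A :=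
    Submodule.subset_span ⟨a, b, c, rfl⟩
  have h2 := (Submodule.Quotient.mk_eq_zero _).2 h
  rw [Submodule.Quotient.mk_add, Submodule.Quotient.mk_sub] at h2
  change cdiff K (a * b) c - cdiff K a (b * c) + cdiff K (c * a) b = 0 at h2
  rw [sub_add_eq_add_sub, sub_eq_zero] at h2
  exact h2.symm

theorem cdiff_one (a : A) : cdiff K a 1 = 0 := by
  have h := cdiff_mul (K := K) a 1 1
  simpa using h

theorem cdiff_algebraMap (a : A) (r : K) : cdiff K a (algebraMap K A r) = 0 := by
  rw [Algebra.algebraMap_eq_smul_one, map_smul, cdiff_one, smul_zero]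

theorem central_mul_mem_commutatorSpan {z : A} (hz : ∀ a, z * a = a * z) {x : A}
    (hx : x ∈ commutatorSpan K A) : z * x ∈ commutatorSpan K A := by
  induction hx using Submodule.span_induction with
  | mem x hx =>
    obtain ⟨a, b, rfl⟩ := hx
    have : z * (a * b - b * a) = (z * a) * b - b * (z * a) := by
      rw [mul_sub, ← mul_assoc, ← mul_assoc b, ← hz b, mul_assoc z b]
    rw [this]
    exact mul_sub_mul_mem_commutatorSpan _ _
  | zero => simp
  | add x y _ _ hx hy => rw [mul_add]; exact add_mem hx hy
  | smul r x _ hx => rw [mul_smul_comm]; exact Submodule.smul_mem _ _ hx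

section CharTwo

variable [CharP K 2]

variable (K) in
theorem add_self_eq_zero_of_charTwo {V : Type*} [AddCommGroup V] [Module K V] (x : V) :
    x + x = 0 := by
  have h : (2 : K) = 0 := by exact_mod_cast CharP.cast_eq_zero K 2
  rw [← two_smul K x, h, zero_smul]

variable (K) in
theorem neg_eq_self_of_charTwo {V : Type*} [AddCommGroup V] [Module K V] (x : V) : -x = x :=
  neg_eq_of_add_eq_zero_left (add_self_eq_zero_of_charTwo K x)

variable (K) in
theorem sub_eq_add_of_charTwo {V : Type*} [AddCommGroup V] [Module K V] (x y : V) :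
    x - y = x + y := by
  rw [sub_eq_add_neg, neg_eq_self_of_charTwo K]

theorem mul_add_mul_mem_commutatorSpan (a b : A) : a * b + b * a ∈ commutatorSpan K A := by
  rw [← sub_eq_add_of_charTwo K]
  exact mul_sub_mul_mem_commutatorSpan a b

variable (K A) in
/-- The elements whose square lies in the span of the commutators. -/
def squareKernel : Submodule K A where
  carrier := {x | x * x ∈ commutatorSpan K A}
  zero_mem' := by simp
  add_mem' {x y} hx hy := by
    have : (x + y) * (x + y) = x * x + y * y + (x * y + y * x) := by noncomm_ring
    simp only [Set.mem_ofPred_eq] at *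
    rw [this]
    exact add_mem (add_mem hx hy) (mul_add_mul_mem_commutatorSpan x y)
  smul_mem' r x hx := by
    simp only [Set.mem_ofPred_eq] at *
    rw [smul_mul_smul_comm]
    exact Submodule.smul_mem _ _ hx

theorem mem_squareKernel {x : A} : x ∈ squareKernel K A ↔ x * x ∈ commutatorSpan K A := Iff.rfl

/-- Since `squareKernel` is a subspace, one commutator suffices. In its square, `abab + baba` is the
sum of the two products of `a` and `bab`, and the remaining terms are the two products of `ab` and
`ba`; both sums are commutators in characteristic two. -/
theorem square_mem_commutatorSpan {x : A} (hx : x ∈ commutatorSpan K A) :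
    x * x ∈ commutatorSpan K A := by
  suffices commutatorSpan K A ≤ squareKernel K A from this hx
  refine Submodule.span_le.2 ?_
  rintro _ ⟨a, b, rfl⟩
  change (a * b - b * a) * (a * b - b * a) ∈ commutatorSpan K A
  have h : (a * b - b * a) * (a * b - b * a) =
      (a * b * (a * b) + b * a * (b * a)) - (a * b * (b * a) + b * a * (a * b)) := by noncomm_ring
  rw [h]
  refine sub_mem ?_ (mul_add_mul_mem_commutatorSpan _ _)
  have := mul_add_mul_mem_commutatorSpan (K := K) a (b * a * b)
  convert this using 1
  noncomm_ring

theorem central_mul_mem_squareKernel {z : A} (hz : ∀ a, z * a = a * z) {x : A}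
    (hx : x ∈ squareKernel K A) : z * x ∈ squareKernel K A := by
  rw [mem_squareKernel] at *
  have : z * x * (z * x) = z * (z * (x * x)) := by
    rw [mul_assoc z x, ← mul_assoc x z x, ← hz x, mul_assoc z x x]
  rw [this]
  exact central_mul_mem_commutatorSpan hz (central_mul_mem_commutatorSpan hz hx)

/-- The Leibniz rule produces the symbol `(zx) dx` twice. Squares are therefore invisible to
differentials with central coefficient. -/
theorem cdiff_central_mul_self {z : A} (hz : ∀ a, z * a = a * z) (x : A) :
    cdiff K z (x * x) = 0 := by
  rw [cdiff_mul, ← hz x, add_self_eq_zero_of_charTwo K]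

end CharTwo

/-- For central `z` the Leibniz expansion of `z d(ab)` is symmetric in `a` and `b`. Thus `z dx`
depends only on `x` modulo commutators, the form in which it is compared across a transfer. -/
theorem cdiff_central_commutatorSpan {z : A} (hz : ∀ a, z * a = a * z) {x : A}
    (hx : x ∈ commutatorSpan K A) : cdiff K z x = 0 := by
  induction hx using Submodule.span_induction with
  | mem x hx =>
    obtain ⟨a, b, rfl⟩ := hx
    rw [map_sub, cdiff_mul, cdiff_mul, hz a, hz b]
    abel
  | zero => simp
  | add x y _ _ hx hy => rw [map_add, hx, hy, add_zero]
  | smul r x _ hx => rw [map_smul, hx, smul_zero]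

end TracesAndDifferentials

/-! ### Dual bases of projective right modules and cyclicity of traces. -/

section Frames

variable {K : Type u} [Field K] {A B : Type u} [Ring A] [Algebra K A] [Ring B] [Algebra K B]

/-- This is `tr (X²) ≡ (tr X)²`: off-diagonal products occur in pairs `X i j * X j i + X j i * X i
j`, and the mixed products of diagonal entries pair up likewise. -/
theorem sum_mul_swap_add_square_mem_commutatorSpan [CharP K 2] {ι : Type*} (s : Finset ι)
    (X : ι → ι → B) :
    (∑ i ∈ s, ∑ j ∈ s, X i j * X j i) + (∑ i ∈ s, X i i) * (∑ i ∈ s, X i i) ∈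
      commutatorSpan K B := by
  classical
  induction s using Finset.induction_on with
  | empty => simp
  | insert a s ha ih =>
    simp only [Finset.sum_insert ha, Finset.sum_add_distrib]
    have h1 : X a a * X a a + X a a * X a a = 0 := add_self_eq_zero_of_charTwo K _
    have h2 : (∑ j ∈ s, X a j * X j a) + ∑ j ∈ s, X j a * X a j ∈ commutatorSpan K B := by
      rw [← Finset.sum_add_distrib]
      exact Submodule.sum_mem _ fun j _ => mul_add_mul_mem_commutatorSpan _ _
    have h3 := mul_add_mul_mem_commutatorSpan (K := K) (X a a) (∑ i ∈ s, X i i)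
    convert add_mem (add_mem ih h2) h3 using 1
    -- The two sides differ by the square of `X a a` taken twice, which `h1` supplies as a form of
    -- zero.
    refine Eq.trans ?_ (add_zero _)
    rw [← h1]
    noncomm_ring

/-- A finite generating family of a right module together with dual coordinates. -/
structure RightFrame (B W ι : Type*) [Ring B] [AddCommGroup W] [Module Bᵐᵒᵖ W] [Fintype ι] where
  vec : ι → W
  coord : ι → W →ₗ[Bᵐᵒᵖ] B
  sum_coord : ∀ x, ∑ i, op (coord i x) • vec i = x

namespace RightFrame

theorem exists_of_projective (B W : Type*) [Ring B] [AddCommGroup W] [Module Bᵐᵒᵖ W]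
    [Module.Finite Bᵐᵒᵖ W] [Module.Projective Bᵐᵒᵖ W] :
    ∃ n, Nonempty (RightFrame B W (Fin n)) := by
  obtain ⟨n, f, g, -, -, h⟩ := Module.Finite.exists_comp_eq_id_of_projective Bᵐᵒᵖ W
  refine ⟨n, ⟨⟨fun i => f (Pi.single i 1), fun i => ?_, fun x => ?_⟩⟩⟩
  · exact
      { toFun := fun x => unop (g x i)
        map_add' := fun x y => by simp
        map_smul' := fun b x => by
          simp only [map_smul, Pi.smul_apply, smul_eq_mul, unop_mul, RingHom.id_apply]
          rfl }
  · have h2 : f (g x) = x := LinearMap.congr_fun h x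
    conv_rhs => rw [← h2]
    simp only [LinearMap.coe_mk, AddHom.coe_mk, op_unop, ← map_smul, ← map_sum]
    congr 1
    ext i
    simp [Finset.sum_apply, Pi.single_apply]

variable {W ι : Type*} [AddCommGroup W] [Module Bᵐᵒᵖ W] [Fintype ι] (F : RightFrame B W ι)

theorem map_eq_sum (s : W →ₗ[Bᵐᵒᵖ] B) (y : W) : s y = ∑ i, s (F.vec i) * F.coord i y := by
  conv_lhs => rw [← F.sum_coord y]
  simp

theorem coord_sum {L : Type*} [Fintype L] (i : ι) (b : L → B) (r : L → W) :
    F.coord i (∑ l, op (b l) • r l) = ∑ l, F.coord i (r l) * b l := by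
  simp

/-- Cyclicity of `tr (φ dx)` for a map `φ = r ∘ s` through a free module on which `x` becomes the
matrix `G`. With `R`, `S`, `X` the coordinate matrices one has `SX = GS` and `XR = RG`. Expanding `R
d(SX)` gives `RS dX + XR dS`, expanding `R d(GS)` gives `SR dG + RG dS`, and the terms with `dS`
cancel. -/
theorem sum_cdiff_factor (x : W →ₗ[Bᵐᵒᵖ] W) {L : Type*} [Fintype L] (r : L → W)
    (s : L → W →ₗ[Bᵐᵒᵖ] B) (G : L → L → B) (hs : ∀ l y, s l (x y) = ∑ m, G l m * s m y)
    (hr : ∀ l, x (r l) = ∑ m, op (G m l) • r m) :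
    ∑ i, ∑ j, cdiff K (F.coord i (∑ l, op (s l (F.vec j)) • r l)) (F.coord j (x (F.vec i))) =
      ∑ l, ∑ m, cdiff K (s m (r l)) (G l m) := by
  have hSX : ∀ l i, ∑ j, s l (F.vec j) * F.coord j (x (F.vec i)) =
      ∑ m, G l m * s m (F.vec i) := fun l i => by rw [← F.map_eq_sum, hs]
  have hXR : ∀ l j, ∑ i, F.coord j (x (F.vec i)) * F.coord i (r l) =
      ∑ m, F.coord j (r m) * G m l := fun l j => by
    refine Eq.trans (F.map_eq_sum (F.coord j ∘ₗ x) (r l)).symm ?_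
    rw [LinearMap.comp_apply, hr, coord_sum]
  have e1 : ∑ i, ∑ j, cdiff K (F.coord i (∑ l, op (s l (F.vec j)) • r l))
        (F.coord j (x (F.vec i))) +
      ∑ l, ∑ j, cdiff K (∑ i, F.coord j (x (F.vec i)) * F.coord i (r l)) (s l (F.vec j)) =
      ∑ l, ∑ i, cdiff K (F.coord i (r l)) (∑ j, s l (F.vec j) * F.coord j (x (F.vec i))) := by
    simp only [coord_sum]
    simp only [map_sum, LinearMap.sum_apply, cdiff_mul, Finset.sum_add_distrib]
    congr 1
    · calc _ = ∑ i, ∑ l, ∑ j, cdiff K (F.coord i (r l) * s l (F.vec j)) (F.coord j (x (F.vec i))) :=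
            Finset.sum_congr rfl fun i _ => Finset.sum_comm
        _ = _ := Finset.sum_comm
    · exact Finset.sum_congr rfl fun l _ => Finset.sum_comm
  simp only [hSX, hXR] at e1
  have e2 : ∑ l, ∑ i, cdiff K (F.coord i (r l)) (∑ m, G l m * s m (F.vec i)) =
      ∑ l, ∑ j, cdiff K (∑ m, F.coord j (r m) * G m l) (s l (F.vec j)) +
      ∑ l, ∑ m, cdiff K (s m (r l)) (G l m) := by
    simp only [map_sum, LinearMap.sum_apply, cdiff_mul, Finset.sum_add_distrib]
    congr 1
    · calc _ = ∑ i, ∑ l, ∑ m, cdiff K (F.coord i (r l) * G l m) (s m (F.vec i)) :=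
            Finset.sum_comm
        _ = ∑ i, ∑ m, ∑ l, cdiff K (F.coord i (r l) * G l m) (s m (F.vec i)) :=
            Finset.sum_congr rfl fun i _ => Finset.sum_comm
        _ = _ := Finset.sum_comm
    · refine Finset.sum_congr rfl fun l _ => ?_
      rw [Finset.sum_comm]
      refine Finset.sum_congr rfl fun m _ => ?_
      rw [← LinearMap.sum_apply, ← map_sum, ← F.map_eq_sum]
  rw [e2, add_comm] at e1
  exact add_left_cancel e1

/-- Cyclicity of the ordinary trace: `x ∘ r ∘ s` and `s ∘ x ∘ r` have the same trace modulo
commutators. -/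
theorem sum_coord_factor_sub_mem (x : W →ₗ[Bᵐᵒᵖ] W) {L : Type*} [Fintype L] (r : L → W)
    (s : L → W →ₗ[Bᵐᵒᵖ] B) :
    ∑ i, F.coord i (x (∑ l, op (s l (F.vec i)) • r l)) - ∑ l, s l (x (r l)) ∈
      commutatorSpan K B := by
  have h1 : ∑ i, F.coord i (x (∑ l, op (s l (F.vec i)) • r l)) =
      ∑ l, ∑ i, F.coord i (x (r l)) * s l (F.vec i) := by
    rw [Finset.sum_comm]
    refine Finset.sum_congr rfl fun i _ => ?_
    simp
  have h2 : ∑ l, s l (x (r l)) = ∑ l, ∑ i, s l (F.vec i) * F.coord i (x (r l)) :=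
    Finset.sum_congr rfl fun l _ => F.map_eq_sum _ _
  rw [h1, h2, ← Finset.sum_sub_distrib]
  refine Submodule.sum_mem _ fun l _ => ?_
  rw [← Finset.sum_sub_distrib]
  exact Submodule.sum_mem _ fun i _ => mul_sub_mul_mem_commutatorSpan _ _

end RightFrame

theorem commutatorSpan_field : commutatorSpan K K = ⊥ := by
  rw [eq_bot_iff]
  refine Submodule.span_le.2 ?_
  rintro _ ⟨a, b, rfl⟩
  simp [mul_comm]

/-- Over a field of characteristic two, `(tr Y)² = tr (Y²)`. For `Y = C * ρ x` the right side is `tr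
(C² ρ (x²))`, and `y ↦ tr (C² ρ y)` kills commutators because `C²` commutes with the image of `ρ`.
-/
theorem trace_mul_eq_zero_of_mem_squareKernel [CharP K 2] {L : Type*} [Fintype L] [DecidableEq L]
    (ρ : A →ₐ[K] Matrix L L K) (C : Matrix L L K) (hC : ∀ a, C * ρ a = ρ a * C) {x : A}
    (hx : x ∈ squareKernel K A) : (C * ρ x).trace = 0 := by
  have h1 : ∀ y ∈ commutatorSpan K A, (C * C * ρ y).trace = 0 := fun y hy => by
    induction hy using Submodule.span_induction with
    | mem y hy =>
      obtain ⟨a, b, rfl⟩ := hy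
      have hc : C * C * ρ a = ρ a * (C * C) := by rw [mul_assoc, hC, ← mul_assoc, hC, mul_assoc]
      rw [map_sub, map_mul, map_mul, mul_sub, Matrix.trace_sub, ← mul_assoc, ← mul_assoc,
        Matrix.trace_mul_comm (C * C * ρ b), ← mul_assoc, hc, sub_self]
    | zero => simp
    | add y z _ _ hy hz => rw [map_add, mul_add, Matrix.trace_add, hy, hz, add_zero]
    | smul r y _ hy => rw [map_smul, mul_smul_comm, Matrix.trace_smul, hy, smul_zero]
  have h2 := sum_mul_swap_add_square_mem_commutatorSpan (K := K) Finset.univ (C * ρ x)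
  rw [commutatorSpan_field, Submodule.mem_bot] at h2
  have h3 : ∑ i, ∑ j, (C * ρ x) i j * (C * ρ x) j i = (C * C * ρ (x * x)).trace := by
    have : C * C * ρ (x * x) = (C * ρ x) * (C * ρ x) := by
      rw [map_mul, mul_assoc C (ρ x), ← mul_assoc (ρ x), ← hC]
      simp only [mul_assoc]
    rw [this]
    simp [Matrix.trace, Matrix.mul_apply]
  rw [h3, h1 _ hx, zero_add] at h2
  exact mul_self_eq_zero.1 h2

end Frames

/-! ### The transfer maps of a bimodule, and maps of trace zero. -/

section BimoduleTraces

variable {K : Type u} [Field K] {A B : Type u} [Ring A] [Algebra K A] [Ring B] [Algebra K B]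

namespace KBimod

/-- Left multiplication on a bimodule. -/
def lmul (M : KBimod K A B) (a : A) : M.carrier →ₗ[Bᵐᵒᵖ] M.carrier :=
  DistribSMul.toLinearMap Bᵐᵒᵖ M.carrier a

@[simp] theorem lmul_apply (M : KBimod K A B) (a : A) (x : M.carrier) : M.lmul a x = a • x := rfl

end KBimod

namespace RightFrame

variable {M : KBimod K A B} {ι : Type*} [Fintype ι] (F : RightFrame B M.carrier ι)

/-- The matrix of the left multiplication by an element of `A`. -/
def mat (a : A) (i j : ι) : B := F.coord i (a • F.vec j)

/-- The frame need not be a basis, so `F.mat 1` is in general only an idempotent matrix. Products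
are respected all the same, because the coordinates recover every vector. -/
theorem mat_mul (a b : A) (i j : ι) : F.mat (a * b) i j = ∑ l, F.mat a i l * F.mat b l j := by
  have h := F.map_eq_sum (F.coord i ∘ₗ M.lmul a) (b • F.vec j)
  simp only [LinearMap.comp_apply, KBimod.lmul_apply, ← mul_smul] at h
  exact h

theorem mat_add (a b : A) (i j : ι) : F.mat (a + b) i j = F.mat a i j + F.mat b i j := by
  simp [mat, add_smul]

theorem mat_smul (r : K) (a : A) (i j : ι) : F.mat (r • a) i j = r • F.mat a i j := by
  simp only [mat, smul_assoc]
  exact (F.coord i).map_smul_of_tower r _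

/-- The entries of the matrix of the left multiplication, as linear maps. -/
def matₗ (i j : ι) : A →ₗ[K] B where
  toFun a := F.mat a i j
  map_add' a b := F.mat_add a b i j
  map_smul' r a := F.mat_smul r a i j

@[simp] theorem matₗ_apply (i j : ι) (a : A) : F.matₗ i j a = F.mat a i j := rfl

/-- The trace of the left multiplication. -/
noncomputable def trace : A →ₗ[K] B := ∑ i, F.matₗ i i

theorem trace_apply (a : A) : F.trace a = ∑ i, F.mat a i i := by
  simp [trace, LinearMap.sum_apply]

theorem trace_mem_commutatorSpan {x : A} (hx : x ∈ commutatorSpan K A) :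
    F.trace x ∈ commutatorSpan K B := by
  induction hx using Submodule.span_induction with
  | mem x hx =>
    obtain ⟨a, b, rfl⟩ := hx
    rw [map_sub, trace_apply, trace_apply]
    simp only [mat_mul]
    rw [Finset.sum_comm (f := fun i l => F.mat b i l * F.mat a l i), ← Finset.sum_sub_distrib]
    refine Submodule.sum_mem _ fun i _ => ?_
    rw [← Finset.sum_sub_distrib]
    exact Submodule.sum_mem _ fun j _ => mul_sub_mul_mem_commutatorSpan _ _
  | zero => simp
  | add x y _ _ hx hy => rw [map_add]; exact add_mem hx hy
  | smul r x _ hx => rw [map_smul]; exact Submodule.smul_mem _ _ hx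

theorem trace_mul_self_add_mem [CharP K 2] (x : A) :
    F.trace (x * x) + F.trace x * F.trace x ∈ commutatorSpan K B := by
  have := sum_mul_swap_add_square_mem_commutatorSpan (K := K) Finset.univ (F.mat x)
  simpa only [trace_apply, mat_mul] using this

theorem trace_mem_squareKernel [CharP K 2] {x : A} (hx : x ∈ squareKernel K A) :
    F.trace x ∈ squareKernel K B := by
  have h := F.trace_mul_self_add_mem x
  exact (Submodule.add_mem_iff_right _ (F.trace_mem_commutatorSpan hx)).1 h

/-- The map on differentials induced by the matrices of the left multiplications. -/
noncomputable def dtrace : CyclicDiff K A →ₗ[K] CyclicDiff K B :=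
  (boundarySpan K A).liftQ
    (TensorProduct.lift (∑ i, ∑ j, (cdiff K).compl₁₂ (F.matₗ i j) (F.matₗ j i))) (by
    refine Submodule.span_le.2 ?_
    rintro _ ⟨a, b, c, rfl⟩
    simp only [SetLike.mem_coe, LinearMap.mem_ker, map_add, map_sub, TensorProduct.lift.tmul,
      LinearMap.sum_apply, LinearMap.compl₁₂_apply, matₗ_apply, mat_mul, map_sum, cdiff_mul,
      Finset.sum_add_distrib]
    rw [sub_add_eq_add_sub, sub_eq_zero]
    congr 1
    · refine Finset.sum_congr rfl fun i _ => ?_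
      rw [Finset.sum_comm]
    · rw [Finset.sum_congr rfl fun i _ => Finset.sum_comm, Finset.sum_comm]
      exact Finset.sum_congr rfl fun i _ => Finset.sum_comm)

theorem dtrace_cdiff (a b : A) :
    F.dtrace (cdiff K a b) = ∑ i, ∑ j, cdiff K (F.mat a i j) (F.mat b j i) := by
  change (TensorProduct.lift (∑ i, ∑ j, (cdiff K).compl₁₂ (F.matₗ i j) (F.matₗ j i)))
    (a ⊗ₜ[K] b) = _
  simp [LinearMap.sum_apply]

/-- The maps whose composite with left multiplications by elements of the square kernel has trace
zero, and whose trace against all differentials vanishes. -/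
def traceNull [CharP K 2] : AddSubmonoid (M.carrier → M.carrier) where
  carrier := {φ | (∀ x ∈ squareKernel K A,
      ∑ i, F.coord i (x • φ (F.vec i)) ∈ commutatorSpan K B) ∧
    ∀ x : A, ∑ i, ∑ j, cdiff K (F.coord i (φ (F.vec j))) (F.mat x j i) = 0}
  zero_mem' := by simp
  add_mem' {φ ψ} hφ hψ := by
    refine ⟨fun x hx => ?_, fun x => ?_⟩
    · simp only [Pi.add_apply, smul_add, map_add, Finset.sum_add_distrib]
      exact add_mem (hφ.1 x hx) (hψ.1 x hx)
    · simp only [Pi.add_apply, map_add, LinearMap.add_apply, Finset.sum_add_distrib]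
      rw [hφ.2, hψ.2, add_zero]

/-- Cyclicity moves both traces to a free module on which `A` acts by matrices with entries in `K`.
There the differentials of the entries vanish, and the ordinary trace is handled by
`trace_mul_eq_zero_of_mem_squareKernel`. -/
theorem mem_traceNull_of_matrix [CharP K 2] {L : Type*} [Fintype L] [DecidableEq L]
    (ρ : A →ₐ[K] Matrix L L K) (r : L → M.carrier) (s : L → M.carrier →ₗ[Bᵐᵒᵖ] B)
    (hs : ∀ a l y, s l (a • y) = ∑ m, algebraMap K B (ρ a l m) * s m y)
    (hr : ∀ a l, a • r l = ∑ m, op (algebraMap K B (ρ a m l)) • r m) :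
    (fun y => ∑ l, op (s l y) • r l) ∈ F.traceNull := by
  refine ⟨fun x hx => ?_, fun x => ?_⟩
  · have h := F.sum_coord_factor_sub_mem (K := K) (M.lmul x) r s
    have h0 : ∑ l, s l (x • r l) = 0 := by
      -- A functional `χ` on `B` turns the pairing of `s` with `r` into a matrix over `K`, and this
      -- matrix commutes with `ρ`.
      refine (Module.forall_dual_apply_eq_zero_iff K _).1 fun χ => ?_
      have h1 := trace_mul_eq_zero_of_mem_squareKernel ρ (Matrix.of fun l m => χ (s l (r m)))
        (fun a => ?_) hx
      · rw [← h1]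
        simp only [hr, map_sum, map_smul, Matrix.trace, Matrix.diag, Matrix.mul_apply,
          Matrix.of_apply]
        refine Finset.sum_congr rfl fun l _ => Finset.sum_congr rfl fun m _ => ?_
        rw [op_smul_eq_mul, ← Algebra.commutes, ← Algebra.smul_def, map_smul, smul_eq_mul, mul_comm]
      · ext l n
        simp only [Matrix.mul_apply, Matrix.of_apply]
        have e1 := congrArg χ (hs a l (r n))
        have e2 : s l (a • r n) = ∑ m, s l (r m) * algebraMap K B (ρ a m n) := by
          rw [hr]; simp
        rw [e2] at e1
        simp only [map_sum, ← Algebra.commutes, ← Algebra.smul_def, map_smul, smul_eq_mul] at e1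
        rw [← e1]
        exact Finset.sum_congr rfl fun m _ => mul_comm _ _
    simp only [KBimod.lmul_apply] at h
    rw [h0, sub_zero] at h
    exact h
  · have h := F.sum_cdiff_factor (K := K) (M.lmul x) r s
      (fun l m => algebraMap K B (ρ x l m)) (fun l y => hs x l y) (fun l => hr x l)
    simp only [cdiff_algebraMap, Finset.sum_const_zero] at h
    exact h

/-- Coordinate-free version: any map factoring through `X ⊗ B`, with `X` a finite-dimensional
`A`-module, is trace-null. A basis of `X` supplies the scalar matrices. -/
theorem mem_traceNull_of_tensor [CharP K 2] {X : Type u} [AddCommGroup X] [Module K X] [Module A X]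
    [IsScalarTower K A X] [Module.Finite K X] (s : M.carrier →+ X ⊗[K] Bᵐᵒᵖ)
    (r : X →ₗ[K] M.carrier) (R : X ⊗[K] Bᵐᵒᵖ →ₗ[K] M.carrier)
    (hsA : ∀ (a : A) y, s (a • y) = (Algebra.lsmul K K X a).rTensor Bᵐᵒᵖ (s y))
    (hsB : ∀ (b : Bᵐᵒᵖ) y, s (b • y) = (LinearMap.mulLeft K b).lTensor X (s y))
    (hr : ∀ (a : A) x, r (a • x) = a • r x) (hR : ∀ x b, R (x ⊗ₜ b) = b • r x) :
    (fun y => R (s y)) ∈ F.traceNull := by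
  classical
  let bs := Module.finBasis K X
  let pr (l) : X ⊗[K] Bᵐᵒᵖ →ₗ[K] Bᵐᵒᵖ :=
    (TensorProduct.lid K Bᵐᵒᵖ).toLinearMap ∘ₗ (bs.coord l).rTensor Bᵐᵒᵖ
  have hpr : ∀ l x b, pr l (x ⊗ₜ b) = bs.coord l x • b := fun l x b => by simp [pr]
  let σ (l) : M.carrier →ₗ[Bᵐᵒᵖ] B :=
    { toFun := fun y => unop (pr l (s y))
      map_add' := fun x y => by simp
      map_smul' := fun b y => by
        rw [hsB, RingHom.id_apply]
        generalize s y = t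
        rw [← unop_op (b • unop _)]
        congr 1
        induction t with
        | zero => simp
        | add t t' h h' => rw [map_add, map_add, h, h', map_add]; simp
        | tmul x c =>
          rw [LinearMap.lTensor_tmul, hpr, hpr]
          apply unop_injective
          simp [MulOpposite.smul_eq_mul_unop] }
  let ρ : A →ₐ[K] Matrix _ _ K :=
    (LinearMap.toMatrixAlgEquiv bs).toAlgHom.comp (Algebra.lsmul K K X)
  have hρ : ∀ a l m, ρ a l m = bs.coord l (a • bs m) := fun a l m => by
    simp [ρ, LinearMap.toMatrixAlgEquiv_apply]
  have key := F.mem_traceNull_of_matrix ρ (fun l => r (bs l)) σ ?_ ?_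
  · convert key using 2 with y
    change _ = ∑ l, pr l (s y) • r (bs l)
    generalize s y = t
    induction t with
    | zero => simp
    | add t t' h h' => simp only [map_add, h, h', add_smul, Finset.sum_add_distrib]
    | tmul x c =>
      simp only [hR, hpr, smul_assoc]
      conv_lhs => rw [← bs.sum_repr x]
      simp only [map_sum, map_smul, Finset.smul_sum]
      refine Finset.sum_congr rfl fun l _ => ?_
      rw [smul_comm]
      rfl
  · intro a l y
    apply op_injective
    change pr l (s (a • y)) = _
    have : ∀ m, op (algebraMap K B (ρ a l m) * σ m y) = ρ a l m • pr m (s y) := fun m => by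
      rw [← Algebra.smul_def]; rfl
    rw [hsA, Finset.op_sum]
    simp only [this]
    generalize s y = t
    induction t with
    | zero => simp
    | add t t' h h' => simp only [map_add, h, h', smul_add, Finset.sum_add_distrib]
    | tmul x c =>
      simp only [LinearMap.rTensor_tmul, hpr, hρ, ← mul_smul, ← Finset.sum_smul]
      congr 1
      conv_lhs => rw [← bs.sum_repr x]
      simp only [map_sum, map_smul, Algebra.lsmul_coe, smul_eq_mul]
      exact Finset.sum_congr rfl fun m _ => mul_comm _ _
  · intro a l
    rw [← hr]
    conv_lhs => rw [← bs.sum_repr (a • bs l)]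
    rw [map_sum]
    refine Finset.sum_congr rfl fun m _ => ?_
    rw [map_smul, hρ, Algebra.algebraMap_eq_smul_one, op_smul, smul_assoc, op_one, one_smul]
    rfl

end RightFrame

end BimoduleTraces

/-! ### Balanced tensor products, projective bimodules and composition of transfers. -/

section StableTransfer

variable {K : Type u} [Field K] {A B C : Type u} [Ring A] [Algebra K A] [Ring B] [Algebra K B]
  [Ring C] [Algebra K C]

namespace KBimod

/-- The linear map out of a balanced tensor product induced by a balanced bilinear map. -/
noncomputable def balancedLift (M : KBimod K A B) (N : KBimod K B C) {X : Type u} [AddCommGroup X]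
    [Module K X] (f : M.carrier →ₗ[K] N.carrier →ₗ[K] X)
    (h : ∀ m (b : B) n, f (op b • m) n = f m (b • n)) : BalancedTensor M N →ₗ[K] X :=
  (balancedRel M N).liftQ (TensorProduct.lift f) (by
    refine Submodule.span_le.2 ?_
    rintro _ ⟨m, b, n, rfl⟩
    simp [h])

@[simp] theorem balancedLift_tmul (M : KBimod K A B) (N : KBimod K B C) {X : Type u}
    [AddCommGroup X] [Module K X] (f : M.carrier →ₗ[K] N.carrier →ₗ[K] X)
    (h : ∀ m (b : B) n, f (op b • m) n = f m (b • n)) (m : M.carrier) (n : N.carrier) :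
    balancedLift M N f h (tmul M N m n) = f m n := by
  change TensorProduct.lift f (m ⊗ₜ[K] n) = _
  simp

/-- The universal balanced bilinear map. -/
def tmulₗ (M : KBimod K A B) (N : KBimod K B C) :
    M.carrier →ₗ[K] N.carrier →ₗ[K] BalancedTensor M N :=
  (TensorProduct.mk K M.carrier N.carrier).compr₂ (balancedRel M N).mkQ

@[simp] theorem tmulₗ_apply (M : KBimod K A B) (N : KBimod K B C) (m : M.carrier)
    (n : N.carrier) : tmulₗ M N m n = tmul M N m n := rfl

theorem tmul_balanced (M : KBimod K A B) (N : KBimod K B C) (m : M.carrier) (b : B)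
    (n : N.carrier) : tmul M N (op b • m) n = tmul M N m (b • n) :=
  (Submodule.Quotient.eq _).2 (Submodule.subset_span ⟨m, b, n, rfl⟩)

theorem exists_eq_sum_tmul (M : KBimod K A B) (N : KBimod K B C) (u : BalancedTensor M N) :
    ∃ (l : ℕ) (x : Fin l → M.carrier) (y : Fin l → N.carrier), u = ∑ i, tmul M N (x i) (y i) := by
  induction u using Submodule.Quotient.induction_on with
  | _ u =>
  obtain ⟨l, x, y, rfl⟩ := TensorProduct.exists_sum_tmul_eq u
  exact ⟨l, x, y, map_sum (balancedRel M N).mkQ _ _⟩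

/-- The direct sum of the regular bimodule and a bimodule. -/
def regularProd (P : KBimod K A A) : KBimod K A A where
  carrier := A × P.carrier

/-- Compatibility with the actions on both sides. -/
structure IsBimoduleMap {M N : KBimod K A B} (f : M.carrier →ₗ[K] N.carrier) : Prop where
  left : ∀ (a : A) x, f (a • x) = a • f x
  right : ∀ (b : Bᵐᵒᵖ) x, f (b • x) = b • f x

theorem IsBimoduleMap.map_sum_smul {M N : KBimod K A B} {f : M.carrier →ₗ[K] N.carrier}
    (hf : IsBimoduleMap f) {T : Type*} [Fintype T] (c : T → Bᵐᵒᵖ) (x : T → M.carrier) :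
    f (∑ t, c t • x t) = ∑ t, c t • f (x t) := by
  simp only [map_sum, hf.right]

-- The projective bimodule `Q` need not be finitely generated. A finite set of dual basis elements
-- nevertheless serves all right combinations of the given finite family at once, because right
-- multiplication does not enlarge supports. The family will be the image of a frame.
attribute [local instance] TensorProduct.Algebra.module in
theorem IsProjective.exists_dual {Q : KBimod K A B} (hQ : Q.IsProjective) {T : Type*} [Fintype T]
    (q : T → Q.carrier) :
    ∃ (S : Finset Q.carrier) (θ : Q.carrier → Q.carrier →ₗ[K] A ⊗[K] Bᵐᵒᵖ)
      (R : Q.carrier → A ⊗[K] Bᵐᵒᵖ →ₗ[K] Q.carrier),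
      (∀ k (a : A) x, θ k (a • x) = (LinearMap.mulLeft K a).rTensor Bᵐᵒᵖ (θ k x)) ∧
      (∀ k (b : Bᵐᵒᵖ) x, θ k (b • x) = (LinearMap.mulLeft K b).lTensor A (θ k x)) ∧
      (∀ k (a : A) (b : Bᵐᵒᵖ), R k (a ⊗ₜ b) = a • b • k) ∧
      ∀ c : T → Bᵐᵒᵖ, ∑ t, c t • q t = ∑ k ∈ S, R k (θ k (∑ t, c t • q t)) := by
  classical
  obtain ⟨s, hs⟩ := Module.projective_def.1 hQ
  have hK : ∀ (r : K) (x : Q.carrier), r • x = (r • (1 : A ⊗[K] Bᵐᵒᵖ)) • x := fun r x => by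
    rw [Algebra.TensorProduct.one_def, TensorProduct.smul_tmul', TensorProduct.Algebra.smul_def,
      smul_assoc, one_smul, one_smul]
  have hA : ∀ (a : A) (x : Q.carrier), a • x = (a ⊗ₜ[K] (1 : Bᵐᵒᵖ)) • x := fun a x => by
    rw [TensorProduct.Algebra.smul_def, one_smul]
  have hB : ∀ (b : Bᵐᵒᵖ) (x : Q.carrier), b • x = ((1 : A) ⊗ₜ[K] b) • x := fun a x => by
    rw [TensorProduct.Algebra.smul_def, one_smul]
  have hmA : ∀ (a : A) (u : A ⊗[K] Bᵐᵒᵖ), (a ⊗ₜ[K] (1 : Bᵐᵒᵖ)) * u =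
      (LinearMap.mulLeft K a).rTensor Bᵐᵒᵖ u := fun a u => by
    induction u with
    | zero => simp
    | add u v hu hv => rw [mul_add, hu, hv, map_add]
    | tmul c d => simp
  have hmB : ∀ (b : Bᵐᵒᵖ) (u : A ⊗[K] Bᵐᵒᵖ), ((1 : A) ⊗ₜ[K] b) * u =
      (LinearMap.mulLeft K b).lTensor A u := fun a u => by
    induction u with
    | zero => simp
    | add u v hu hv => rw [mul_add, hu, hv, map_add]
    | tmul c d => simp
  refine ⟨Finset.univ.biUnion fun t => (s (q t)).support, fun k =>
    { toFun := fun x => s x k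
      map_add' := fun x y => by simp
      map_smul' := fun r x => by
        rw [hK, map_smul, Finsupp.smul_apply, smul_eq_mul, smul_mul_assoc, one_mul]; rfl },
    fun k =>
    { toFun := fun u => u • k
      map_add' := fun u v => add_smul u v k
      map_smul' := fun r u => by
        rw [RingHom.id_apply, hK r (u • k), ← mul_smul, smul_mul_assoc, one_mul] }, ?_, ?_, ?_, ?_⟩
  · intro k a x
    change s (a • x) k = _
    rw [hA, map_smul, Finsupp.smul_apply, smul_eq_mul, hmA]; rfl
  · intro k b x
    change s (b • x) k = _
    rw [hB, map_smul, Finsupp.smul_apply, smul_eq_mul, hmB]; rfl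
  · intro k a b
    exact TensorProduct.Algebra.smul_def a b k
  · intro c
    have h := hs (∑ t, c t • q t)
    conv_lhs => rw [← h]
    have hsub : (s (∑ t, c t • q t)).support ⊆ Finset.univ.biUnion fun t => (s (q t)).support := by
      intro k hk
      rw [Finsupp.mem_support_iff] at hk
      by_contra hk2
      apply hk
      rw [map_sum, Finsupp.finsetSum_apply]
      refine Finset.sum_eq_zero fun t _ => ?_
      rw [hB, map_smul, Finsupp.smul_apply]
      have : s (q t) k = 0 := by
        by_contra h3
        exact hk2 (Finset.mem_biUnion.2 ⟨t, Finset.mem_univ _, Finsupp.mem_support_iff.2 h3⟩)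
      rw [this, smul_zero]
    rw [Finsupp.linearCombination_apply]
    exact Finsupp.sum_of_support_subset _ hsub _ fun i _ => zero_smul (A ⊗[K] Bᵐᵒᵖ) (id i)

end KBimod

namespace RightFrame
open KBimod

variable {M : KBimod K A B} {N : KBimod K B C} {W : KBimod K A C} {ι κ : Type*} [Fintype ι]
  [Fintype κ]

theorem coord_smul (F : RightFrame B M.carrier ι) (i : ι) (r : K) (m : M.carrier) :
    F.coord i (r • m) = r • F.coord i m :=
  (F.coord i).map_smul_of_tower r m

/-- The coordinates on a balanced tensor product. -/
noncomputable def compCoord (F : RightFrame B M.carrier ι) (G : RightFrame C N.carrier κ)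
    (p : ι × κ) : BalancedTensor M N →ₗ[K] C :=
  balancedLift M N
    (LinearMap.mk₂ K (fun m n => G.coord p.2 (F.coord p.1 m • n))
      (fun m m' n => by simp [add_smul])
      (fun r m n => by rw [coord_smul, smul_assoc, coord_smul])
      (fun m n n' => by simp)
      (fun r m n => by
        rw [smul_comm (F.coord p.1 m) r n, coord_smul]))
    (fun m b n => by simp [mul_smul])

theorem compCoord_tmul (F : RightFrame B M.carrier ι) (G : RightFrame C N.carrier κ)
    (p : ι × κ) (m : M.carrier) (n : N.carrier) :
    F.compCoord G p (tmul M N m n) = G.coord p.2 (F.coord p.1 m • n) :=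
  balancedLift_tmul M N _ _ m n

/-- The frame of a balanced tensor product, transported to an isomorphic bimodule. -/
noncomputable def comp (F : RightFrame B M.carrier ι) (G : RightFrame C N.carrier κ)
    (φ : BalancedTensor M N ≃ₗ[K] W.carrier)
    (hφ : ∀ (c : C) (m : M.carrier) (n : N.carrier),
      φ (tmul M N m (MulOpposite.op c • n)) = MulOpposite.op c • φ (tmul M N m n)) :
    RightFrame C W.carrier (ι × κ) where
  vec p := φ (tmul M N (F.vec p.1) (G.vec p.2))
  coord p :=
    { toFun := fun y => F.compCoord G p (φ.symm y)
      map_add' := fun x y => by rw [map_add, map_add]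
      map_smul' := fun a y => by
        obtain ⟨l, x, z, hu⟩ := exists_eq_sum_tmul M N (φ.symm y)
        have hay : φ.symm (a • y) = ∑ i, tmul M N (x i) (a • z i) := by
          rw [LinearEquiv.symm_apply_eq, map_sum, ← φ.apply_symm_apply y, hu, map_sum,
            Finset.smul_sum]
          exact Finset.sum_congr rfl fun i _ => (hφ (unop a) _ _).symm
        rw [hay, hu]
        simp only [map_sum, compCoord_tmul, RingHom.id_apply, Finset.smul_sum]
        refine Finset.sum_congr rfl fun i _ => ?_
        rw [smul_comm, map_smul] }
  sum_coord y := by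
    obtain ⟨u, rfl⟩ : ∃ u, φ u = y := φ.surjective y
    simp only [LinearMap.coe_mk, AddHom.coe_mk, LinearEquiv.symm_apply_apply]
    obtain ⟨l, x, z, rfl⟩ := exists_eq_sum_tmul M N u
    simp only [map_sum, compCoord_tmul, Finset.op_sum, Finset.sum_smul]
    rw [Finset.sum_comm]
    refine Finset.sum_congr rfl fun i _ => ?_
    rw [Fintype.sum_prod_type]
    have h1 : ∀ i' j', op (G.coord j' (F.coord i' (x i) • z i)) •
        φ (tmul M N (F.vec i') (G.vec j')) =
        φ (tmulₗ M N (F.vec i') (op (G.coord j' (F.coord i' (x i) • z i)) • G.vec j')) :=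
      fun i' j' => (hφ _ _ _).symm
    simp only [h1, ← map_sum, G.sum_coord]
    congr 1
    simp only [tmulₗ_apply, ← tmul_balanced]
    rw [← tmulₗ_apply]
    conv_rhs => rw [← F.sum_coord (x i)]
    simp only [map_sum, LinearMap.sum_apply, tmulₗ_apply]

/-- The matrix on the tensor product is obtained by replacing each entry in `B` by its own matrix
over `C`. Composition of the trace maps and of the maps on differentials follows. -/
theorem comp_mat (F : RightFrame B M.carrier ι) (G : RightFrame C N.carrier κ)
    (φ : BalancedTensor M N ≃ₗ[K] W.carrier)
    (hφl : ∀ (a : A) (m : M.carrier) (n : N.carrier),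
      φ (tmul M N (a • m) n) = a • φ (tmul M N m n))
    (hφ : ∀ (c : C) (m : M.carrier) (n : N.carrier),
      φ (tmul M N m (MulOpposite.op c • n)) = MulOpposite.op c • φ (tmul M N m n)) (a : A)
    (p q : ι × κ) :
    (F.comp G φ hφ).mat a p q = G.mat (F.mat a p.1 q.1) p.2 q.2 := by
  have h : a • (F.comp G φ hφ).vec q = φ (tmul M N (a • F.vec q.1) (G.vec q.2)) := (hφl _ _ _).symm
  rw [mat, h]
  change F.compCoord G p (φ.symm _) = _
  rw [φ.symm_apply_apply, compCoord_tmul]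
  rfl

theorem trace_trace (F : RightFrame B M.carrier ι) (G : RightFrame C N.carrier κ)
    (φ : BalancedTensor M N ≃ₗ[K] W.carrier)
    (hφl : ∀ (a : A) (m : M.carrier) (n : N.carrier),
      φ (tmul M N (a • m) n) = a • φ (tmul M N m n))
    (hφ : ∀ (c : C) (m : M.carrier) (n : N.carrier),
      φ (tmul M N m (MulOpposite.op c • n)) = MulOpposite.op c • φ (tmul M N m n)) (a : A) :
    G.trace (F.trace a) = (F.comp G φ hφ).trace a := by
  simp only [trace_apply, comp_mat F G φ hφl, Fintype.sum_prod_type, ← matₗ_apply G, map_sum]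

theorem dtrace_dtrace (F : RightFrame B M.carrier ι) (G : RightFrame C N.carrier κ)
    (φ : BalancedTensor M N ≃ₗ[K] W.carrier)
    (hφl : ∀ (a : A) (m : M.carrier) (n : N.carrier),
      φ (tmul M N (a • m) n) = a • φ (tmul M N m n))
    (hφ : ∀ (c : C) (m : M.carrier) (n : N.carrier),
      φ (tmul M N m (MulOpposite.op c • n)) = MulOpposite.op c • φ (tmul M N m n)) (a b : A) :
    G.dtrace (F.dtrace (cdiff K a b)) = (F.comp G φ hφ).dtrace (cdiff K a b) := by
  simp only [dtrace_cdiff, comp_mat F G φ hφl, Fintype.sum_prod_type, map_sum]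
  exact Finset.sum_congr rfl fun i _ => Finset.sum_comm

end RightFrame

end StableTransfer

/-! ### Maps through projective bimodules are trace-null. -/

section CentralTransfer

variable {K : Type u} [Field K] {A B : Type u} [Ring A] [Algebra K A] [Ring B] [Algebra K B]

namespace RightFrame
open KBimod

/-- A map through `Q` is a finite sum of maps through `A ⊗ Bᵐᵒᵖ`, which has the shape `X ⊗ B` with
`X = A`. -/
theorem mem_traceNull_of_projective [CharP K 2] [Module.Finite K A] {W Q : KBimod K A B} {ι : Type*}
    [Fintype ι] (F : RightFrame B W.carrier ι) (hQ : Q.IsProjective)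
    {l : W.carrier →ₗ[K] Q.carrier} (hl : IsBimoduleMap l) {j : Q.carrier →ₗ[K] W.carrier}
    (hj : IsBimoduleMap j) : (fun w => j (l w)) ∈ F.traceNull := by
  obtain ⟨S, θ, R, hA, hB, hR, h⟩ := hQ.exists_dual fun t => l (F.vec t)
  have hw : (fun w => j (l w)) = ∑ k ∈ S, fun w => (j ∘ₗ R k) ((θ k ∘ₗ l) w) := by
    funext w
    have h2 : ∑ t, op (F.coord t w) • l (F.vec t) = l w := by
      rw [← hl.map_sum_smul]
      rw [F.sum_coord]
    have h1 := h fun t => op (F.coord t w)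
    rw [h2] at h1
    conv_lhs => rw [h1]
    simp
  rw [hw]
  refine sum_mem fun k _ => ?_
  refine F.mem_traceNull_of_tensor (X := A) (θ k ∘ₗ l).toAddMonoidHom
    (j ∘ₗ (LinearMap.toSpanSingleton A Q.carrier k).restrictScalars K) (j ∘ₗ R k) ?_ ?_ ?_ ?_
  · intro a y
    simp only [LinearMap.toAddMonoidHom_coe, LinearMap.comp_apply, hl.left, hA]
    rfl
  · intro b y
    simp only [LinearMap.toAddMonoidHom_coe, LinearMap.comp_apply, hl.right, hB]
  · intro a x
    simp [hj.left, mul_smul]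
  · intro x b
    simp only [LinearMap.comp_apply, hR, LinearMap.restrictScalars_apply,
      LinearMap.toSpanSingleton_apply]
    rw [smul_comm, hj.right]

/-- The map sends `m` to `∑ xᵢ ⊗ (yᵢ ⊗ m)`, applies an endomorphism through `Q` to the second factor
and contracts. It passes through `M ⊗_B (B ⊗ Bᵐᵒᵖ)`, that is, `M ⊗_K Bᵐᵒᵖ`, so
`mem_traceNull_of_tensor` applies with `X = M`. -/
theorem mem_traceNull_of_tensor_projective [CharP K 2] {M : KBimod K A B} {N : KBimod K B A}
    {Y Q : KBimod K B B} [Module.Finite K M.carrier] {ι : Type*} [Fintype ι]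
    (F : RightFrame B M.carrier ι) (hQ : Q.IsProjective)
    {l : Y.carrier →ₗ[K] Q.carrier} (hl : IsBimoduleMap l) {j : Q.carrier →ₗ[K] Y.carrier}
    (hj : IsBimoduleMap j) (τ : N.carrier →ₗ[K] M.carrier →ₗ[K] Y.carrier)
    (hτl : ∀ (b : B) n m, τ (b • n) m = b • τ n m)
    (hτr : ∀ (b : Bᵐᵒᵖ) n m, τ n (b • m) = b • τ n m)
    (hτ : ∀ (a : A) n m, τ (op a • n) m = τ n (a • m))
    (p : M.carrier →ₗ[K] Y.carrier →ₗ[K] M.carrier)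
    (hpl : ∀ (a : A) x y, p (a • x) y = a • p x y)
    (hpr : ∀ (b : Bᵐᵒᵖ) x y, p x (b • y) = b • p x y)
    (hp : ∀ (b : B) x y, p (op b • x) y = p x (b • y))
    {n : ℕ} (x : Fin n → M.carrier) (y : Fin n → N.carrier)
    (hxy : ∀ a : A, ∑ i, tmul M N (a • x i) (y i) = ∑ i, tmul M N (x i) (op a • y i)) :
    (fun m => ∑ i, p (x i) (j (l (τ (y i) m)))) ∈ F.traceNull := by
  classical
  obtain ⟨S, θ, R, hA, hB, hR, h⟩ := hQ.exists_dual fun t : Fin n × ι => l (τ (y t.1) (F.vec t.2))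
  let ra : M.carrier → B →ₗ[K] M.carrier := fun x =>
    { toFun := fun b => op b • x
      map_add' := fun b b' => by rw [op_add, add_smul]
      map_smul' := fun r b => by rw [op_smul, smul_assoc, RingHom.id_apply] }
  have hra : ∀ x b, ra x b = op b • x := fun _ _ => rfl
  have ra_add : ∀ x x', ra (x + x') = ra x + ra x' := fun x x' => by
    ext b; simp [hra]
  have ra_smul : ∀ (r : K) x, ra (r • x) = r • ra x := fun r x => by
    ext b; simp only [hra, LinearMap.smul_apply]; rw [smul_comm]
  have ra_op : ∀ (b : B) x, ra (op b • x) = ra x ∘ₗ LinearMap.mulLeft K b := fun b x => by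
    ext b'; simp [hra, ← mul_smul, ← op_mul]
  have ra_left : ∀ (a : A) x, ra (a • x) = (Algebra.lsmul K K M.carrier a) ∘ₗ ra x := fun a x => by
    ext b'; simp [hra, smul_comm]
  -- The relation `hxy` holds only in `M ⊗_B N`, so `A`-linearity of `s k` needs that `s k m`
  -- depends only on the class of `∑ xᵢ ⊗ yᵢ` there.
  let Ξ (k : Q.carrier) (m : M.carrier) : BalancedTensor M N →ₗ[K] M.carrier ⊗[K] Bᵐᵒᵖ :=
    balancedLift M N
      (LinearMap.mk₂ K (fun x n => (ra x).rTensor Bᵐᵒᵖ (θ k (l (τ n m))))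
        (fun x x' n => by rw [ra_add, LinearMap.rTensor_add, LinearMap.add_apply])
        (fun r x n => by rw [ra_smul, LinearMap.rTensor_smul, LinearMap.smul_apply])
        (fun x n n' => by simp)
        (fun r x n => by simp))
      (fun x b n => by
        simp only [LinearMap.mk₂_apply]
        rw [ra_op, hτl, hl.left, hA, LinearMap.rTensor_comp, LinearMap.comp_apply])
  have hΞ : ∀ k m x n, Ξ k m (tmul M N x n) = (ra x).rTensor Bᵐᵒᵖ (θ k (l (τ n m))) :=
    fun k m x n => balancedLift_tmul M N _ _ x n
  let s (k : Q.carrier) : M.carrier →ₗ[K] M.carrier ⊗[K] Bᵐᵒᵖ :=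
    ∑ i, (ra (x i)).rTensor Bᵐᵒᵖ ∘ₗ θ k ∘ₗ l ∘ₗ τ (y i)
  have hs : ∀ k m, s k m = ∑ i, (ra (x i)).rTensor Bᵐᵒᵖ (θ k (l (τ (y i) m))) := fun k m => by
    simp [s, LinearMap.sum_apply]
  let r (k : Q.carrier) : M.carrier →ₗ[K] M.carrier := p.flip (j k)
  let T (k : Q.carrier) : M.carrier ⊗[K] Bᵐᵒᵖ →ₗ[K] M.carrier :=
    TensorProduct.lift (LinearMap.mk₂ K (fun x b => b • r k x)
      (fun x x' b => by simp) (fun c x b => by rw [map_smul, smul_comm])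
      (fun x b b' => by rw [add_smul]) (fun c x b => by rw [smul_assoc]))
  have hT : ∀ k x b, T k (x ⊗ₜ b) = b • r k x := fun k x b => by simp [T]
  have hTR : ∀ k x u, T k ((ra x).rTensor Bᵐᵒᵖ u) = p x (j (R k u)) := fun k x u => by
    induction u with
    | zero => simp
    | add u v hu hv => simp only [map_add, hu, hv]
    | tmul b c =>
      rw [LinearMap.rTensor_tmul, hT, hR, hra]
      change c • p (op b • x) (j k) = _
      rw [hp, hj.left, hj.right, ← hpr, smul_comm b c]
  have hw : (fun m => ∑ i, p (x i) (j (l (τ (y i) m)))) = ∑ k ∈ S, fun m => T k (s k m) := by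
    funext m
    rw [Finset.sum_apply]
    simp only [hs, map_sum, hTR]
    rw [Finset.sum_comm]
    refine Finset.sum_congr rfl fun i _ => ?_
    -- The set `S` was chosen for all pairs of an index of `y` and a frame index; coefficients
    -- vanishing outside one `i` select `yᵢ`.
    have h2 : ∑ t : Fin n × ι, (if t.1 = i then op (F.coord t.2 m) else 0) •
        l (τ (y t.1) (F.vec t.2)) = l (τ (y i) m) := by
      rw [Fintype.sum_prod_type, Finset.sum_eq_single i]
      · simp only [if_true]
        conv_rhs => rw [← F.sum_coord m]
        simp only [map_sum, hτr, hl.right]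
      · intro i' _ hi
        simp [hi]
      · simp
    have h1 := h fun t => if t.1 = i then op (F.coord t.2 m) else 0
    rw [h2] at h1
    rw [← map_sum, ← map_sum, ← h1]
  rw [hw]
  refine sum_mem fun k _ => ?_
  refine F.mem_traceNull_of_tensor (X := M.carrier) (s k).toAddMonoidHom (r k) (T k) ?_ ?_ ?_ ?_
  · intro a m
    have e1 : s k (a • m) = Ξ k m (∑ i, tmul M N (x i) (op a • y i)) := by
      rw [hs, map_sum]
      simp only [hΞ, hτ]
    simp only [LinearMap.toAddMonoidHom_coe]
    rw [e1, ← hxy, map_sum, hs, map_sum]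
    simp only [hΞ, ra_left, LinearMap.rTensor_comp, LinearMap.comp_apply]
  · intro b m
    simp only [LinearMap.toAddMonoidHom_coe, hs, map_sum, hτr, hl.right, hB]
    refine Finset.sum_congr rfl fun i _ => ?_
    exact LinearMap.congr_fun ((LinearMap.rTensor_comp_lTensor _ _ _).trans
      (LinearMap.lTensor_comp_rTensor _ _ _).symm) _
  · intro a x
    exact hpl a x _
  · intro x b
    exact hT k x b

end RightFrame

end CentralTransfer

/-! ### Transfer of central elements along a stable equivalence. -/

section StableEquivalenceTransfer

variable {K : Type u} [Field K] {A B : Type u} [Ring A] [Algebra K A] [Ring B] [Algebra K B]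

namespace KBimod

/-- The first projection from `A × P`. -/
def regFst (P : KBimod K A A) : (regularProd P).carrier →ₗ[Aᵐᵒᵖ] A := LinearMap.fst Aᵐᵒᵖ A P.carrier

/-- The second projection from `A × P`. -/
def regSnd (P : KBimod K A A) : (regularProd P).carrier →ₗ[K] P.carrier := LinearMap.snd K A P.carrier

/-- The inclusion of `P` into `A × P`. -/
def regInr (P : KBimod K A A) : P.carrier →ₗ[K] (regularProd P).carrier := LinearMap.inr K A P.carrier

/-- The generator of the first summand of `A × P`. -/
def regOne (P : KBimod K A A) : (regularProd P).carrier := ((1 : A), (0 : P.carrier))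

theorem regSnd_isBimoduleMap (P : KBimod K A A) : IsBimoduleMap (N := P) (regSnd P) :=
  ⟨fun _ _ => rfl, fun _ _ => rfl⟩

theorem regInr_isBimoduleMap (P : KBimod K A A) : IsBimoduleMap (M := P) (regInr P) :=
  ⟨fun a _ => Prod.ext (smul_zero a).symm rfl, fun a _ => Prod.ext (smul_zero a).symm rfl⟩

theorem regFst_smul (P : KBimod K A A) (a : A) (w : (regularProd P).carrier) :
    regFst P (a • w) = a * regFst P w := rfl

@[simp] theorem regFst_one (P : KBimod K A A) : regFst P (regOne P) = 1 := rfl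

theorem smul_regOne (P : KBimod K A A) (a : A) : a • regOne P = op a • regOne P :=
  Prod.ext ((mul_one a).trans (one_mul a).symm) ((smul_zero a).trans (smul_zero (op a)).symm)

theorem reg_decomp (P : KBimod K A A) (w : (regularProd P).carrier) :
    op (regFst P w) • regOne P + regInr P (regSnd P w) = w :=
  Prod.ext ((add_zero _).trans (one_mul _))
    ((congrArg (· + (w : A × P.carrier).2) (smul_zero (op (regFst P w)))).trans (zero_add _))

end KBimod

namespace RightFrame
open KBimod

/-- Left multiplication by `x` on `A ⊕ P` splits into the part through `A`, whose trace is `x` by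
cyclicity, and the part through `P`, which is trace-null. -/
theorem trace_regularProd [CharP K 2] [Module.Finite K A] {P : KBimod K A A} {ι : Type*} [Fintype ι]
    (H : RightFrame A (regularProd P).carrier ι) (hP : P.IsProjective) {x : A}
    (hx : x ∈ squareKernel K A) : H.trace x - x ∈ commutatorSpan K A := by
  have h1 := H.sum_coord_factor_sub_mem (K := K) ((regularProd P).lmul x) (L := Unit)
    (fun _ => regOne P) (fun _ => regFst P)
  have h2 := (H.mem_traceNull_of_projective hP (regSnd_isBimoduleMap P)
    (regInr_isBimoduleMap P)).1 x hx
  simp only [Finset.univ_unique, Finset.sum_singleton, lmul_apply, regFst_smul, regFst_one,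
    mul_one] at h1
  have h3 := add_mem h1 h2
  rw [sub_add_eq_add_sub, ← Finset.sum_add_distrib] at h3
  simp only [← map_add, ← smul_add, reg_decomp] at h3
  rw [trace_apply]
  exact h3

/-- The multiplication by `z` is split along `A ⊕ P`. Cyclicity evaluates the summand through `A` as
`z dx`; the summand through `P` stays a bimodule map because `z` is central, so it drops out. -/
theorem dtrace_regularProd [CharP K 2] [Module.Finite K A] {P : KBimod K A A} {ι : Type*}
    [Fintype ι] (H : RightFrame A (regularProd P).carrier ι) (hP : P.IsProjective) {z : A}
    (hz : ∀ a, z * a = a * z) (x : A) : H.dtrace (cdiff K z x) = cdiff K z x := by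
  have h1 := H.sum_cdiff_factor (K := K) ((regularProd P).lmul x) (L := Unit)
    (fun _ => z • regOne P) (fun _ => regFst P) (fun _ _ => x)
    (fun _ y => by simp [regFst_smul])
    (fun _ => by
      simp only [Finset.univ_unique, Finset.sum_singleton, lmul_apply]
      rw [← smul_comm z (op x), ← smul_regOne, ← mul_smul, ← mul_smul, hz])
  have hj : IsBimoduleMap (M := P) ((Algebra.lsmul K K (regularProd P).carrier z) ∘ₗ regInr P) :=
    ⟨fun a y => by
      simp only [LinearMap.comp_apply, Algebra.lsmul_coe, (regInr_isBimoduleMap P).left,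
        ← mul_smul, hz],
    fun a y => by
      simp only [LinearMap.comp_apply, Algebra.lsmul_coe, (regInr_isBimoduleMap P).right]
      rw [smul_comm]⟩
  have h2 := (H.mem_traceNull_of_projective hP (regSnd_isBimoduleMap P) hj).2 x
  simp only [Finset.univ_unique, Finset.sum_singleton, lmul_apply, regFst_smul, regFst_one,
    mul_one] at h1
  have hsplit : ∀ i j, H.mat z i j = H.coord i (op (regFst P (H.vec j)) • z • regOne P) +
      H.coord i (z • regInr P (regSnd P (H.vec j))) := fun i j => by
    rw [mat, ← map_add, ← smul_comm z (op _), ← smul_add, reg_decomp]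
  rw [dtrace_cdiff]
  simp only [hsplit, map_add, LinearMap.add_apply, Finset.sum_add_distrib]
  exact (congrArg₂ _ h1 h2).trans (add_zero _)

variable {M : KBimod K A B} {N : KBimod K B A}

/-- With `E` the idempotent matrix of the frame, the claim is `tr (zE dX) = z d(tr X)`. Substituting
`X = EX` on the right gives the left side plus the error `tr (Xz dE)`. -/
theorem sum_cdiff_coord_mul_central {ι : Type*} [Fintype ι] (F : RightFrame B M.carrier ι) {z : B}
    (hz : ∀ b, z * b = b * z) (x : A) :
    ∑ i, ∑ j, cdiff K (F.coord i (op z • F.vec j)) (F.mat x j i) = cdiff K z (F.trace x) := by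
  have hE : ∀ y l, F.coord l y = ∑ j, F.coord l (F.vec j) * F.coord j y :=
    fun y l => F.map_eq_sum _ _
  have hX : ∀ l m, F.mat x l m = ∑ j, F.coord l (F.vec j) * F.mat x j m := fun l m => hE _ _
  have hX2 : ∀ l m, F.mat x l m = ∑ j, F.mat x l j * F.coord j (F.vec m) := fun l m =>
    F.map_eq_sum (F.coord l ∘ₗ M.lmul x) (F.vec m)
  -- Expanding `dE = d(EE)` and absorbing `E` through `XE = X = EX` shows that this error equals its
  -- own double.
  have hD : ∑ l, ∑ j, cdiff K (F.mat x j l * z) (F.coord l (F.vec j)) = 0 := by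
    have e : ∑ l, ∑ j, cdiff K (F.mat x j l * z) (F.coord l (F.vec j)) =
        ∑ l, ∑ j, cdiff K (F.mat x j l * z) (F.coord l (F.vec j)) +
        ∑ l, ∑ j, cdiff K (F.mat x j l * z) (F.coord l (F.vec j)) := by
      conv_lhs =>
        enter [2, l, 2, j]
        rw [hE (F.vec j) l]
      simp only [map_sum, cdiff_mul, Finset.sum_add_distrib]
      congr 1
      · rw [Finset.sum_congr rfl fun l _ => Finset.sum_comm, Finset.sum_comm]
        refine Finset.sum_congr rfl fun m _ => ?_
        rw [Finset.sum_comm]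
        refine Finset.sum_congr rfl fun j _ => ?_
        rw [hX2 j m, Finset.sum_mul, map_sum, LinearMap.sum_apply]
        refine Finset.sum_congr rfl fun l _ => ?_
        rw [mul_assoc, hz, mul_assoc]
      · refine Finset.sum_congr rfl fun l _ => ?_
        rw [Finset.sum_comm]
        refine Finset.sum_congr rfl fun m _ => ?_
        rw [hX m l, Finset.sum_mul, map_sum, LinearMap.sum_apply]
        refine Finset.sum_congr rfl fun j _ => ?_
        rw [mul_assoc]
    exact left_eq_add.1 e
  rw [trace_apply]
  conv_rhs =>
    enter [2, 2, l]
    rw [hX l l]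
  simp only [map_sum, cdiff_mul, Finset.sum_add_distrib]
  rw [hD, add_zero]
  refine Finset.sum_congr rfl fun i _ => Finset.sum_congr rfl fun j _ => ?_
  rw [map_smul, op_smul_eq_mul, hz]

/-- If `z` on the left and `z'` on the right agree on `M` up to a trace-null map, each trace may be
computed with `z'` in place of `z`. -/
theorem exists_central_of_traceNull [CharP K 2] {ι : Type*} [Fintype ι]
    (F : RightFrame B M.carrier ι) {z : A} (hz : ∀ a, z * a = a * z) {z' : B}
    (hz' : ∀ b, z' * b = b * z') {δ : M.carrier → M.carrier} (hδ : δ ∈ F.traceNull)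
    (h : ∀ m, z • m = op z' • m + δ m) :
    (∀ x ∈ squareKernel K A, F.trace (z * x) - z' * F.trace x ∈ commutatorSpan K B) ∧
      ∀ x, F.dtrace (cdiff K z x) = cdiff K z' (F.trace x) := by
  refine ⟨fun x hx => ?_, fun x => ?_⟩
  · have e : F.trace (z * x) - z' * F.trace x = ∑ i, F.coord i (x • δ (F.vec i)) := by
      rw [trace_apply, trace_apply, Finset.mul_sum, ← Finset.sum_sub_distrib]
      refine Finset.sum_congr rfl fun i _ => ?_
      rw [mat, mat, hz, mul_smul, h, smul_add, map_add, smul_comm, map_smul, op_smul_eq_mul, hz',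
        add_sub_cancel_left]
    rw [e]
    exact hδ.1 x hx
  · rw [dtrace_cdiff, ← sum_cdiff_coord_mul_central F hz', ← add_zero (∑ i, ∑ j, cdiff K
      (F.coord i (op z' • F.vec j)) _), ← hδ.2 x, ← Finset.sum_add_distrib]
    refine Finset.sum_congr rfl fun i _ => ?_
    rw [← Finset.sum_add_distrib]
    refine Finset.sum_congr rfl fun j _ => ?_
    rw [← LinearMap.add_apply, ← map_add, ← map_add, ← h]
    rfl

/-- The identity of `M` is written as `M → M ⊗ N ⊗ M → M`. Letting `z` act on the last factor gives
an endomorphism `g` of `N ⊗_A M ≅ B ⊕ Q`. Its component `B → B` is multiplication by a central `z'`,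
and everything else passes through `Q`. -/
theorem exists_central_transfer [CharP K 2] [Module.Finite K M.carrier] {P : KBimod K A A}
    {Q : KBimod K B B} {ι : Type*} [Fintype ι] (F : RightFrame B M.carrier ι)
    (hQ : Q.IsProjective) (φ : BalancedTensor M N ≃ₗ[K] (regularProd P).carrier)
    (hφl : ∀ (a : A) m n, φ (tmul M N (a • m) n) = a • φ (tmul M N m n))
    (hφr : ∀ (a : A) m n, φ (tmul M N m (op a • n)) = op a • φ (tmul M N m n))
    (ψ : BalancedTensor N M ≃ₗ[K] (regularProd Q).carrier)
    (hψl : ∀ (b : B) n m, ψ (tmul N M (b • n) m) = b • ψ (tmul N M n m))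
    (hψr : ∀ (b : B) n m, ψ (tmul N M n (op b • m)) = op b • ψ (tmul N M n m))
    {z : A} (hz : ∀ a, z * a = a * z) :
    ∃ z' : B, (∀ b, z' * b = b * z') ∧
      (∀ x ∈ squareKernel K A, F.trace (z * x) - z' * F.trace x ∈ commutatorSpan K B) ∧
      ∀ x, F.dtrace (cdiff K z x) = cdiff K z' (F.trace x) := by
  let pr : M.carrier →ₗ[K] N.carrier →ₗ[K] A :=
    (tmulₗ M N).compr₂ ((regFst P).restrictScalars K ∘ₗ φ.toLinearMap)
  have hprdef : ∀ m n, pr m n = regFst P (φ (tmul M N m n)) := fun m n => rfl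
  let τ : N.carrier →ₗ[K] M.carrier →ₗ[K] (regularProd Q).carrier :=
    (tmulₗ N M).compr₂ ψ.toLinearMap
  have hτdef : ∀ n m, τ n m = ψ (tmul N M n m) := fun n m => rfl
  have hspan : ∀ y : (regularProd Q).carrier, ∃ (l : ℕ) (n : Fin l → N.carrier)
      (m : Fin l → M.carrier), y = ∑ i, τ (n i) (m i) := fun y => by
    obtain ⟨l, n, m, h⟩ := exists_eq_sum_tmul N M (ψ.symm y)
    exact ⟨l, n, m, by rw [← ψ.apply_symm_apply y, h, map_sum]; rfl⟩
  have hτl : ∀ (b : B) n m, τ (b • n) m = b • τ n m := fun b n m => hψl b n m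
  have hτr : ∀ (b : Bᵐᵒᵖ) n m, τ n (b • m) = b • τ n m := fun b n m => hψr (unop b) n m
  have hτ : ∀ (a : A) n m, τ (op a • n) m = τ n (a • m) := fun a n m => by
    rw [hτdef, hτdef, tmul_balanced]
  let L : M.carrier → BalancedTensor N M →ₗ[K] M.carrier := fun x =>
    balancedLift N M (LinearMap.mk₂ K (fun n m => pr x n • m)
      (fun n n' m => by rw [map_add, add_smul])
      (fun r n m => by rw [map_smul, smul_assoc])
      (fun n m m' => by simp)
      (fun r n m => by rw [smul_comm]))
      (fun n a m => by
        simp only [LinearMap.mk₂_apply, hprdef]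
        rw [hφr, map_smul, op_smul_eq_mul, mul_smul])
  have hL : ∀ x n m, L x (tmul N M n m) = pr x n • m := fun x n m => balancedLift_tmul N M _ _ n m
  have hLτ : ∀ x n m, L x (ψ.symm (τ n m)) = pr x n • m := fun x n m => by
    rw [hτdef, ψ.symm_apply_apply, hL]
  let p : M.carrier →ₗ[K] (regularProd Q).carrier →ₗ[K] M.carrier :=
    LinearMap.mk₂ K (fun x y => L x (ψ.symm y))
      (fun x x' y => by
        obtain ⟨l, n, m, rfl⟩ := hspan y
        simp only [map_sum, hLτ, ← Finset.sum_add_distrib, ← add_smul, map_add,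
          LinearMap.add_apply])
      (fun r x y => by
        obtain ⟨l, n, m, rfl⟩ := hspan y
        simp only [map_sum, hLτ, Finset.smul_sum]
        refine Finset.sum_congr rfl fun i _ => ?_
        rw [map_smul, LinearMap.smul_apply, smul_assoc])
      (fun x y y' => by simp)
      (fun r x y => by simp)
  have hp0 : ∀ x n m, p x (τ n m) = pr x n • m := hLτ
  have hpl : ∀ (a : A) x y, p (a • x) y = a • p x y := fun a x y => by
    obtain ⟨l, n, m, rfl⟩ := hspan y
    simp only [map_sum, hp0, Finset.smul_sum]
    refine Finset.sum_congr rfl fun i _ => ?_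
    rw [hprdef, hprdef, hφl, regFst_smul, mul_smul]
  have hpr : ∀ (b : Bᵐᵒᵖ) x y, p x (b • y) = b • p x y := fun b x y => by
    obtain ⟨l, n, m, rfl⟩ := hspan y
    simp only [Finset.smul_sum, map_sum, ← hτr, hp0]
    exact Finset.sum_congr rfl fun i _ => smul_comm _ _ _
  have hp : ∀ (b : B) x y, p (op b • x) y = p x (b • y) := fun b x y => by
    obtain ⟨l, n, m, rfl⟩ := hspan y
    simp only [Finset.smul_sum, map_sum, ← hτl, hp0]
    refine Finset.sum_congr rfl fun i _ => ?_
    rw [hprdef, hprdef, tmul_balanced]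
  -- `∑ xsᵢ ⊗ ysᵢ` corresponds to the unit of `A`: it commutes with `A`, and contracting it with `m`
  -- returns `m`.
  obtain ⟨n, xs, ys, hξ⟩ := exists_eq_sum_tmul M N (φ.symm (regOne P))
  have hξ' : ∑ i, φ (tmul M N (xs i) (ys i)) = regOne P := by
    rw [← map_sum, ← hξ, φ.apply_symm_apply]
  have hxy : ∀ a : A, ∑ i, tmul M N (a • xs i) (ys i) = ∑ i, tmul M N (xs i) (op a • ys i) := by
    intro a
    apply φ.injective
    simp only [map_sum, hφl, hφr, ← Finset.smul_sum, hξ', smul_regOne]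
  have hone : ∑ i, pr (xs i) (ys i) = 1 := by
    simp only [hprdef, ← map_sum]
    rw [map_sum, hξ', regFst_one]
  have hid : ∀ m, ∑ i, p (xs i) (τ (ys i) m) = m := fun m => by
    simp only [hp0, ← Finset.sum_smul, hone, one_smul]
  -- The action of `z` on the second factor is balanced over `A` precisely because `z` is central.
  let gl : BalancedTensor N M →ₗ[K] BalancedTensor N M :=
    balancedLift N M ((tmulₗ N M).compl₂ (Algebra.lsmul K K M.carrier z))
      (fun n a m => by
        simp only [LinearMap.compl₂_apply, Algebra.lsmul_coe, tmulₗ_apply]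
        rw [tmul_balanced, ← mul_smul, ← mul_smul, hz])
  have hgl : ∀ n m, gl (tmul N M n m) = tmul N M n (z • m) := fun n m =>
    balancedLift_tmul N M _ _ n m
  let g : (regularProd Q).carrier →ₗ[K] (regularProd Q).carrier :=
    ψ.toLinearMap ∘ₗ gl ∘ₗ ψ.symm.toLinearMap
  have hg : ∀ n m, g (τ n m) = τ n (z • m) := fun n m => by
    change ψ (gl (ψ.symm (ψ (tmul N M n m)))) = ψ (tmul N M n (z • m))
    rw [ψ.symm_apply_apply, hgl]
  have hgB : IsBimoduleMap g := by
    refine ⟨fun b y => ?_, fun b y => ?_⟩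
    · obtain ⟨l, n, m, rfl⟩ := hspan y
      simp only [Finset.smul_sum, map_sum, ← hτl, hg]
    · obtain ⟨l, n, m, rfl⟩ := hspan y
      simp only [Finset.smul_sum, map_sum, ← hτr, hg]
      exact Finset.sum_congr rfl fun i _ => by rw [smul_comm]
  set z' : B := regFst Q (g (regOne Q)) with hz'def
  set q₀ : Q.carrier := regSnd Q (g (regOne Q)) with hq₀
  have hgone : ∀ b : B, b • g (regOne Q) = op b • g (regOne Q) := fun b => by
    rw [← hgB.left, ← hgB.right, smul_regOne]
  have hz' : ∀ b, z' * b = b * z' := fun b => by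
    have := congrArg (regFst Q) (hgone b)
    rw [regFst_smul, map_smul, op_smul_eq_mul] at this
    exact this.symm
  have hq : ∀ b : B, b • q₀ = op b • q₀ := fun b => by
    have := congrArg (regSnd Q) (hgone b)
    rwa [(regSnd_isBimoduleMap Q).left, (regSnd_isBimoduleMap Q).right] at this
  -- The difference between `g` and right multiplication by `z'` is the sum of two maps through `Q`:
  -- `j₁` after the projection to `Q`, and the inclusion of `Q` after `l₂`.
  let j₁ : Q.carrier →ₗ[K] (regularProd Q).carrier :=
    g ∘ₗ regInr Q - regInr Q ∘ₗ Algebra.lsmul K K Q.carrier (op z')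
  have hj₁ : IsBimoduleMap j₁ := by
    refine ⟨fun b y => ?_, fun b y => ?_⟩
    · simp only [j₁, LinearMap.sub_apply, LinearMap.comp_apply, (regInr_isBimoduleMap Q).left,
        hgB.left, Algebra.lsmul_coe, smul_sub]
      rw [← (regInr_isBimoduleMap Q).left, smul_comm b (op z') y]
    · simp only [j₁, LinearMap.sub_apply, LinearMap.comp_apply, (regInr_isBimoduleMap Q).right,
        hgB.right, Algebra.lsmul_coe, smul_sub]
      have : op z' * b = b * op z' := unop_injective (by simp [hz'])
      rw [← mul_smul, ← mul_smul, this]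
  -- This is right linear because `q₀` commutes with `B`, being a component of the image of the unit
  -- under the bimodule map `g`.
  let l₂ : (regularProd Q).carrier →ₗ[K] Q.carrier :=
    (LinearMap.toSpanSingleton B Q.carrier q₀).restrictScalars K ∘ₗ (regFst Q).restrictScalars K
  have hl₂d : ∀ y, l₂ y = regFst Q y • q₀ := fun y => rfl
  have hl₂ : IsBimoduleMap l₂ := by
    refine ⟨fun b y => ?_, fun b y => ?_⟩
    · rw [hl₂d, hl₂d, regFst_smul, mul_smul]
    · rw [hl₂d, hl₂d, map_smul]
      change (regFst Q y * unop b) • q₀ = _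
      rw [mul_smul, hq, op_unop, smul_comm]
  refine ⟨z', hz', F.exists_central_of_traceNull hz hz' (add_mem
    (F.mem_traceNull_of_tensor_projective hQ (regSnd_isBimoduleMap Q) hj₁ τ hτl hτr hτ p hpl hpr hp
      xs ys hxy)
    (F.mem_traceNull_of_tensor_projective hQ hl₂ (regInr_isBimoduleMap Q) τ hτl hτr hτ p hpl hpr hp
      xs ys hxy)) fun m => ?_⟩
  have e1 : z • m = ∑ i, p (xs i) (g (τ (ys i) m)) := by
    simp only [hg]; exact (hid _).symm
  have e2 : op z' • m = ∑ i, p (xs i) (op z' • τ (ys i) m) := by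
    simp only [← hτr]; exact (hid _).symm
  rw [e1, e2, Pi.add_apply, ← Finset.sum_add_distrib, ← Finset.sum_add_distrib]
  refine Finset.sum_congr rfl fun i _ => ?_
  rw [← map_add, ← map_add]
  congr 1
  generalize τ (ys i) m = y
  conv_lhs => rw [← reg_decomp Q y]
  conv_rhs => enter [1]; rw [← reg_decomp Q y]
  rw [map_add, hgB.right, ← hgone, smul_add, ← (regInr_isBimoduleMap Q).right, ← reg_decomp Q (g (regOne Q)), smul_add, ← (regInr_isBimoduleMap Q).left]
  simp only [j₁, LinearMap.sub_apply, LinearMap.comp_apply, Algebra.lsmul_coe, hl₂d]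
  rw [← hz'def, ← hq₀]
  have : regFst Q y • op z' • regOne Q = op z' • op (regFst Q y) • regOne Q := by
    rw [smul_comm, smul_regOne]
  rw [this]
  abel

end RightFrame

end StableEquivalenceTransfer

/-! ### The data extracted from a stable equivalence. -/

section StableTransferPair

/-- Maps between two algebras that are mutually inverse on the square kernels modulo commutators and
on the differentials with central coefficients, and compatible with the centres. -/
structure StableTransfer (K : Type u) [Field K] [CharP K 2] (A B : Type u) [Ring A] [Algebra K A]
    [Ring B] [Algebra K B] where
  map : A →ₗ[K] B
  inv : B →ₗ[K] A
  dmap : CyclicDiff K A →ₗ[K] CyclicDiff K B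
  dinv : CyclicDiff K B →ₗ[K] CyclicDiff K A
  map_comm : ∀ x ∈ commutatorSpan K A, map x ∈ commutatorSpan K B
  inv_comm : ∀ x ∈ commutatorSpan K B, inv x ∈ commutatorSpan K A
  map_square : ∀ x ∈ squareKernel K A, map x ∈ squareKernel K B
  inv_square : ∀ x ∈ squareKernel K B, inv x ∈ squareKernel K A
  inv_map : ∀ x ∈ squareKernel K A, inv (map x) - x ∈ commutatorSpan K A
  map_inv : ∀ x ∈ squareKernel K B, map (inv x) - x ∈ commutatorSpan K B
  dinv_dmap : ∀ z : A, (∀ a, z * a = a * z) → ∀ x, dinv (dmap (cdiff K z x)) = cdiff K z x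
  map_central : ∀ z : A, (∀ a, z * a = a * z) → ∃ z' : B, (∀ b, z' * b = b * z') ∧
    (∀ x ∈ squareKernel K A, map (z * x) - z' * map x ∈ commutatorSpan K B) ∧
    ∀ x, dmap (cdiff K z x) = cdiff K z' (map x)
  inv_central : ∀ z : B, (∀ a, z * a = a * z) → ∃ z' : A, (∀ b, z' * b = b * z') ∧
    ∀ x ∈ squareKernel K B, inv (z * x) - z' * inv x ∈ commutatorSpan K A

open KBimod in
theorem StablyEquivalentOfMoritaType.exists_transfer {K : Type u} [Field K] [CharP K 2]
    {A B : Type u} [Ring A] [Algebra K A] [Ring B] [Algebra K B] [Module.Finite K A]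
    [Module.Finite K B] (h : StablyEquivalentOfMoritaType K A B) :
    Nonempty (StableTransfer K A B) := by
  obtain ⟨M, N, P, Q, ⟨hM1, -, hM2, hM3⟩, ⟨hN1, -, hN2, hN3⟩, hP, hQ, ⟨φ, hφl, hφr⟩,
    ⟨ψ, hψl, hψr⟩⟩ := h
  obtain ⟨m, ⟨F⟩⟩ := RightFrame.exists_of_projective B M.carrier
  obtain ⟨n, ⟨G⟩⟩ := RightFrame.exists_of_projective A N.carrier
  have : Module.Finite K M.carrier := Module.Finite.trans A M.carrier
  have : Module.Finite K N.carrier := Module.Finite.trans B N.carrier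
  let φ' : BalancedTensor M N ≃ₗ[K] (regularProd P).carrier := φ
  let ψ' : BalancedTensor N M ≃ₗ[K] (regularProd Q).carrier := ψ
  exact ⟨{
    map := F.trace
    inv := G.trace
    dmap := F.dtrace
    dinv := G.dtrace
    map_comm := fun x hx => F.trace_mem_commutatorSpan hx
    inv_comm := fun x hx => G.trace_mem_commutatorSpan hx
    map_square := fun x hx => F.trace_mem_squareKernel hx
    inv_square := fun x hx => G.trace_mem_squareKernel hx
    inv_map := fun x hx => by
      rw [F.trace_trace G φ' hφl hφr]
      exact RightFrame.trace_regularProd _ hP hx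
    map_inv := fun x hx => by
      rw [G.trace_trace F ψ' hψl hψr]
      exact RightFrame.trace_regularProd _ hQ hx
    dinv_dmap := fun z hz x => by
      rw [F.dtrace_dtrace G φ' hφl hφr]
      exact RightFrame.dtrace_regularProd _ hP hz x
    map_central := fun z hz => F.exists_central_transfer hQ φ' hφl hφr ψ' hψl hψr hz
    inv_central := fun z hz => by
      obtain ⟨z', h1, h2, -⟩ := G.exists_central_transfer hP ψ' hψl hψr φ' hφl hφr hz
      exact ⟨z', h1, h2⟩ }⟩

end StableTransferPair

/-! ### Invariants of the data: nilpotent central elements and the second socle. -/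

section Invariants

variable {K : Type u} [Field K] [CharP K 2] {A B : Type u} [Ring A] [Algebra K A]
    [Ring B] [Algebra K B]

variable (K A) in
/-- The central elements acting nilpotently on the square kernel modulo commutators. -/
def nilCentral : Set A :=
  {z | (∀ a, z * a = a * z) ∧ ∃ n : ℕ, ∀ x ∈ squareKernel K A, z ^ n * x ∈ commutatorSpan K A}

variable (K A) in
/-- The elements of the square kernel that are killed, modulo commutators, by all products of two
elements of `nilCentral`. -/
def secondSocle : Submodule K A where
  carrier := {x | x ∈ squareKernel K A ∧
    ∀ z ∈ nilCentral K A, ∀ z' ∈ nilCentral K A, z * (z' * x) ∈ commutatorSpan K A}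
  zero_mem' := by simp
  add_mem' {x y} hx hy := ⟨add_mem hx.1 hy.1, fun z hz z' hz' => by
    rw [mul_add, mul_add]; exact add_mem (hx.2 z hz z' hz') (hy.2 z hz z' hz')⟩
  smul_mem' r x hx := ⟨Submodule.smul_mem _ _ hx.1, fun z hz z' hz' => by
    rw [mul_smul_comm, mul_smul_comm]; exact Submodule.smul_mem _ _ (hx.2 z hz z' hz')⟩

namespace StableTransfer

theorem map_mem_iff (T : StableTransfer K A B) {x : A} (hx : x ∈ squareKernel K A) :
    T.map x ∈ commutatorSpan K B ↔ x ∈ commutatorSpan K A := by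
  refine ⟨fun h => ?_, T.map_comm x⟩
  have h1 := T.inv_map x hx
  have h2 := sub_mem (T.inv_comm _ h) h1
  rwa [sub_sub_cancel] at h2

theorem inv_mem_iff (T : StableTransfer K A B) {x : B} (hx : x ∈ squareKernel K B) :
    T.inv x ∈ commutatorSpan K A ↔ x ∈ commutatorSpan K B := by
  refine ⟨fun h => ?_, T.inv_comm x⟩
  have h1 := T.map_inv x hx
  have h2 := sub_mem (T.map_comm _ h) h1
  rwa [sub_sub_cancel] at h2

theorem pow_mul_transfer {f : A →ₗ[K] B} {z : A} (hz : ∀ a, z * a = a * z) {z' : B} (hz' : ∀ b, z' * b = b * z')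
    (h : ∀ x ∈ squareKernel K A, f (z * x) - z' * f x ∈ commutatorSpan K B) (n : ℕ) :
    ∀ x ∈ squareKernel K A, f (z ^ n * x) - z' ^ n * f x ∈ commutatorSpan K B := by
  induction n with
  | zero => simp
  | succ n ih =>
    intro x hx
    have h1 := ih (z * x) (central_mul_mem_squareKernel hz hx)
    have hzn : ∀ b, z' ^ n * b = b * z' ^ n := fun b => Commute.pow_left (hz' b) n
    have h2 := central_mul_mem_commutatorSpan hzn (h x hx)
    have h3 := add_mem h1 h2
    rw [mul_sub, sub_add_sub_cancel, ← mul_assoc, ← mul_assoc, ← pow_succ, ← pow_succ] at h3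
    exact h3

/-- The exponent that works for `z` works for `z'`: on `squareKernel` of `B` the composite `map ∘
inv` is the identity modulo commutators, and `map` turns `zⁿ` into `z'ⁿ`. -/
theorem exists_map_nilCentral (T : StableTransfer K A B) {z : A} (hz : z ∈ nilCentral K A) : ∃ z' ∈ nilCentral K B,
    (∀ x ∈ squareKernel K A, T.map (z * x) - z' * T.map x ∈ commutatorSpan K B) ∧
    ∀ x, T.dmap (cdiff K z x) = cdiff K z' (T.map x) := by
  obtain ⟨hz, n, hn⟩ := hz
  obtain ⟨z', hz', h1, h2⟩ := T.map_central z hz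
  refine ⟨z', ⟨hz', n, fun y hy => ?_⟩, h1, h2⟩
  have hzn : ∀ b, z' ^ n * b = b * z' ^ n := fun b => Commute.pow_left (hz' b) n
  have h3 := pow_mul_transfer hz hz' h1 n _ (T.inv_square y hy)
  have h4 := sub_mem (T.map_comm _ (hn _ (T.inv_square y hy))) h3
  rw [sub_sub_cancel] at h4
  have h5 := sub_mem h4 (central_mul_mem_commutatorSpan hzn (T.map_inv y hy))
  rwa [← mul_sub, sub_sub_cancel] at h5

theorem exists_inv_nilCentral (T : StableTransfer K A B) {z : B} (hz : z ∈ nilCentral K B) : ∃ z' ∈ nilCentral K A,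
    ∀ x ∈ squareKernel K B, T.inv (z * x) - z' * T.inv x ∈ commutatorSpan K A := by
  obtain ⟨hz, n, hn⟩ := hz
  obtain ⟨z', hz', h1⟩ := T.inv_central z hz
  refine ⟨z', ⟨hz', n, fun y hy => ?_⟩, h1⟩
  have hzn : ∀ b, z' ^ n * b = b * z' ^ n := fun b => Commute.pow_left (hz' b) n
  have h3 := pow_mul_transfer hz hz' h1 n _ (T.map_square y hy)
  have h4 := sub_mem (T.inv_comm _ (hn _ (T.map_square y hy))) h3
  rw [sub_sub_cancel] at h4
  have h5 := sub_mem h4 (central_mul_mem_commutatorSpan hzn (T.inv_map y hy))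
  rwa [← mul_sub, sub_sub_cancel] at h5

/-- Since `inv` detects commutators on `squareKernel`, the test elements of `nilCentral K B` may be
carried back to `A`, where the hypothesis on `x` applies. -/
theorem map_mem_secondSocle (T : StableTransfer K A B) {x : A} (hx : x ∈ secondSocle K A) : T.map x ∈ secondSocle K B := by
  refine ⟨T.map_square x hx.1, fun y hy y' hy' => ?_⟩
  have hmx := T.map_square x hx.1
  obtain ⟨z, hz, h1⟩ := T.exists_inv_nilCentral hy
  obtain ⟨z', hz', h1'⟩ := T.exists_inv_nilCentral hy'
  have hy'x := central_mul_mem_squareKernel hy'.1 hmx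
  rw [← T.inv_mem_iff (central_mul_mem_squareKernel hy.1 hy'x)]
  have e1 := h1 _ hy'x
  have e2 := central_mul_mem_commutatorSpan hz.1 (h1' _ hmx)
  have e3 := central_mul_mem_commutatorSpan hz.1
    (central_mul_mem_commutatorSpan hz'.1 (T.inv_map x hx.1))
  have e4 := add_mem (add_mem (add_mem e1 e2) e3) (hx.2 z hz z' hz')
  simpa only [mul_sub, sub_add_sub_cancel, sub_add_cancel] using e4

/-- The transfer maps bound the dimensions modulo commutators. -/
theorem card_le_card (T : StableTransfer K A B) {U : Submodule K A} (hU : U ≤ squareKernel K A) {V : Submodule K B}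
    (hUV : ∀ x ∈ U, T.map x ∈ V) {ι κ : Type*} [Fintype ι] [Fintype κ] (v : ι → A)
    (hv : ∀ i, v i ∈ U)
    (hli : ∀ c : ι → K, ∑ i, c i • v i ∈ commutatorSpan K A → ∀ i, c i = 0) (w : κ → B)
    (hw : V ≤ commutatorSpan K B ⊔ Submodule.span K (Set.range w)) :
    Fintype.card ι ≤ Fintype.card κ := by
  classical
  let q := (commutatorSpan K B).mkQ
  have h1 : LinearIndependent K fun i => q (T.map (v i)) := by
    rw [Fintype.linearIndependent_iff]
    intro c hc
    apply hli c
    rw [← T.map_mem_iff (Submodule.sum_mem _ fun i _ => Submodule.smul_mem _ _ (hU (hv i))),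
      ← Submodule.Quotient.mk_eq_zero]
    change q _ = 0
    rw [← hc]
    simp only [map_sum, map_smul]
  have h2 : Set.range (fun i => q (T.map (v i))) ⊆
      Submodule.span K (Set.range fun j => q (w j)) := by
    rintro _ ⟨i, rfl⟩
    obtain ⟨a, ha, b, hb, hab⟩ := Submodule.mem_sup.1 (hw (hUV _ (hv i)))
    have ha0 : q a = 0 := (Submodule.Quotient.mk_eq_zero _).2 ha
    simp only [SetLike.mem_coe]
    rw [← hab, map_add, ha0, zero_add]
    have := Submodule.mem_map_of_mem (f := q) hb
    rwa [Submodule.map_span, ← Set.range_comp] at this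
  have h3 := linearIndependent_le_span_aux' _ h1 _ h2
  calc Fintype.card ι ≤ Fintype.card (Set.range fun j => q (w j)) := h3
    _ ≤ Fintype.card κ := Fintype.card_range_le _

/-- Under the transfer `z₁ dx` and `z₂ dx` become differentials of the same element of `secondSocle
K B`, hence multiples `s₁ L` and `s₂ L`. A linear relation found there comes back through `dinv`. -/
theorem exists_dependent (T : StableTransfer K A B) {x : A} (hx : x ∈ secondSocle K A) {z₁ z₂ : A}
    (hz₁ : z₁ ∈ nilCentral K A) (hz₂ : z₂ ∈ nilCentral K A)
    (h : ∀ y ∈ secondSocle K B, ∃ L : CyclicDiff K B, ∀ z ∈ nilCentral K B,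
      ∃ r : K, cdiff K z y = r • L) :
    ∃ r₁ r₂ : K, (r₁ ≠ 0 ∨ r₂ ≠ 0) ∧ r₁ • cdiff K z₁ x + r₂ • cdiff K z₂ x = 0 := by
  obtain ⟨L, hL⟩ := h _ (T.map_mem_secondSocle hx)
  obtain ⟨y₁, hy₁, -, h1⟩ := T.exists_map_nilCentral hz₁
  obtain ⟨y₂, hy₂, -, h2⟩ := T.exists_map_nilCentral hz₂
  obtain ⟨s₁, hs₁⟩ := hL y₁ hy₁
  obtain ⟨s₂, hs₂⟩ := hL y₂ hy₂
  have key : ∀ r₁ r₂ : K, r₁ * s₁ + r₂ * s₂ = 0 →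
      r₁ • cdiff K z₁ x + r₂ • cdiff K z₂ x = 0 := fun r₁ r₂ hr => by
    have e : r₁ • cdiff K z₁ x + r₂ • cdiff K z₂ x =
        T.dinv (T.dmap (r₁ • cdiff K z₁ x + r₂ • cdiff K z₂ x)) := by
      simp only [map_add, map_smul, T.dinv_dmap z₁ hz₁.1, T.dinv_dmap z₂ hz₂.1]
    rw [e, map_add, map_smul, map_smul, h1, h2, hs₁, hs₂, ← mul_smul, ← mul_smul, ← add_smul, hr,
      zero_smul, map_zero]
  by_cases hs : s₁ = 0
  · exact ⟨1, 0, Or.inl one_ne_zero, key _ _ (by simp [hs])⟩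
  · exact ⟨s₂, s₁, Or.inr hs, key _ _ (by
      rw [mul_comm s₁ s₂]; exact add_self_eq_zero_of_charTwo K _)⟩

end StableTransfer

end Invariants

/-! ### Quotients of the path algebra: traces and homomorphisms from generators. -/

section Presentation

theorem StablyEquivalentOfMoritaType.symm {K : Type u} [Field K] {A B : Type u} [Ring A]
    [Algebra K A] [Ring B] [Algebra K B] (h : StablyEquivalentOfMoritaType K A B) :
    StablyEquivalentOfMoritaType K B A := by
  obtain ⟨M, N, P, Q, hM, hN, hP, hQ, h1, h2⟩ := h
  exact ⟨N, M, Q, P, hN, hM, hQ, hP, h2, h1⟩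

/-- A trace form compatible with the defining relations descends to the quotient. -/
theorem RingQuot.exists_trace {K : Type*} [Field K] {P V : Type*} [Ring P] [Algebra K P]
    [AddCommGroup V] [Module K V] {r : P → P → Prop} (f : P →ₗ[K] V)
    (hf : ∀ x y, f (x * y) = f (y * x)) (h : ∀ a b, r a b → ∀ x, f (a * x) = f (b * x)) :
    ∃ g : RingQuot r →ₗ[K] V, (∀ x, g (RingQuot.mkAlgHom K r x) = f x) ∧
      ∀ x y, g (x * y) = g (y * x) := by
  -- This is the radical of the form `(a, x) ↦ f (a * x)`. Symmetry of `f` makes it a two-sided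
  -- ideal, so containing the relations it contains all that they generate.
  let I : Submodule K P :=
    { carrier := {a | ∀ x, f (a * x) = 0}
      zero_mem' := by simp
      add_mem' := fun {a b} ha hb x => by rw [add_mul, map_add, ha, hb, add_zero]
      smul_mem' := fun c a ha x => by rw [smul_mul_assoc, map_smul, ha, smul_zero] }
  have hI : ∀ a, RingQuot.mkAlgHom K r a = 0 → a ∈ I := by
    let c : RingCon P :=
      { r := fun a b => a - b ∈ I
        iseqv := ⟨fun a => by simp, fun {a b} h => by rw [← neg_sub]; exact neg_mem h,
          fun {a b c} h1 h2 => by rw [← sub_add_sub_cancel a b c]; exact add_mem h1 h2⟩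
        mul' := fun {a b c d} h1 h2 x => by
          have e : (a * c - b * d) * x = (a - b) * (c * x) + b * (c - d) * x := by noncomm_ring
          rw [e, map_add, h1, zero_add, mul_assoc, hf, mul_assoc, h2]
        add' := fun {a b c d} h1 h2 => by
          have e : a + c - (b + d) = (a - b) + (c - d) := by abel
          change a + c - (b + d) ∈ I
          rw [e]; exact add_mem h1 h2 }
    intro a ha
    let φ : RingQuot r →+* c.Quotient := RingQuot.lift ⟨c.mk', fun x y hxy => by
      refine (RingCon.eq _).2 ?_
      intro z
      rw [sub_mul, map_sub, h x y hxy, sub_self]⟩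
    have h1 : φ (RingQuot.mkRingHom r a) = c.mk' a := RingQuot.lift_mkRingHom_apply _ _ _
    have h2 : RingQuot.mkRingHom r a = 0 := by
      rw [← RingQuot.mkAlgHom_coe K r]; exact ha
    rw [h2, map_zero] at h1
    have h3 : c 0 a := (RingCon.eq _).1 h1
    have h4 : (0 : P) - a ∈ I := h3
    rwa [zero_sub, neg_mem_iff] at h4
  have hsurj := RingQuot.mkAlgHom_surjective K r
  let q : P →ₗ[K] RingQuot r := (RingQuot.mkAlgHom K r).toLinearMap
  have hle : LinearMap.ker q ≤ LinearMap.ker f := fun a ha => by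
    have := hI a ha 1
    rwa [mul_one] at this
  let g := ((LinearMap.ker q).liftQ f hle).comp (q.quotKerEquivOfSurjective hsurj).symm.toLinearMap
  have hg : ∀ x, g (RingQuot.mkAlgHom K r x) = f x := fun x => by
    have : (q.quotKerEquivOfSurjective hsurj).symm (q x) = Submodule.Quotient.mk x := by
      rw [LinearEquiv.symm_apply_eq]; rfl
    change (LinearMap.ker q).liftQ f hle ((q.quotKerEquivOfSurjective hsurj).symm (q x)) = f x
    rw [this]; rfl
  refine ⟨g, hg, fun x y => ?_⟩
  obtain ⟨x, rfl⟩ := hsurj x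
  obtain ⟨y, rfl⟩ := hsurj y
  rw [← map_mul, ← map_mul, hg, hg, hf]

theorem trace_eq_zero_of_mem_commutatorSpan {K : Type u} [Field K] {A : Type u} [Ring A]
    [Algebra K A] {V : Type*} [AddCommGroup V] [Module K V] (f : A →ₗ[K] V)
    (hf : ∀ x y, f (x * y) = f (y * x)) {x : A} (hx : x ∈ commutatorSpan K A) : f x = 0 := by
  suffices commutatorSpan K A ≤ LinearMap.ker f from this hx
  refine Submodule.span_le.2 ?_
  rintro _ ⟨a, b, rfl⟩
  simp only [SetLike.mem_coe, LinearMap.mem_ker, map_sub, hf a b, sub_self]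

/-- Elements of an algebra satisfying the relations of the path algebra of `2B`. -/
structure IsQuiverRep {R : Type*} [Semiring R] (v : Gen2B → R) : Prop where
  e0_e0 : v .e0 * v .e0 = v .e0
  e1_e1 : v .e1 * v .e1 = v .e1
  e0_e1 : v .e0 * v .e1 = 0
  e1_e0 : v .e1 * v .e0 = 0
  e0_add_e1 : v .e0 + v .e1 = 1
  e0_α : v .e0 * v .α = v .α
  α_e0 : v .α * v .e0 = v .α
  e0_β : v .e0 * v .β = v .β
  β_e1 : v .β * v .e1 = v .β
  e1_γ : v .e1 * v .γ = v .γ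
  γ_e0 : v .γ * v .e0 = v .γ
  e1_η : v .e1 * v .η = v .η
  η_e1 : v .η * v .e1 = v .η

theorem IsQuiverRep.map {R S : Type*} [Semiring R] [Semiring S] {v : Gen2B → R} (hv : IsQuiverRep v)
    (φ : R →+* S) : IsQuiverRep (fun x => φ (v x)) := by
  constructor <;> simp only [← map_mul, ← map_add, hv.e0_e0, hv.e1_e1, hv.e0_e1, hv.e1_e0,
    hv.e0_add_e1, hv.e0_α, hv.α_e0, hv.e0_β, hv.β_e1, hv.e1_γ, hv.γ_e0, hv.e1_η, hv.η_e1,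
    map_zero, map_one]

namespace PathAlg2B

variable (K : Type u) [Field K]

theorem isQuiverRep_of : IsQuiverRep (of K) := by
  have h {a b} (h : PathRel2B K a b) := RingQuot.mkAlgHom_rel K h
  constructor <;> simp only [of, ← map_mul, ← map_add]
  · exact h .e0_e0
  · exact h .e1_e1
  · rw [h .e0_e1, map_zero]
  · rw [h .e1_e0, map_zero]
  · rw [h .e0_add_e1, map_one]
  · exact h .e0_α
  · exact h .α_e0
  · exact h .e0_β
  · exact h .β_e1
  · exact h .e1_γ
  · exact h .γ_e0
  · exact h .e1_η
  · exact h .η_e1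

theorem adjoin_range_of : Algebra.adjoin K (Set.range (of K)) = ⊤ := by
  have h : Set.range (of K) =
      (RingQuot.mkAlgHom K (PathRel2B K)) '' Set.range (FreeAlgebra.ι K) := by
    rw [← Set.range_comp]; rfl
  rw [h, ← AlgHom.map_adjoin, FreeAlgebra.adjoin_range_ι, Algebra.map_top, AlgHom.range_eq_top]
  exact RingQuot.mkAlgHom_surjective K _

variable {K} {R : Type*} [Semiring R] [Algebra K R] {v : Gen2B → R}

/-- The algebra homomorphism given by elements satisfying the relations of the path algebra. -/
noncomputable def lift (hv : IsQuiverRep v) : PathAlg2B K →ₐ[K] R :=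
  RingQuot.liftAlgHom K ⟨FreeAlgebra.lift K v, fun x y h => by
    cases h <;> simp only [map_mul, map_add, map_zero, map_one, FreeAlgebra.lift_ι_apply,
      hv.e0_e0, hv.e1_e1, hv.e0_e1, hv.e1_e0, hv.e0_add_e1, hv.e0_α, hv.α_e0, hv.e0_β, hv.β_e1,
      hv.e1_γ, hv.γ_e0, hv.e1_η, hv.η_e1]⟩

theorem lift_of (hv : IsQuiverRep v) (x : Gen2B) : lift (K := K) hv (of K x) = v x := by
  rw [lift, of, RingQuot.liftAlgHom_mkAlgHom_apply, FreeAlgebra.lift_ι_apply]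

@[elab_as_elim]
theorem induction {C : PathAlg2B K → Prop} (hof : ∀ x, C (of K x))
    (halg : ∀ r, C (algebraMap K _ r)) (hadd : ∀ x y, C x → C y → C (x + y))
    (hmul : ∀ x y, C x → C y → C (x * y)) (x : PathAlg2B K) : C x := by
  have hx : x ∈ Algebra.adjoin K (Set.range (of K)) := by rw [adjoin_range_of]; trivial
  induction hx using Algebra.adjoin_induction with
  | mem x hx => obtain ⟨y, rfl⟩ := hx; exact hof y
  | algebraMap r => exact halg r
  | add x y _ _ hx hy => exact hadd x y hx hy
  | mul x y _ _ hx hy => exact hmul x y hx hy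

end PathAlg2B

section Quotients

variable {K : Type u} [Field K] (r : PathAlg2B K → PathAlg2B K → Prop)

/-- The class of a vertex or an arrow in a quotient of the path algebra. -/
noncomputable def quotGen (x : Gen2B) : RingQuot r :=
  RingQuot.mkAlgHom K r (PathAlg2B.of K x)

theorem isQuiverRep_quotGen : IsQuiverRep (quotGen r) := by
  have h := (PathAlg2B.isQuiverRep_of K).map (RingQuot.mkAlgHom K r).toRingHom
  exact h

theorem adjoin_range_quotGen : Algebra.adjoin K (Set.range (quotGen r)) = ⊤ := by
  have h : Set.range (quotGen r) =
      (RingQuot.mkAlgHom K r) '' Set.range (PathAlg2B.of K) := by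
    rw [← Set.range_comp]; rfl
  rw [h, ← AlgHom.map_adjoin, PathAlg2B.adjoin_range_of, Algebra.map_top, AlgHom.range_eq_top]
  exact RingQuot.mkAlgHom_surjective K _

variable {r} in
theorem exists_algHom_quotGen {R : Type*} [Semiring R] [Algebra K R] {v : Gen2B → R}
    (hv : IsQuiverRep v)
    (h : ∀ a b, r a b → PathAlg2B.lift (K := K) hv a = PathAlg2B.lift hv b) :
    ∃ φ : RingQuot r →ₐ[K] R, ∀ x, φ (quotGen r x) = v x :=
  ⟨RingQuot.liftAlgHom K ⟨PathAlg2B.lift hv, fun x y hxy => h x y hxy⟩, fun x => by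
    rw [quotGen, RingQuot.liftAlgHom_mkAlgHom_apply, PathAlg2B.lift_of]⟩

end Quotients

end Presentation

/-! ### Paths in the common model and its finite dimension. -/

section Model

/-- Generators and relations shared by the algebras `SD(2B)₁` (with `μ = 1`, `ν = 0`) and
`SD(2B)₂` (with `μ = 0`, `ν = 1`), together with a symmetrizing trace form `f` and
representations that detect the vertices and the loop `α`. -/
structure SDModel (K A : Type u) [Field K] [Ring A] [Algebra K A] (k s : ℕ) (c μ ν : K) where
  e0 : A
  e1 : A
  α : A
  β : A
  γ : A
  η : A
  adjoin_eq_top : Algebra.adjoin K {e0, e1, α, β, γ, η} = ⊤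
  k_pos : 1 ≤ k
  s_pos : 1 ≤ s
  μν : μ * ν = 0
  e0_e0 : e0 * e0 = e0
  e1_e1 : e1 * e1 = e1
  e0_e1 : e0 * e1 = 0
  e1_e0 : e1 * e0 = 0
  e0_add_e1 : e0 + e1 = 1
  e0_α : e0 * α = α
  α_e0 : α * e0 = α
  e0_β : e0 * β = β
  β_e1 : β * e1 = β
  e1_γ : e1 * γ = γ
  γ_e0 : γ * e0 = γ
  e1_η : e1 * η = η
  η_e1 : η * e1 = η
  βγβ : β * γ * β = 0
  γβγ : γ * β * γ = 0
  ααβ : α * α * β = 0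
  γαα : γ * α * α = 0
  ηγα : η * γ * α = 0
  αβη : α * β * η = 0
  βηη : β * η * η = 0
  ηηγ : η * η * γ = 0
  γβ : γ * β = ν • η ^ (s - 1)
  βη : β * η = ν • ((α * β * γ) ^ (k - 1) * (α * β))
  ηγ : η * γ = ν • ((γ * α * β) ^ (k - 1) * (γ * α))
  αα : α * α = μ • ((β * γ * α) ^ (k - 1) * (β * γ)) + c • (α * β * γ) ^ k
  η_pow : η ^ s = (γ * α * β) ^ k
  socle : (α * β * γ) ^ k = (β * γ * α) ^ k
  γ_pow : γ * (α * β * γ) ^ k = 0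
  f : A →ₗ[K] K
  f_comm : ∀ x y, f (x * y) = f (y * x)
  f_e0 : f e0 = 0
  f_e1 : f e1 = 0
  f_α : f α = 0
  f_pow : ∀ i, 1 ≤ i → i < k → f ((α * β * γ) ^ i) = 0
  f_top : f ((α * β * γ) ^ k) = 1
  f_η : ∀ j, 1 ≤ j → j < s → f (η ^ j) = 0
  τ : A →ₐ[K] DualNumber K
  τ_e0 : τ e0 = 1
  τ_e1 : τ e1 = 0
  τ_α : τ α = DualNumber.eps
  τ_β : τ β = 0
  τ_γ : τ γ = 0
  τ_η : τ η = 0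
  ε₁ : A →ₐ[K] K
  ε₁_e0 : ε₁ e0 = 0
  ε₁_e1 : ε₁ e1 = 1
  ε₁_α : ε₁ α = 0
  ε₁_β : ε₁ β = 0
  ε₁_γ : ε₁ γ = 0
  ε₁_η : ε₁ η = 0

namespace SDModel

variable {K A : Type u} [Field K] [Ring A] [Algebra K A] {k s : ℕ} {c μ ν : K}
  (S : SDModel K A k s c μ ν)

/-- The three rotations of the path `αβγ`. -/
def w₀ : A := S.α * S.β * S.γ

/-- A rotation of the path `αβγ`. -/
def w₁ : A := S.β * S.γ * S.α

/-- A rotation of the path `αβγ`. -/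
def w₂ : A := S.γ * S.α * S.β

theorem e0_mul_γ : S.e0 * S.γ = 0 := by rw [← S.e1_γ, ← mul_assoc, S.e0_e1, zero_mul]
theorem e0_mul_η : S.e0 * S.η = 0 := by rw [← S.e1_η, ← mul_assoc, S.e0_e1, zero_mul]
theorem e1_mul_α : S.e1 * S.α = 0 := by rw [← S.e0_α, ← mul_assoc, S.e1_e0, zero_mul]
theorem e1_mul_β : S.e1 * S.β = 0 := by rw [← S.e0_β, ← mul_assoc, S.e1_e0, zero_mul]
theorem α_mul_e1 : S.α * S.e1 = 0 := by rw [← S.α_e0, mul_assoc, S.e0_e1, mul_zero]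
theorem γ_mul_e1 : S.γ * S.e1 = 0 := by rw [← S.γ_e0, mul_assoc, S.e0_e1, mul_zero]
theorem β_mul_e0 : S.β * S.e0 = 0 := by rw [← S.β_e1, mul_assoc, S.e1_e0, mul_zero]
theorem η_mul_e0 : S.η * S.e0 = 0 := by rw [← S.η_e1, mul_assoc, S.e1_e0, mul_zero]
theorem α_mul_γ : S.α * S.γ = 0 := by rw [← S.α_e0, mul_assoc, S.e0_mul_γ, mul_zero]
theorem α_mul_η : S.α * S.η = 0 := by rw [← S.α_e0, mul_assoc, S.e0_mul_η, mul_zero]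
theorem γ_mul_γ : S.γ * S.γ = 0 := by
  nth_rewrite 1 [← S.γ_e0]; rw [mul_assoc, S.e0_mul_γ, mul_zero]
theorem γ_mul_η : S.γ * S.η = 0 := by
  nth_rewrite 1 [← S.γ_e0]; rw [mul_assoc, S.e0_mul_η, mul_zero]
theorem β_mul_α : S.β * S.α = 0 := by rw [← S.β_e1, mul_assoc, S.e1_mul_α, mul_zero]
theorem β_mul_β : S.β * S.β = 0 := by
  nth_rewrite 1 [← S.β_e1]; rw [mul_assoc, S.e1_mul_β, mul_zero]
theorem η_mul_α : S.η * S.α = 0 := by rw [← S.η_e1, mul_assoc, S.e1_mul_α, mul_zero]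
theorem η_mul_β : S.η * S.β = 0 := by rw [← S.η_e1, mul_assoc, S.e1_mul_β, mul_zero]

theorem w₀_pow_α (i : ℕ) : S.w₀ ^ i * S.α = S.α * S.w₁ ^ i := by
  have h : SemiconjBy S.α S.w₁ S.w₀ := by
    simp only [SemiconjBy, w₀, w₁, mul_assoc]
  exact (h.pow_right i).eq.symm

theorem w₁_pow_β (i : ℕ) : S.w₁ ^ i * S.β = S.β * S.w₂ ^ i := by
  have h : SemiconjBy S.β S.w₂ S.w₁ := by
    simp only [SemiconjBy, w₁, w₂, mul_assoc]
  exact (h.pow_right i).eq.symm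

theorem w₂_pow_γ (i : ℕ) : S.w₂ ^ i * S.γ = S.γ * S.w₀ ^ i := by
  have h : SemiconjBy S.γ S.w₀ S.w₂ := by
    simp only [SemiconjBy, w₀, w₂, mul_assoc]
  exact (h.pow_right i).eq.symm

theorem w₀_top : S.w₀ ^ k = S.w₁ ^ k := S.socle

theorem γ_mul_w₀_pow : S.γ * S.w₀ ^ k = 0 := S.γ_pow

theorem η_pow_s : S.η ^ s = S.w₂ ^ k := S.η_pow

theorem α_mul_w₀ : S.α * S.w₀ = 0 := by
  rw [w₀, ← mul_assoc, ← mul_assoc, S.ααβ, zero_mul]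

theorem w₁_mul_α : S.w₁ * S.α = 0 := by
  rw [w₁, mul_assoc S.β, mul_assoc S.β, S.γαα, mul_zero]

theorem w₀_mul_β : S.w₀ * S.β = 0 := by
  rw [w₀, mul_assoc, mul_assoc, ← mul_assoc S.β, S.βγβ, mul_zero]

theorem γ_mul_w₁ : S.γ * S.w₁ = 0 := by
  rw [w₁, ← mul_assoc, ← mul_assoc, S.γβγ, zero_mul]

theorem η_mul_w₂ : S.η * S.w₂ = 0 := by
  rw [w₂, ← mul_assoc, ← mul_assoc, S.ηγα, zero_mul]

theorem w₂_mul_η : S.w₂ * S.η = 0 := by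
  rw [w₂, mul_assoc, mul_assoc, ← mul_assoc S.α, S.αβη, mul_zero]

theorem w₀_mul_w₁ : S.w₀ * S.w₁ = 0 := by
  rw [w₁, ← mul_assoc, ← mul_assoc, S.w₀_mul_β, zero_mul, zero_mul]

theorem w₁_mul_w₀ : S.w₁ * S.w₀ = 0 := by
  rw [w₀, ← mul_assoc, ← mul_assoc, S.w₁_mul_α, zero_mul, zero_mul]

theorem e0_mul_w₀ : S.e0 * S.w₀ = S.w₀ := by rw [w₀, ← mul_assoc, ← mul_assoc, S.e0_α]
theorem w₀_mul_e0 : S.w₀ * S.e0 = S.w₀ := by rw [w₀, mul_assoc, S.γ_e0]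
theorem e0_mul_w₁ : S.e0 * S.w₁ = S.w₁ := by rw [w₁, ← mul_assoc, ← mul_assoc, S.e0_β]
theorem w₁_mul_e0 : S.w₁ * S.e0 = S.w₁ := by rw [w₁, mul_assoc, S.α_e0]
theorem e1_mul_w₂ : S.e1 * S.w₂ = S.w₂ := by rw [w₂, ← mul_assoc, ← mul_assoc, S.e1_γ]
theorem w₂_mul_e1 : S.w₂ * S.e1 = S.w₂ := by rw [w₂, mul_assoc, S.β_e1]

theorem w₀_mul_w₂ : S.w₀ * S.w₂ = 0 := by
  rw [← S.w₀_mul_e0, ← S.e1_mul_w₂, mul_assoc, ← mul_assoc S.e0, S.e0_e1, zero_mul, mul_zero]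
theorem w₂_mul_w₀ : S.w₂ * S.w₀ = 0 := by
  rw [← S.w₂_mul_e1, ← S.e0_mul_w₀, mul_assoc, ← mul_assoc S.e1, S.e1_e0, zero_mul, mul_zero]
theorem w₁_mul_w₂ : S.w₁ * S.w₂ = 0 := by
  rw [← S.w₁_mul_e0, ← S.e1_mul_w₂, mul_assoc, ← mul_assoc S.e0, S.e0_e1, zero_mul, mul_zero]
theorem w₂_mul_w₁ : S.w₂ * S.w₁ = 0 := by
  rw [← S.w₂_mul_e1, ← S.e0_mul_w₁, mul_assoc, ← mul_assoc S.e1, S.e1_e0, zero_mul, mul_zero]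
theorem η_mul_w₀ : S.η * S.w₀ = 0 := by
  rw [← S.η_e1, ← S.e0_mul_w₀, mul_assoc, ← mul_assoc S.e1, S.e1_e0, zero_mul, mul_zero]
theorem η_mul_w₁ : S.η * S.w₁ = 0 := by
  rw [← S.η_e1, ← S.e0_mul_w₁, mul_assoc, ← mul_assoc S.e1, S.e1_e0, zero_mul, mul_zero]
theorem w₀_mul_η : S.w₀ * S.η = 0 := by rw [← S.w₀_mul_e0, mul_assoc, S.e0_mul_η, mul_zero]
theorem w₁_mul_η : S.w₁ * S.η = 0 := by rw [← S.w₁_mul_e0, mul_assoc, S.e0_mul_η, mul_zero]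

section Powers

variable {R : Type*} [MonoidWithZero R] {x y : R}

theorem mul_pow_eq_zero (h : x * y = 0) {i : ℕ} (hi : i ≠ 0) : x * y ^ i = 0 := by
  obtain ⟨j, rfl⟩ := Nat.exists_eq_succ_of_ne_zero hi
  rw [pow_succ', ← mul_assoc, h, zero_mul]

theorem pow_mul_eq_zero (h : x * y = 0) {i : ℕ} (hi : i ≠ 0) : x ^ i * y = 0 := by
  obtain ⟨j, rfl⟩ := Nat.exists_eq_succ_of_ne_zero hi
  rw [pow_succ, mul_assoc, h, mul_zero]

end Powers

theorem w₀_pow_of_lt {i : ℕ} (hi : k < i) : S.w₀ ^ i = 0 := by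
  have h : S.w₀ ^ (k + 1) = 0 := by
    rw [pow_succ']; nth_rewrite 1 [w₀]; rw [mul_assoc, S.γ_mul_w₀_pow, mul_zero]
  exact pow_eq_zero_of_le hi h

theorem w₁_pow_of_lt {i : ℕ} (hi : k < i) : S.w₁ ^ i = 0 := by
  have h : S.w₁ ^ (k + 1) = 0 := by
    rw [pow_succ', ← S.w₀_top]
    exact mul_pow_eq_zero S.w₁_mul_w₀ (by have := S.k_pos; omega)
  exact pow_eq_zero_of_le hi h

theorem w₂_pow_of_lt {i : ℕ} (hi : k < i) : S.w₂ ^ i = 0 := by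
  have h : S.w₂ ^ (k + 1) = 0 := by
    rw [pow_succ]; nth_rewrite 2 [w₂]
    rw [← mul_assoc, ← mul_assoc, S.w₂_pow_γ, S.γ_mul_w₀_pow, zero_mul, zero_mul]
  exact pow_eq_zero_of_le hi h

theorem η_pow_of_lt {i : ℕ} (hi : s < i) : S.η ^ i = 0 := by
  have h : S.η ^ (s + 1) = 0 := by
    rw [pow_succ', S.η_pow_s]
    exact mul_pow_eq_zero S.η_mul_w₂ (by have := S.k_pos; omega)
  exact pow_eq_zero_of_le hi h

/-- The nonzero paths, as elements indexed by a length. -/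
def IsPath (i : ℕ) (x : A) : Prop :=
  x = S.e0 * S.w₀ ^ i ∨ x = S.α * S.w₁ ^ i ∨ x = S.α * S.β * S.w₂ ^ i ∨ x = S.β * S.w₂ ^ i ∨
    x = S.β * S.γ * S.w₀ ^ i ∨ x = S.β * S.γ * S.α * S.w₁ ^ i ∨ x = S.γ * S.w₀ ^ i ∨
    x = S.γ * S.α * S.w₁ ^ i ∨ x = S.γ * S.α * S.β * S.w₂ ^ i ∨ x = S.e1 * S.η ^ i

theorem isPath_finite (i : ℕ) : {x | S.IsPath i x}.Finite := by
  simp only [IsPath, Set.ofPred_or]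
  exact ((Set.finite_singleton _).union ((Set.finite_singleton _).union
    ((Set.finite_singleton _).union ((Set.finite_singleton _).union ((Set.finite_singleton _).union
    ((Set.finite_singleton _).union ((Set.finite_singleton _).union
    ((Set.finite_singleton _).union
    ((Set.finite_singleton _).union (Set.finite_singleton _))))))))))

theorem isPath_eq_zero {i : ℕ} (hi : k + s < i) {x : A} (hx : S.IsPath i x) : x = 0 := by
  have h0 : S.w₀ ^ i = 0 := S.w₀_pow_of_lt (by omega)
  have h1 : S.w₁ ^ i = 0 := S.w₁_pow_of_lt (by omega)
  have h2 : S.w₂ ^ i = 0 := S.w₂_pow_of_lt (by omega)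
  have h3 : S.η ^ i = 0 := S.η_pow_of_lt (by omega)
  unfold IsPath at hx
  rw [h0, h1, h2, h3] at hx
  simpa using hx

/-- The span of the paths. -/
def pathSpan : Submodule K A := Submodule.span K {x | ∃ i, S.IsPath i x}

section Membership

variable (i : ℕ)

theorem e0_mem : S.e0 * S.w₀ ^ i ∈ S.pathSpan :=
  Submodule.subset_span ⟨i, Or.inl rfl⟩
theorem α_mem : S.α * S.w₁ ^ i ∈ S.pathSpan :=
  Submodule.subset_span ⟨i, Or.inr (Or.inl rfl)⟩
theorem αβ_mem : S.α * S.β * S.w₂ ^ i ∈ S.pathSpan :=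
  Submodule.subset_span ⟨i, Or.inr (Or.inr (Or.inl rfl))⟩
theorem β_mem : S.β * S.w₂ ^ i ∈ S.pathSpan :=
  Submodule.subset_span ⟨i, Or.inr (Or.inr (Or.inr (Or.inl rfl)))⟩
theorem βγ_mem : S.β * S.γ * S.w₀ ^ i ∈ S.pathSpan :=
  Submodule.subset_span ⟨i, Or.inr (Or.inr (Or.inr (Or.inr (Or.inl rfl))))⟩
theorem βγα_mem : S.β * S.γ * S.α * S.w₁ ^ i ∈ S.pathSpan :=
  Submodule.subset_span ⟨i, by simp [IsPath]⟩
theorem γ_mem : S.γ * S.w₀ ^ i ∈ S.pathSpan :=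
  Submodule.subset_span ⟨i, by simp [IsPath]⟩
theorem γα_mem : S.γ * S.α * S.w₁ ^ i ∈ S.pathSpan :=
  Submodule.subset_span ⟨i, by simp [IsPath]⟩
theorem γαβ_mem : S.γ * S.α * S.β * S.w₂ ^ i ∈ S.pathSpan :=
  Submodule.subset_span ⟨i, by simp [IsPath]⟩
theorem e1_mem : S.e1 * S.η ^ i ∈ S.pathSpan :=
  Submodule.subset_span ⟨i, by simp [IsPath]⟩

end Membership

theorem w₀_pow_mem {i : ℕ} (hi : i ≠ 0) : S.w₀ ^ i ∈ S.pathSpan := by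
  obtain ⟨j, rfl⟩ := Nat.exists_eq_succ_of_ne_zero hi
  have := S.e0_mem (j + 1)
  rwa [pow_succ', ← mul_assoc, S.e0_mul_w₀, ← pow_succ'] at this

theorem w₁_pow_mul_βγ (i : ℕ) : S.w₁ ^ i * (S.β * S.γ) = S.β * S.γ * S.w₀ ^ i := by
  rw [← mul_assoc, S.w₁_pow_β, mul_assoc, S.w₂_pow_γ, mul_assoc]

theorem αα' : S.α * S.α = μ • (S.β * S.γ * S.w₀ ^ (k - 1)) + c • S.w₀ ^ k := by
  rw [← S.w₁_pow_mul_βγ]; exact S.αα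

theorem βη' : S.β * S.η = ν • (S.α * S.β * S.w₂ ^ (k - 1)) := by
  have : S.w₀ ^ (k - 1) * (S.α * S.β) = S.α * S.β * S.w₂ ^ (k - 1) := by
    rw [← mul_assoc, S.w₀_pow_α, mul_assoc, S.w₁_pow_β, mul_assoc]
  rw [← this]; exact S.βη

theorem ηγ' : S.η * S.γ = ν • (S.γ * S.α * S.w₁ ^ (k - 1)) := by
  have : S.w₂ ^ (k - 1) * (S.γ * S.α) = S.γ * S.α * S.w₁ ^ (k - 1) := by
    rw [← mul_assoc, S.w₂_pow_γ, mul_assoc, S.w₀_pow_α, mul_assoc]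
  rw [← this]; exact S.ηγ

theorem γβ' : S.γ * S.β = ν • (S.e1 * S.η ^ (s - 1)) := by
  rw [← mul_smul_comm, ← S.γβ, ← mul_assoc, S.e1_γ]

theorem αα_mem : S.α * S.α ∈ S.pathSpan := by
  rw [S.αα']
  exact add_mem (Submodule.smul_mem _ _ (S.βγ_mem _))
    (Submodule.smul_mem _ _ (S.w₀_pow_mem (by have := S.k_pos; omega)))

theorem mul_mem_pathSpan {g : A} (h : ∀ i x, S.IsPath i x → g * x ∈ S.pathSpan) {x : A}
    (hx : x ∈ S.pathSpan) : g * x ∈ S.pathSpan := by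
  induction hx using Submodule.span_induction with
  | mem x hx => obtain ⟨i, hi⟩ := hx; exact h i x hi
  | zero => rw [mul_zero]; exact zero_mem _
  | add x y _ _ hx hy => rw [mul_add]; exact add_mem hx hy
  | smul r x _ hx => rw [mul_smul_comm]; exact Submodule.smul_mem _ _ hx

theorem e0_mul_mem {x : A} (hx : x ∈ S.pathSpan) : S.e0 * x ∈ S.pathSpan := by
  refine S.mul_mem_pathSpan (fun i x hx => ?_) hx
  rcases hx with rfl | rfl | rfl | rfl | rfl | rfl | rfl | rfl | rfl | rfl <;>
    simp only [← mul_assoc, S.e0_e0, S.e0_α, S.e0_β, S.e0_mul_γ, S.e0_e1, zero_mul, zero_mem]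
  exacts [S.e0_mem i, S.α_mem i, S.αβ_mem i, S.β_mem i, S.βγ_mem i, S.βγα_mem i]

theorem e1_mul_mem {x : A} (hx : x ∈ S.pathSpan) : S.e1 * x ∈ S.pathSpan := by
  refine S.mul_mem_pathSpan (fun i x hx => ?_) hx
  rcases hx with rfl | rfl | rfl | rfl | rfl | rfl | rfl | rfl | rfl | rfl <;>
    simp only [← mul_assoc, S.e1_e0, S.e1_mul_α, S.e1_mul_β, S.e1_γ, S.e1_e1, zero_mul, zero_mem]
  exacts [S.γ_mem i, S.γα_mem i, S.γαβ_mem i, S.e1_mem i]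

theorem α_mul_mem {x : A} (hx : x ∈ S.pathSpan) : S.α * x ∈ S.pathSpan := by
  refine S.mul_mem_pathSpan (fun i x hx => ?_) hx
  rcases hx with rfl | rfl | rfl | rfl | rfl | rfl | rfl | rfl | rfl | rfl <;>
    simp only [← mul_assoc, S.ααβ, S.α_mul_γ, S.α_mul_e1, zero_mul, zero_mem, S.α_e0]
  · rcases eq_or_ne i 0 with rfl | hi
    · simpa using S.α_mem 0
    · rw [mul_pow_eq_zero S.α_mul_w₀ hi]; exact zero_mem _
  · rcases i with _ | i
    · simpa using S.αα_mem
    · rw [pow_succ', ← mul_assoc, w₁, ← mul_assoc, ← mul_assoc, S.ααβ]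
      simp only [zero_mul, zero_mem]
  · exact S.αβ_mem i
  · have := S.w₀_pow_mem (Nat.succ_ne_zero i)
    rwa [pow_succ'] at this
  · have := S.α_mem (i + 1)
    rwa [pow_succ', w₁, ← mul_assoc, ← mul_assoc, ← mul_assoc] at this

theorem β_mul_mem {x : A} (hx : x ∈ S.pathSpan) : S.β * x ∈ S.pathSpan := by
  refine S.mul_mem_pathSpan (fun i x hx => ?_) hx
  rcases hx with rfl | rfl | rfl | rfl | rfl | rfl | rfl | rfl | rfl | rfl <;>
    simp only [← mul_assoc, S.β_mul_e0, S.β_mul_α, S.β_mul_β, S.β_e1, zero_mul, zero_mem]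
  · exact S.βγ_mem i
  · exact S.βγα_mem i
  · have := S.β_mem (i + 1)
    rwa [pow_succ', w₂, ← mul_assoc, ← mul_assoc, ← mul_assoc] at this
  · rcases i with _ | _ | i
    · simpa using S.β_mem 0
    · rw [zero_add, pow_one, S.βη']; exact Submodule.smul_mem _ _ (S.αβ_mem _)
    · rw [pow_succ', pow_succ', ← mul_assoc, ← mul_assoc, S.βηη, zero_mul]; exact zero_mem _

theorem γ_mul_mem {x : A} (hx : x ∈ S.pathSpan) : S.γ * x ∈ S.pathSpan := by
  refine S.mul_mem_pathSpan (fun i x hx => ?_) hx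
  rcases hx with rfl | rfl | rfl | rfl | rfl | rfl | rfl | rfl | rfl | rfl <;>
    simp only [← mul_assoc, S.γ_e0, S.γβγ, S.γ_mul_γ, S.γ_mul_e1, zero_mul, zero_mem]
  · exact S.γ_mem i
  · exact S.γα_mem i
  · exact S.γαβ_mem i
  · rcases i with _ | i
    · rw [pow_zero, mul_one, S.γβ']; exact Submodule.smul_mem _ _ (S.e1_mem _)
    · rw [pow_succ', w₂, ← mul_assoc, ← mul_assoc, ← mul_assoc, S.γβγ]
      simp only [zero_mul, zero_mem]

theorem η_mul_mem {x : A} (hx : x ∈ S.pathSpan) : S.η * x ∈ S.pathSpan := by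
  refine S.mul_mem_pathSpan (fun i x hx => ?_) hx
  rcases hx with rfl | rfl | rfl | rfl | rfl | rfl | rfl | rfl | rfl | rfl <;>
    simp only [← mul_assoc, S.η_mul_e0, S.η_mul_α, S.η_mul_β, S.ηγα, zero_mul, zero_mem, S.η_e1]
  · rcases i with _ | i
    · rw [pow_zero, mul_one, S.ηγ']; exact Submodule.smul_mem _ _ (S.γα_mem _)
    · rw [pow_succ', w₀, ← mul_assoc, ← mul_assoc, ← mul_assoc, S.ηγα]
      simp only [zero_mul, zero_mem]
  · have := S.e1_mem (i + 1)
    rwa [pow_succ', ← mul_assoc, S.e1_η] at this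

/-- The span contains `1` and is stable under left multiplication by each generator, so it is a left
ideal containing `1`. -/
theorem pathSpan_eq_top : S.pathSpan = ⊤ := by
  have h1 : (1 : A) ∈ S.pathSpan := by
    rw [← S.e0_add_e1]
    exact add_mem (by simpa using S.e0_mem 0) (by simpa using S.e1_mem 0)
  have h : ∀ g : A, ∀ x ∈ S.pathSpan, g * x ∈ S.pathSpan := by
    intro g
    have hg : g ∈ Algebra.adjoin K {S.e0, S.e1, S.α, S.β, S.γ, S.η} := by
      rw [S.adjoin_eq_top]; trivial
    induction hg using Algebra.adjoin_induction with
    | mem g hg =>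
      intro x hx
      rcases hg with rfl | rfl | rfl | rfl | rfl | rfl
      exacts [S.e0_mul_mem hx, S.e1_mul_mem hx, S.α_mul_mem hx, S.β_mul_mem hx, S.γ_mul_mem hx,
        S.η_mul_mem hx]
    | algebraMap r =>
      intro x hx
      rw [← Algebra.smul_def]; exact Submodule.smul_mem _ _ hx
    | add a b _ _ ha hb => intro x hx; rw [add_mul]; exact add_mem (ha x hx) (hb x hx)
    | mul a b _ _ ha hb => intro x hx; rw [mul_assoc]; exact ha _ (hb x hx)
  refine eq_top_iff.2 fun x _ => ?_
  have := h x 1 h1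
  rwa [mul_one] at this

theorem finite (S : SDModel K A k s c μ ν) : Module.Finite K A := by
  have hfin : {x | ∃ i ∈ Finset.range (k + s + 1), S.IsPath i x}.Finite := by
    have : {x | ∃ i ∈ Finset.range (k + s + 1), S.IsPath i x} =
        ⋃ i ∈ Finset.range (k + s + 1), {x | S.IsPath i x} := by
      ext x; simp
    rw [this]
    exact Set.Finite.biUnion (Finset.finite_toSet _) fun i _ => S.isPath_finite i
  refine ⟨Submodule.fg_def.2 ⟨_, hfin, ?_⟩⟩
  rw [eq_top_iff, ← S.pathSpan_eq_top, pathSpan, Submodule.span_le]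
  rintro x ⟨i, hx⟩
  by_cases hi : i ∈ Finset.range (k + s + 1)
  · exact Submodule.subset_span ⟨i, hi, hx⟩
  · rw [S.isPath_eq_zero (by simp at hi; omega) hx]; exact zero_mem _

end SDModel

end Model

/-! ### The model modulo commutators, and its central elements. -/

section ModelTraces

namespace SDModel

variable {K A : Type u} [Field K] [Ring A] [Algebra K A] {k s : ℕ} {c μ ν : K}
  (S : SDModel K A k s c μ ν)

theorem pow_mul_eq_self {R : Type*} [Monoid R] {x y : R} (h : x * y = x) {i : ℕ} (hi : i ≠ 0) :
    x ^ i * y = x ^ i := by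
  obtain ⟨j, rfl⟩ := Nat.exists_eq_succ_of_ne_zero hi
  rw [pow_succ, mul_assoc, h]

theorem mul_pow_eq_self {R : Type*} [Monoid R] {x y : R} (h : x * y = y) {i : ℕ} (hi : i ≠ 0) :
    x * y ^ i = y ^ i := by
  obtain ⟨j, rfl⟩ := Nat.exists_eq_succ_of_ne_zero hi
  rw [pow_succ', ← mul_assoc, h]

theorem mem_commutatorSpan_of_idempotent {e x : A} (h1 : x * e = x) (h2 : e * x = 0) :
    x ∈ commutatorSpan K A := by
  have := mul_sub_mul_mem_commutatorSpan (K := K) x e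
  rwa [h1, h2, sub_zero] at this

theorem αw₁_pow_mul_βγ (i : ℕ) : S.α * S.w₁ ^ i * (S.β * S.γ) = S.w₀ ^ (i + 1) := by
  rw [← S.w₀_pow_α, mul_assoc, ← mul_assoc S.α, pow_succ]; rfl

theorem γαβ_sub_mem (i : ℕ) :
    S.γ * S.α * S.β * S.w₂ ^ i - S.w₀ ^ (i + 1) ∈ commutatorSpan K A := by
  have := mul_sub_mul_mem_commutatorSpan (K := K) S.γ (S.α * S.w₁ ^ i * S.β)
  rw [mul_assoc _ S.β S.γ, S.αw₁_pow_mul_βγ] at this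
  rwa [mul_assoc _ S.β, ← S.w₁_pow_β, mul_assoc S.γ, ← mul_assoc S.α]

theorem βγα_sub_mem (i : ℕ) :
    S.β * S.γ * S.α * S.w₁ ^ i - S.w₀ ^ (i + 1) ∈ commutatorSpan K A := by
  have := mul_sub_mul_mem_commutatorSpan (K := K) (S.β * S.γ) (S.α * S.w₁ ^ i)
  rwa [S.αw₁_pow_mul_βγ, ← mul_assoc] at this

theorem w₂_pow_sub_mem {i : ℕ} (hi : i ≠ 0) : S.w₂ ^ i - S.w₀ ^ i ∈ commutatorSpan K A := by
  obtain ⟨j, rfl⟩ := Nat.exists_eq_succ_of_ne_zero hi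
  have := S.γαβ_sub_mem j
  rwa [← w₂, ← pow_succ'] at this

theorem w₁_pow_sub_mem {i : ℕ} (hi : i ≠ 0) : S.w₁ ^ i - S.w₀ ^ i ∈ commutatorSpan K A := by
  obtain ⟨j, rfl⟩ := Nat.exists_eq_succ_of_ne_zero hi
  have := S.βγα_sub_mem j
  rwa [← w₁, ← pow_succ'] at this

theorem αw₁_pow_mem {i : ℕ} (hi : i ≠ 0) : S.α * S.w₁ ^ i ∈ commutatorSpan K A := by
  have := mul_sub_mul_mem_commutatorSpan (K := K) S.α (S.w₁ ^ i)
  rwa [pow_mul_eq_zero S.w₁_mul_α hi, sub_zero] at this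

theorem βγ_w₀_pow_mem {i : ℕ} (hi : i ≠ 0) : S.β * S.γ * S.w₀ ^ i ∈ commutatorSpan K A := by
  have := mul_sub_mul_mem_commutatorSpan (K := K) S.β (S.γ * S.w₀ ^ i)
  rwa [mul_assoc S.γ, pow_mul_eq_zero S.w₀_mul_β hi, mul_zero, sub_zero, ← mul_assoc] at this

theorem αβ_w₂_pow_mem (i : ℕ) : S.α * S.β * S.w₂ ^ i ∈ commutatorSpan K A := by
  refine mem_commutatorSpan_of_idempotent (e := S.e1) ?_ ?_
  · rw [mul_assoc S.α, ← S.w₁_pow_β, mul_assoc, mul_assoc, S.β_e1]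
  · simp only [← mul_assoc, S.e1_mul_α, zero_mul]

theorem β_w₂_pow_mem (i : ℕ) : S.β * S.w₂ ^ i ∈ commutatorSpan K A := by
  refine mem_commutatorSpan_of_idempotent (e := S.e1) ?_ ?_
  · rw [← S.w₁_pow_β, mul_assoc, S.β_e1]
  · simp only [← mul_assoc, S.e1_mul_β, zero_mul]

theorem γ_w₀_pow_mem (i : ℕ) : S.γ * S.w₀ ^ i ∈ commutatorSpan K A := by
  refine mem_commutatorSpan_of_idempotent (e := S.e0) ?_ ?_
  · rw [← S.w₂_pow_γ, mul_assoc, S.γ_e0]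
  · simp only [← mul_assoc, S.e0_mul_γ, zero_mul]

theorem γα_w₁_pow_mem (i : ℕ) : S.γ * S.α * S.w₁ ^ i ∈ commutatorSpan K A := by
  refine mem_commutatorSpan_of_idempotent (e := S.e0) ?_ ?_
  · rw [mul_assoc S.γ, ← S.w₀_pow_α, mul_assoc, mul_assoc, S.α_e0]
  · simp only [← mul_assoc, S.e0_mul_γ, zero_mul]

/-- Modulo commutators the algebra is spanned by the vertices, by `α` and by powers of `αβγ` and
`η`. -/
theorem class_induction {C : A → Prop} (hcomm : ∀ x ∈ commutatorSpan K A, C x)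
    (hadd : ∀ x y, C x → C y → C (x + y)) (hsmul : ∀ (r : K) x, C x → C (r • x))
    (h0 : C S.e0) (h1 : C S.e1) (hα : C S.α) (hw : ∀ i, 1 ≤ i → i ≤ k → C (S.w₀ ^ i))
    (hη : ∀ j, 1 ≤ j → j < s → C (S.η ^ j)) (x : A) : C x := by
  have hsub : ∀ {x y}, x - y ∈ commutatorSpan K A → C y → C x := fun {x y} h hy => by
    have := hadd _ _ (hcomm _ h) hy
    rwa [sub_add_cancel] at this
  have hz : C 0 := hcomm 0 (zero_mem _)
  have hw' : ∀ i, C (S.w₀ ^ (i + 1)) := fun i => by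
    rcases lt_or_ge k (i + 1) with h | h
    · rw [S.w₀_pow_of_lt h]; exact hz
    · exact hw _ (by omega) h
  have hη' : ∀ j, C (S.e1 * S.η ^ j) := fun j => by
    rcases Nat.eq_zero_or_pos j with rfl | hj
    · simpa using h1
    have e : S.e1 * S.η ^ j = S.η ^ j := by
      obtain ⟨i, rfl⟩ := Nat.exists_eq_succ_of_ne_zero hj.ne'
      rw [pow_succ', ← mul_assoc, S.e1_η]
    rw [e]
    rcases lt_trichotomy j s with h | rfl | h
    · exact hη j hj h
    · rw [S.η_pow_s]
      have := S.k_pos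
      exact hsub (S.w₂_pow_sub_mem (by omega)) (hw k this le_rfl)
    · rw [S.η_pow_of_lt h]; exact hz
  have hx : x ∈ S.pathSpan := by rw [S.pathSpan_eq_top]; trivial
  induction hx using Submodule.span_induction with
  | zero => exact hz
  | add x y _ _ hx hy => exact hadd x y hx hy
  | smul r x _ hx => exact hsmul r x hx
  | mem x hx =>
    obtain ⟨i, hx⟩ := hx
    rcases hx with rfl | rfl | rfl | rfl | rfl | rfl | rfl | rfl | rfl | rfl
    · rcases i with _ | i
      · simpa using h0
      · rw [pow_succ', ← mul_assoc, S.e0_mul_w₀, ← pow_succ']; exact hw' i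
    · rcases i with _ | i
      · simpa using hα
      · exact hcomm _ (S.αw₁_pow_mem i.succ_ne_zero)
    · exact hcomm _ (S.αβ_w₂_pow_mem i)
    · exact hcomm _ (S.β_w₂_pow_mem i)
    · rcases i with _ | i
      · rw [pow_zero, mul_one]
        refine hsub (mul_sub_mul_mem_commutatorSpan _ _) ?_
        rw [S.γβ']; exact hsmul _ _ (hη' _)
      · exact hcomm _ (S.βγ_w₀_pow_mem i.succ_ne_zero)
    · exact hsub (S.βγα_sub_mem i) (hw' i)
    · exact hcomm _ (S.γ_w₀_pow_mem i)
    · exact hcomm _ (S.γα_w₁_pow_mem i)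
    · exact hsub (S.γαβ_sub_mem i) (hw' i)
    · exact hη' i

theorem f_comm_zero {x : A} (hx : x ∈ commutatorSpan K A) : S.f x = 0 :=
  trace_eq_zero_of_mem_commutatorSpan S.f S.f_comm hx

theorem f_eq_of_sub_mem {x y : A} (h : x - y ∈ commutatorSpan K A) : S.f x = S.f y := by
  rw [← sub_eq_zero, ← map_sub, S.f_comm_zero h]

theorem f_central_comm {z : A} (hz : ∀ a, z * a = a * z) {x : A}
    (hx : x ∈ commutatorSpan K A) : S.f (z * x) = 0 :=
  S.f_comm_zero (central_mul_mem_commutatorSpan hz hx)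

theorem τ_comm {x : A} (hx : x ∈ commutatorSpan K A) : S.τ x = 0 :=
  trace_eq_zero_of_mem_commutatorSpan S.τ.toLinearMap
    (fun x y => by simp [mul_comm]) hx

theorem ε₁_comm {x : A} (hx : x ∈ commutatorSpan K A) : S.ε₁ x = 0 :=
  trace_eq_zero_of_mem_commutatorSpan S.ε₁.toLinearMap
    (fun x y => by simp [mul_comm]) hx

theorem f_w₀_pow {i : ℕ} (hi : i ≠ 0) : S.f (S.w₀ ^ i) = if i = k then 1 else 0 := by
  split_ifs with h
  · rw [h]; exact S.f_top
  · rcases lt_or_ge i k with h' | h'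
    · exact S.f_pow i (by omega) h'
    · rw [S.w₀_pow_of_lt (by omega), map_zero]

theorem f_w₁_pow {i : ℕ} (hi : i ≠ 0) : S.f (S.w₁ ^ i) = if i = k then 1 else 0 := by
  rw [S.f_eq_of_sub_mem (S.w₁_pow_sub_mem hi), S.f_w₀_pow hi]

theorem f_w₂_pow {i : ℕ} (hi : i ≠ 0) : S.f (S.w₂ ^ i) = if i = k then 1 else 0 := by
  rw [S.f_eq_of_sub_mem (S.w₂_pow_sub_mem hi), S.f_w₀_pow hi]

theorem f_η_pow {j : ℕ} (hj : j ≠ 0) : S.f (S.η ^ j) = if j = s then 1 else 0 := by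
  split_ifs with h
  · have := S.k_pos
    rw [h, S.η_pow_s, S.f_w₂_pow (by omega), if_pos rfl]
  · rcases lt_or_ge j s with h' | h'
    · exact S.f_η j (by omega) h'
    · rw [S.η_pow_of_lt (by omega), map_zero]

theorem central_of_commute {z : A} (h0 : Commute z S.e0) (h1 : Commute z S.e1)
    (hα : Commute z S.α) (hβ : Commute z S.β) (hγ : Commute z S.γ) (hη : Commute z S.η) (a : A) :
    z * a = a * z := by
  have ha : a ∈ Algebra.adjoin K {S.e0, S.e1, S.α, S.β, S.γ, S.η} := by
    rw [S.adjoin_eq_top]; trivial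
  change Commute z a
  induction ha using Algebra.adjoin_induction with
  | mem g hg =>
    rcases hg with rfl | rfl | rfl | rfl | rfl | rfl
    exacts [h0, h1, hα, hβ, hγ, hη]
  | algebraMap r => exact (Algebra.commutes r z).symm
  | add a b _ _ ha hb => exact ha.add_right hb
  | mul a b _ _ ha hb => exact ha.mul_right hb

/-- The sum of the rotations of `αβγ`, a central element. -/
def u : A := S.w₀ + S.w₁ + S.w₂

theorem e1_mul_w₀ : S.e1 * S.w₀ = 0 := by
  rw [← S.e0_mul_w₀, ← mul_assoc, S.e1_e0, zero_mul]
theorem e1_mul_w₁ : S.e1 * S.w₁ = 0 := by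
  rw [← S.e0_mul_w₁, ← mul_assoc, S.e1_e0, zero_mul]
theorem e0_mul_w₂ : S.e0 * S.w₂ = 0 := by
  rw [← S.e1_mul_w₂, ← mul_assoc, S.e0_e1, zero_mul]
theorem w₀_mul_e1 : S.w₀ * S.e1 = 0 := by
  rw [← S.w₀_mul_e0, mul_assoc, S.e0_e1, mul_zero]
theorem w₁_mul_e1 : S.w₁ * S.e1 = 0 := by
  rw [← S.w₁_mul_e0, mul_assoc, S.e0_e1, mul_zero]
theorem w₂_mul_e0 : S.w₂ * S.e0 = 0 := by
  rw [← S.w₂_mul_e1, mul_assoc, S.e1_e0, mul_zero]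
theorem w₂_mul_α : S.w₂ * S.α = 0 := by
  rw [← S.w₂_mul_e1, mul_assoc, S.e1_mul_α, mul_zero]
theorem w₂_mul_β : S.w₂ * S.β = 0 := by
  rw [← S.w₂_mul_e1, mul_assoc, S.e1_mul_β, mul_zero]
theorem α_mul_w₂ : S.α * S.w₂ = 0 := by
  rw [← S.e1_mul_w₂, ← mul_assoc, S.α_mul_e1, zero_mul]
theorem γ_mul_w₂ : S.γ * S.w₂ = 0 := by
  rw [← S.e1_mul_w₂, ← mul_assoc, S.γ_mul_e1, zero_mul]
theorem β_mul_w₀ : S.β * S.w₀ = 0 := by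
  rw [← S.e0_mul_w₀, ← mul_assoc, S.β_mul_e0, zero_mul]
theorem β_mul_w₁ : S.β * S.w₁ = 0 := by
  rw [← S.e0_mul_w₁, ← mul_assoc, S.β_mul_e0, zero_mul]
theorem w₀_mul_γ : S.w₀ * S.γ = 0 := by
  rw [← S.w₀_mul_e0, mul_assoc, S.e0_mul_γ, mul_zero]
theorem w₁_mul_γ : S.w₁ * S.γ = 0 := by
  rw [← S.w₁_mul_e0, mul_assoc, S.e0_mul_γ, mul_zero]

theorem u_central (a : A) : S.u * a = a * S.u := by
  have hα := S.w₀_pow_α 1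
  have hβ := S.w₁_pow_β 1
  have hγ := S.w₂_pow_γ 1
  simp only [pow_one] at hα hβ hγ
  refine S.central_of_commute ?_ ?_ ?_ ?_ ?_ ?_ a <;>
    simp only [Commute, SemiconjBy, u, add_mul, mul_add, S.w₀_mul_e0, S.e0_mul_w₀, S.w₁_mul_e0,
      S.e0_mul_w₁, S.e1_mul_w₂, S.w₂_mul_e1, S.e1_mul_w₀, S.e1_mul_w₁, S.e0_mul_w₂, S.w₀_mul_e1,
      S.w₁_mul_e1, S.w₂_mul_e0, S.w₂_mul_α, S.w₂_mul_β, S.α_mul_w₂, S.γ_mul_w₂, S.β_mul_w₀,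
      S.β_mul_w₁, S.w₀_mul_γ, S.w₁_mul_γ, S.w₂_mul_η, S.η_mul_w₂, S.w₁_mul_η, S.w₀_mul_η,
      S.η_mul_w₀, S.η_mul_w₁, S.w₁_mul_α, S.α_mul_w₀, S.w₀_mul_β, S.γ_mul_w₁, hα, hβ, hγ,
      add_zero, zero_add]

theorem u_pow {j : ℕ} (hj : j ≠ 0) : S.u ^ j = S.w₀ ^ j + S.w₁ ^ j + S.w₂ ^ j := by
  induction j with
  | zero => exact absurd rfl hj
  | succ j ih =>
    rcases Nat.eq_zero_or_pos j with rfl | hj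
    · simp [u]
    · rw [pow_succ, ih hj.ne', u]
      simp only [add_mul, mul_add, pow_mul_eq_zero S.w₀_mul_w₁ hj.ne',
        pow_mul_eq_zero S.w₀_mul_w₂ hj.ne', pow_mul_eq_zero S.w₁_mul_w₀ hj.ne',
        pow_mul_eq_zero S.w₁_mul_w₂ hj.ne', pow_mul_eq_zero S.w₂_mul_w₀ hj.ne',
        pow_mul_eq_zero S.w₂_mul_w₁ hj.ne', add_zero, zero_add, pow_succ]

theorem u_pow_central (j : ℕ) (a : A) : S.u ^ j * a = a * S.u ^ j :=
  Commute.pow_left (S.u_central a) j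

theorem η_pow_mul_αw₁ {j : ℕ} (hj : j ≠ 0) (i : ℕ) : S.η ^ j * (S.α * S.w₁ ^ i) = 0 := by
  rw [← mul_assoc, pow_mul_eq_zero S.η_mul_α hj, zero_mul]

/-- A central element with the same products as `η` modulo lower terms. -/
def ζ : A := S.η + ν • (S.α * S.w₁ ^ (k - 1))

theorem αα_pow_mul {i : ℕ} (hi : i ≠ 0) : S.α * S.w₁ ^ i * S.α = 0 := by
  rw [mul_assoc, pow_mul_eq_zero S.w₁_mul_α hi, mul_zero]

theorem αα_mul_pow {i : ℕ} (hi : i ≠ 0) : S.α * (S.α * S.w₁ ^ i) = 0 := by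
  rw [← S.w₀_pow_α, ← mul_assoc, mul_pow_eq_zero S.α_mul_w₀ hi, zero_mul]

/-- For `ν ≠ 0` the relations give `βη = ν α β w₂ ^ (k - 1)` and a companion formula for `ηγ`. The
summand `ν α w₁ ^ (k - 1)` produces the same terms on the other side of `β` and `γ`. -/
theorem ζ_central (a : A) : S.ζ * a = a * S.ζ := by
  refine S.central_of_commute ?_ ?_ ?_ ?_ ?_ ?_ a <;>
    simp only [Commute, SemiconjBy, ζ, add_mul, mul_add, smul_mul_assoc, mul_smul_comm]
  · rw [S.η_mul_e0, S.e0_mul_η, ← S.w₀_pow_α, mul_assoc, S.α_e0, S.w₀_pow_α, ← mul_assoc, S.e0_α]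
  · rw [S.η_e1, S.e1_η, ← S.w₀_pow_α, mul_assoc, S.α_mul_e1, S.w₀_pow_α, ← mul_assoc, S.e1_mul_α,
      zero_mul, mul_zero]
  · rw [S.η_mul_α, S.α_mul_η]
    rcases eq_or_ne (k - 1) 0 with h | h
    · rw [h, pow_zero, mul_one]
    · rw [S.αα_pow_mul h, S.αα_mul_pow h]
  · rw [S.η_mul_β, S.βη', mul_assoc S.α, S.w₁_pow_β, ← mul_assoc S.β, S.β_mul_α, zero_mul,
      smul_zero, mul_assoc S.α, zero_add, add_zero]
  · rw [S.γ_mul_η, S.ηγ', mul_assoc S.α, mul_assoc S.γ]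
    have : S.α * (S.w₁ ^ (k - 1) * S.γ) = 0 := by
      rw [← mul_assoc, ← S.w₀_pow_α, mul_assoc, S.α_mul_γ, mul_zero]
    rw [this, smul_zero, add_zero, zero_add]
  · rw [← mul_assoc, S.η_mul_α, zero_mul, ← S.w₀_pow_α, mul_assoc, S.α_mul_η, mul_zero]

theorem ηη_central (a : A) : S.η ^ 2 * a = a * S.η ^ 2 := by
  refine S.central_of_commute ?_ ?_ ?_ ?_ ?_ ?_ a <;>
    simp only [Commute, SemiconjBy, pow_two]
  · rw [mul_assoc, S.η_mul_e0, ← mul_assoc, S.e0_mul_η, mul_zero, zero_mul]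
  · rw [mul_assoc, S.η_e1, ← mul_assoc, S.e1_η]
  · rw [mul_assoc, S.η_mul_α, ← mul_assoc, S.α_mul_η, mul_zero, zero_mul]
  · rw [mul_assoc, S.η_mul_β, ← mul_assoc, S.βηη, mul_zero]
  · rw [S.ηηγ, ← mul_assoc, S.γ_mul_η, zero_mul]
  · rw [mul_assoc]

/-- The central element that agrees with `η ^ j` in products with powers of `η`. -/
def ζpow (j : ℕ) : A := S.η ^ (j - 1) * S.ζ

theorem ζpow_eq {j : ℕ} (hj : 2 ≤ j) : S.ζpow j = S.η ^ j := by
  obtain ⟨i, rfl⟩ : ∃ i, j = i + 1 + 1 := ⟨j - 2, by omega⟩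
  rw [ζpow, ζ, Nat.add_sub_cancel, mul_add, mul_smul_comm, S.η_pow_mul_αw₁ i.succ_ne_zero,
    smul_zero, add_zero, ← pow_succ]

theorem ζpow_one : S.ζpow 1 = S.ζ := by simp [ζpow]

theorem ζpow_add_two {j : ℕ} (hj : j ≠ 0) : S.ζpow (j + 2) = S.η ^ 2 * S.ζpow j := by
  rw [ζpow, ζpow, ← mul_assoc, ← pow_add]
  congr 2; omega

theorem ζpow_central {j : ℕ} (hj : j ≠ 0) (a : A) : S.ζpow j * a = a * S.ζpow j := by
  induction j using Nat.strong_induction_on generalizing a with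
  | _ j ih =>
    rcases j with _ | _ | _ | j
    · exact absurd rfl hj
    · rw [zero_add, S.ζpow_one]; exact S.ζ_central a
    · rw [S.ζpow_eq le_rfl]; exact S.ηη_central a
    · rw [S.ζpow_add_two j.succ_ne_zero, mul_assoc, ih (j + 1) (by omega) j.succ_ne_zero,
        ← mul_assoc, S.ηη_central, mul_assoc]

theorem ζpow_mul_η_pow {i j : ℕ} (hi : i ≠ 0) (hj : j ≠ 0) :
    S.ζpow j * S.η ^ i = S.η ^ (j + i) := by
  have h : S.α * S.w₁ ^ (k - 1) * S.η ^ i = 0 := by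
    rw [← S.w₀_pow_α, mul_assoc, mul_pow_eq_zero S.α_mul_η hi, mul_zero]
  rw [ζpow, ζ, mul_assoc, add_mul, smul_mul_assoc, h, smul_zero, add_zero, ← pow_succ', ← pow_add]
  congr 1; omega

theorem ζ_mul_w₀ : S.ζ * S.w₀ = 0 := by
  rw [ζ, add_mul, S.η_mul_w₀, smul_mul_assoc, ← S.w₀_pow_α, mul_assoc, S.α_mul_w₀, mul_zero,
    smul_zero, add_zero]

theorem ζpow_mul_w₀_pow {i : ℕ} (j : ℕ) (hi : i ≠ 0) : S.ζpow j * S.w₀ ^ i = 0 := by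
  rw [ζpow, mul_assoc, mul_pow_eq_zero S.ζ_mul_w₀ hi, mul_zero]

theorem u_pow_mul_w₀_pow {i j : ℕ} (hi : i ≠ 0) : S.u ^ j * S.w₀ ^ i = S.w₀ ^ (j + i) := by
  rcases eq_or_ne j 0 with rfl | hj
  · simp
  rw [S.u_pow hj, add_mul, add_mul, ← pow_add,
    pow_mul_eq_zero (mul_pow_eq_zero S.w₁_mul_w₀ hi) hj,
    pow_mul_eq_zero (mul_pow_eq_zero S.w₂_mul_w₀ hi) hj, add_zero, add_zero]

theorem u_pow_mul_η_pow {i j : ℕ} (hi : i ≠ 0) (hj : j ≠ 0) : S.u ^ j * S.η ^ i = 0 := by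
  rw [S.u_pow hj, add_mul, add_mul,
    pow_mul_eq_zero (mul_pow_eq_zero S.w₀_mul_η hi) hj,
    pow_mul_eq_zero (mul_pow_eq_zero S.w₁_mul_η hi) hj,
    pow_mul_eq_zero (mul_pow_eq_zero S.w₂_mul_η hi) hj, add_zero, add_zero]

theorem u_pow_mul_α {j : ℕ} (hj : j ≠ 0) : S.u ^ j * S.α = S.α * S.w₁ ^ j := by
  rw [S.u_pow hj, add_mul, add_mul, pow_mul_eq_zero S.w₁_mul_α hj,
    pow_mul_eq_zero S.w₂_mul_α hj, add_zero, add_zero, S.w₀_pow_α]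

/-- The element `w₀ ^ k = w₁ ^ k` is annihilated on the right by every arrow, so only the
coefficient of the vertex `e0`, read by `τ`, survives. -/
theorem w₀_top_mul (x : A) : S.w₀ ^ k * x = (S.τ x).fst • S.w₀ ^ k := by
  have hk : k ≠ 0 := by have := S.k_pos; omega
  have hx : x ∈ Algebra.adjoin K {S.e0, S.e1, S.α, S.β, S.γ, S.η} := by
    rw [S.adjoin_eq_top]; trivial
  induction hx using Algebra.adjoin_induction with
  | mem g hg =>
    rcases hg with rfl | rfl | rfl | rfl | rfl | rfl
    · rw [S.τ_e0, S.w₀_top]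
      rw [pow_mul_eq_self S.w₁_mul_e0 hk, TrivSqZeroExt.fst_one, one_smul]
    · rw [S.τ_e1, pow_mul_eq_zero S.w₀_mul_e1 hk, TrivSqZeroExt.fst_zero, zero_smul]
    · rw [S.τ_α, S.w₀_top, pow_mul_eq_zero S.w₁_mul_α hk, DualNumber.fst_eps, zero_smul]
    · rw [S.τ_β, pow_mul_eq_zero S.w₀_mul_β hk, TrivSqZeroExt.fst_zero, zero_smul]
    · rw [S.τ_γ, pow_mul_eq_zero S.w₀_mul_γ hk, TrivSqZeroExt.fst_zero, zero_smul]
    · rw [S.τ_η, pow_mul_eq_zero S.w₀_mul_η hk, TrivSqZeroExt.fst_zero, zero_smul]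
  | algebraMap r =>
    rw [AlgHom.commutes, TrivSqZeroExt.algebraMap_eq_inl, TrivSqZeroExt.fst_inl,
      ← Algebra.commutes, Algebra.smul_def]
  | add a b _ _ ha hb => rw [mul_add, ha, hb, map_add, TrivSqZeroExt.fst_add, add_smul]
  | mul a b _ _ ha hb =>
    rw [← mul_assoc, ha, smul_mul_assoc, hb, map_mul, TrivSqZeroExt.fst_mul, mul_smul]

theorem f_top_mul (x : A) : S.f (S.w₀ ^ k * x) = (S.τ x).fst := by
  rw [S.w₀_top_mul, map_smul, w₀, S.f_top, smul_eq_mul, mul_one]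

theorem τ_w₀ : S.τ S.w₀ = 0 := by simp [w₀, S.τ_β]

theorem τ_w₀_pow {i : ℕ} (hi : i ≠ 0) : S.τ (S.w₀ ^ i) = 0 := by
  rw [map_pow, S.τ_w₀, zero_pow hi]

theorem τ_η_pow {i : ℕ} (hi : i ≠ 0) : S.τ (S.η ^ i) = 0 := by
  rw [map_pow, S.τ_η, zero_pow hi]

theorem ε₁_w₀_pow {i : ℕ} (hi : i ≠ 0) : S.ε₁ (S.w₀ ^ i) = 0 := by
  rw [map_pow, w₀, map_mul, map_mul, S.ε₁_α, zero_mul, zero_mul, zero_pow hi]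

theorem ε₁_η_pow {i : ℕ} (hi : i ≠ 0) : S.ε₁ (S.η ^ i) = 0 := by
  rw [map_pow, S.ε₁_η, zero_pow hi]

/-- The part of an element, modulo commutators and `(αβγ) ^ k`, that is spanned by powers. -/
def powerPart : A →ₗ[K] A :=
  ∑ i ∈ Finset.Ico 1 k, (S.f ∘ₗ LinearMap.mulLeft K (S.u ^ (k - i))).smulRight (S.w₀ ^ i) +
    ∑ j ∈ Finset.Ico 1 s, (S.f ∘ₗ LinearMap.mulLeft K (S.ζpow (s - j))).smulRight (S.η ^ j)

theorem powerPart_apply (x : A) : S.powerPart x =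
    ∑ i ∈ Finset.Ico 1 k, S.f (S.u ^ (k - i) * x) • S.w₀ ^ i +
      ∑ j ∈ Finset.Ico 1 s, S.f (S.ζpow (s - j) * x) • S.η ^ j := by
  simp [powerPart]

theorem powerPart_comm {x : A} (hx : x ∈ commutatorSpan K A) : S.powerPart x = 0 := by
  rw [powerPart_apply, Finset.sum_eq_zero, Finset.sum_eq_zero, add_zero]
  · intro j hj
    have := Finset.mem_Ico.1 hj
    rw [S.f_central_comm (S.ζpow_central (by omega)) hx, zero_smul]
  · intro j hj
    rw [S.f_central_comm (S.u_pow_central _) hx, zero_smul]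

/-- The functionals `f (u ^ (k - i) * ·)` and `f (ζpow (s - j) * ·)` kill commutators, since their
multipliers are central, and are dual to the powers `w₀ ^ i` and `η ^ j` below the top. -/
theorem powerPart_w₀_pow {i : ℕ} (hi : i ≠ 0) :
    S.powerPart (S.w₀ ^ i) = if i < k then S.w₀ ^ i else 0 := by
  rw [powerPart_apply]
  have h2 : ∑ j ∈ Finset.Ico 1 s, S.f (S.ζpow (s - j) * S.w₀ ^ i) • S.η ^ j = 0 :=
    Finset.sum_eq_zero fun j _ => by rw [S.ζpow_mul_w₀_pow _ hi, map_zero, zero_smul]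
  have h1 : ∀ j ∈ Finset.Ico 1 k, S.f (S.u ^ (k - j) * S.w₀ ^ i) • S.w₀ ^ j =
      if i = j then S.w₀ ^ j else 0 := fun j hj => by
    have := Finset.mem_Ico.1 hj
    rw [S.u_pow_mul_w₀_pow hi, S.f_w₀_pow (by omega), ite_smul, one_smul, zero_smul]
    exact if_congr (by omega) rfl rfl
  rw [h2, add_zero, Finset.sum_congr rfl h1, Finset.sum_ite_eq]
  exact if_congr (by rw [Finset.mem_Ico]; omega) rfl rfl

theorem powerPart_η_pow {i : ℕ} (hi : i ≠ 0) :
    S.powerPart (S.η ^ i) = if i < s then S.η ^ i else 0 := by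
  rw [powerPart_apply]
  have h1 : ∑ j ∈ Finset.Ico 1 k, S.f (S.u ^ (k - j) * S.η ^ i) • S.w₀ ^ j = 0 :=
    Finset.sum_eq_zero fun j hj => by
      have := Finset.mem_Ico.1 hj
      rw [S.u_pow_mul_η_pow hi (by omega), map_zero, zero_smul]
  have h2 : ∀ j ∈ Finset.Ico 1 s, S.f (S.ζpow (s - j) * S.η ^ i) • S.η ^ j =
      if i = j then S.η ^ j else 0 := fun j hj => by
    have := Finset.mem_Ico.1 hj
    rw [S.ζpow_mul_η_pow hi (by omega), S.f_η_pow (by omega), ite_smul, one_smul, zero_smul]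
    exact if_congr (by omega) rfl rfl
  rw [h1, zero_add, Finset.sum_congr rfl h2, Finset.sum_ite_eq]
  exact if_congr (by rw [Finset.mem_Ico]; omega) rfl rfl

/-- Modulo commutators the spanning classes are `e0`, `e1`, `α` and powers. The maps `τ` and `ε₁`
read the first three, `powerPart` reads the powers below the top, and only `w₀ ^ k` is left. -/
theorem sub_powerPart_mem {x : A} (hτ : S.τ x = 0) (hε : S.ε₁ x = 0) :
    x - S.powerPart x ∈ commutatorSpan K A ⊔ Submodule.span K {S.w₀ ^ k} := by
  -- Subtracting the contributions of `e0`, `e1` and `α` makes the claim linear in an unrestricted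
  -- `x`, so that it can be checked on spanning classes.
  let L : A →ₗ[K] A := LinearMap.id - S.powerPart
  suffices h : ∀ x, L x - (S.τ x).fst • L S.e0 - S.ε₁ x • L S.e1 - (S.τ x).snd • L S.α ∈
      commutatorSpan K A ⊔ Submodule.span K {S.w₀ ^ k} by
    have := h x
    rwa [hτ, hε, TrivSqZeroExt.fst_zero, TrivSqZeroExt.snd_zero, zero_smul, zero_smul, zero_smul,
      sub_zero, sub_zero, sub_zero] at this
  clear hτ hε x
  intro x
  have hz : ∀ x, S.τ x = 0 → S.ε₁ x = 0 →
      L x ∈ commutatorSpan K A ⊔ Submodule.span K {S.w₀ ^ k} →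
      L x - (S.τ x).fst • L S.e0 - S.ε₁ x • L S.e1 - (S.τ x).snd • L S.α ∈
      commutatorSpan K A ⊔ Submodule.span K {S.w₀ ^ k} := fun x h1 h2 h3 => by
    rwa [h1, h2, TrivSqZeroExt.fst_zero, TrivSqZeroExt.snd_zero, zero_smul, zero_smul, zero_smul,
      sub_zero, sub_zero, sub_zero]
  refine S.class_induction (C := fun x => L x - (S.τ x).fst • L S.e0 - S.ε₁ x • L S.e1 -
    (S.τ x).snd • L S.α ∈ commutatorSpan K A ⊔ Submodule.span K {S.w₀ ^ k})
    ?_ ?_ ?_ ?_ ?_ ?_ ?_ ?_ x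
  · intro x hx
    refine hz x (S.τ_comm hx) (S.ε₁_comm hx) ?_
    change x - S.powerPart x ∈ _
    rw [S.powerPart_comm hx, sub_zero]
    exact Submodule.mem_sup_left hx
  · intro x y hx hy
    convert add_mem hx hy using 1
    simp only [map_add, TrivSqZeroExt.fst_add, TrivSqZeroExt.snd_add, add_smul]
    abel
  · intro r x hx
    convert Submodule.smul_mem _ r hx using 1
    simp only [map_smul, TrivSqZeroExt.fst_smul, TrivSqZeroExt.snd_smul, smul_sub, smul_assoc]
  · simp [S.τ_e0, S.ε₁_e0]
  · simp [S.τ_e1, S.ε₁_e1]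
  · simp [S.τ_α, S.ε₁_α]
  · intro i h1 h2
    refine hz _ (S.τ_w₀_pow (by omega)) (S.ε₁_w₀_pow (by omega)) ?_
    change S.w₀ ^ i - S.powerPart (S.w₀ ^ i) ∈ _
    rw [S.powerPart_w₀_pow (by omega)]
    split_ifs with h
    · rw [sub_self]; exact zero_mem _
    · have : i = k := by omega
      rw [sub_zero, this]
      exact Submodule.mem_sup_right (Submodule.mem_span_singleton_self _)
  · intro j h1 h2
    refine hz _ (S.τ_η_pow (by omega)) (S.ε₁_η_pow (by omega)) ?_
    change S.η ^ j - S.powerPart (S.η ^ j) ∈ _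
    rw [S.powerPart_η_pow (by omega), if_pos h2, sub_self]
    exact zero_mem _

end SDModel

end ModelTraces

/-! ### Traces of squares and the action of nilpotent central elements. -/

section ModelSocle

namespace SDModel

variable {K A : Type u} [Field K] [Ring A] [Algebra K A] {k s : ℕ} {c μ ν : K}
  (S : SDModel K A k s c μ ν)

theorem f_αα : S.f (S.α * S.α) = c := by
  have h : S.f (S.β * S.γ * S.w₀ ^ (k - 1)) = 0 := by
    rcases eq_or_ne (k - 1) 0 with hk | hk
    · rw [hk, pow_zero, mul_one, S.f_comm, S.γβ', map_smul]
      rcases eq_or_ne (s - 1) 0 with hs | hs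
      · rw [hs, pow_zero, mul_one, S.f_e1, smul_zero]
      · obtain ⟨i, hi⟩ := Nat.exists_eq_succ_of_ne_zero hs
        rw [hi, pow_succ', ← mul_assoc, S.e1_η, ← pow_succ', S.f_η _ (by omega) (by omega),
          smul_zero]
    · exact S.f_comm_zero (S.βγ_w₀_pow_mem hk)
  rw [S.αα', map_add, map_smul, map_smul, h, smul_zero, zero_add, w₀, S.f_top, smul_eq_mul,
    mul_one]

theorem f_u_pow_mul_e0 {j : ℕ} (hj : j ≠ 0) (hk : j ≠ k) : S.f (S.u ^ j * S.e0) = 0 := by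
  rw [S.u_pow hj, add_mul, add_mul, pow_mul_eq_self S.w₀_mul_e0 hj, pow_mul_eq_self S.w₁_mul_e0 hj,
    pow_mul_eq_zero S.w₂_mul_e0 hj, map_add, map_add, S.f_w₀_pow hj, S.f_w₁_pow hj, if_neg hk,
    map_zero, add_zero, add_zero]

theorem f_u_pow_mul_e1 {j : ℕ} (hj : j ≠ 0) (hk : j ≠ k) : S.f (S.u ^ j * S.e1) = 0 := by
  rw [S.u_pow hj, add_mul, add_mul, pow_mul_eq_zero S.w₀_mul_e1 hj, pow_mul_eq_zero S.w₁_mul_e1 hj,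
    pow_mul_eq_self S.w₂_mul_e1 hj, map_add, map_add, S.f_w₂_pow hj, if_neg hk,
    map_zero, add_zero, add_zero]

theorem f_u_pow_mul_α {j : ℕ} (hj : j ≠ 0) : S.f (S.u ^ j * S.α) = 0 := by
  rw [S.u_pow_mul_α hj, S.f_comm_zero (S.αw₁_pow_mem hj)]

theorem ζpow_eq_of {j : ℕ} (hj : j ≠ 0) (h : j = 1 → ν = 0) : S.ζpow j = S.η ^ j := by
  rcases eq_or_ne j 1 with rfl | h1
  · simp [S.ζpow_one, ζ, h rfl]
  · exact S.ζpow_eq (by omega)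

/-- The mixed terms vanish, and `α w₁ ^ (k - 1)` has square zero unless `k = 1`, when its square is
`α * α`. The `μ`-part of that square disappears because `μ * ν = 0`. -/
theorem ζ_pow_two : S.ζ ^ 2 = S.η ^ 2 + if k = 1 then (ν ^ 2 * c) • S.w₀ ^ k else 0 := by
  have h1 : S.η * (S.α * S.w₁ ^ (k - 1)) = 0 := by rw [← mul_assoc, S.η_mul_α, zero_mul]
  have h2 : S.α * S.w₁ ^ (k - 1) * S.η = 0 := by
    rw [← S.w₀_pow_α, mul_assoc, S.α_mul_η, mul_zero]
  have h3 : ν • (S.α * S.w₁ ^ (k - 1)) * ν • (S.α * S.w₁ ^ (k - 1)) =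
      if k = 1 then (ν ^ 2 * c) • S.w₀ ^ k else 0 := by
    split_ifs with h
    · have hk : k - 1 = 0 := by omega
      rw [hk, pow_zero, mul_one, smul_mul_smul_comm, S.αα', smul_add, smul_smul, smul_smul,
        mul_assoc ν ν μ, mul_comm ν μ, S.μν, mul_zero, zero_smul, zero_add, pow_two]
    · have hk : k - 1 ≠ 0 := by have := S.k_pos; omega
      rw [smul_mul_smul_comm, ← mul_assoc, S.αα_pow_mul hk, zero_mul, smul_zero]
  rw [pow_two, pow_two, ← h3, ζ, add_mul, mul_add, mul_add, mul_smul_comm, h1, smul_mul_assoc _ _ S.η,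
    h2, smul_zero, add_zero, zero_add]

/-- Elements killed by all these traces are multiples of the socle modulo commutators. -/
theorem mem_of_traces {x : A} (hτ : S.τ x = 0) (hε : S.ε₁ x = 0)
    (hu : ∀ j, 1 ≤ j → j < k → S.f (S.u ^ j * x) = 0)
    (hζ : ∀ j, 1 ≤ j → j < s → S.f (S.ζpow j * x) = 0) :
    x ∈ commutatorSpan K A ⊔ Submodule.span K {S.w₀ ^ k} := by
  have h := S.sub_powerPart_mem hτ hε
  have h0 : S.powerPart x = 0 := by
    rw [powerPart_apply, Finset.sum_eq_zero, Finset.sum_eq_zero, add_zero]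
    · intro j hj
      have := Finset.mem_Ico.1 hj
      rw [hζ _ (by omega) (by omega), zero_smul]
    · intro j hj
      have := Finset.mem_Ico.1 hj
      rw [hu _ (by omega) (by omega), zero_smul]
  rwa [h0, sub_zero] at h

variable [CharP K 2]

/-- The trace form on squares. -/
theorem f_mul_self (hs : s = 2 → ν = 0) (x : A) : S.f (x * x) =
    c * (S.τ x).snd ^ 2 + (if Even k then S.f (S.u ^ (k / 2) * x) ^ 2 else 0) +
      (if Even s then S.f (S.ζpow (s / 2) * x) ^ 2 else 0) := by
  have hk1 := S.k_pos
  have hs1 := S.s_pos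
  have hk : Even k → k / 2 ≠ 0 ∧ k / 2 ≠ k ∧ k / 2 + k / 2 = k := fun h => by
    obtain ⟨r, hr⟩ := h; omega
  have hs' : Even s → s / 2 ≠ 0 ∧ s / 2 ≠ s ∧ s / 2 + s / 2 = s := fun h => by
    obtain ⟨r, hr⟩ := h; omega
  -- Only `s = 2` could prevent this, as `ζpow 1 = ζ` contains the correction with `ν`; this is the
  -- role of `hs`.
  have hζ : Even s → S.ζpow (s / 2) = S.η ^ (s / 2) := fun h =>
    S.ζpow_eq_of (hs' h).1 fun h1 => hs (by have := hs' h; omega)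
  -- Both sides are additive, scale by `r ^ 2` and vanish on commutators, so the spanning classes
  -- suffice. A power contributes exactly when its exponent is half of `k` or of `s`.
  refine S.class_induction (C := fun x => S.f (x * x) =
    c * (S.τ x).snd ^ 2 + (if Even k then S.f (S.u ^ (k / 2) * x) ^ 2 else 0) +
      (if Even s then S.f (S.ζpow (s / 2) * x) ^ 2 else 0)) ?_ ?_ ?_ ?_ ?_ ?_ ?_ ?_ x
  · intro x hx
    rw [S.f_comm_zero (square_mem_commutatorSpan hx), S.τ_comm hx,
      S.f_central_comm (S.u_pow_central _) hx]
    split_ifs with h1 h2 h2 <;> simp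
    all_goals rw [S.f_central_comm (S.ζpow_central (hs' h2).1) hx, zero_pow two_ne_zero]
  · intro x y hx hy
    have e : S.f ((x + y) * (x + y)) = S.f (x * x) + S.f (y * y) := by
      have h := S.f_comm x y
      have h2 := add_self_eq_zero_of_charTwo K (S.f (y * x))
      simp only [add_mul, mul_add, map_add]
      linear_combination h + h2
    have sq : ∀ a b : K, (a + b) ^ 2 = a ^ 2 + b ^ 2 := fun a b => by
      have := add_self_eq_zero_of_charTwo K (a * b)
      linear_combination this
    rw [e, hx, hy, map_add, TrivSqZeroExt.snd_add, mul_add, mul_add, map_add, map_add, sq, sq, sq]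
    split_ifs <;> ring
  · intro r x hx
    rw [smul_mul_smul_comm, map_smul, hx, map_smul, TrivSqZeroExt.snd_smul, mul_smul_comm,
      mul_smul_comm, map_smul, map_smul]
    simp only [smul_eq_mul]
    split_ifs <;> ring
  · rw [S.e0_e0, S.f_e0, S.τ_e0, TrivSqZeroExt.snd_one]
    have h1 : Even k → S.f (S.u ^ (k / 2) * S.e0) = 0 := fun h =>
      S.f_u_pow_mul_e0 (hk h).1 (hk h).2.1
    have h2 : Even s → S.f (S.ζpow (s / 2) * S.e0) = 0 := fun h => by
      rw [hζ h, pow_mul_eq_zero S.η_mul_e0 (hs' h).1, map_zero]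
    split_ifs with h3 h4 h4 <;> simp [h1, h2, h3, h4]
  · rw [S.e1_e1, S.f_e1, S.τ_e1, TrivSqZeroExt.snd_zero]
    have h1 : Even k → S.f (S.u ^ (k / 2) * S.e1) = 0 := fun h =>
      S.f_u_pow_mul_e1 (hk h).1 (hk h).2.1
    have h2 : Even s → S.f (S.ζpow (s / 2) * S.e1) = 0 := fun h => by
      rw [hζ h, pow_mul_eq_self S.η_e1 (hs' h).1, S.f_η_pow (hs' h).1, if_neg (hs' h).2.1]
    split_ifs with h3 h4 h4 <;> simp [h1, h2, h3, h4]
  · rw [S.f_αα, S.τ_α, DualNumber.snd_eps]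
    have h1 : Even k → S.f (S.u ^ (k / 2) * S.α) = 0 := fun h => S.f_u_pow_mul_α (hk h).1
    have h2 : Even s → S.f (S.ζpow (s / 2) * S.α) = 0 := fun h => by
      rw [hζ h, pow_mul_eq_zero S.η_mul_α (hs' h).1, map_zero]
    split_ifs with h3 h4 h4 <;> simp [h1, h2, h3, h4]
  · intro i h1 h2
    have hi : i ≠ 0 := by omega
    rw [S.ζpow_mul_w₀_pow _ hi, S.τ_w₀_pow hi, S.u_pow_mul_w₀_pow hi, ← pow_add,
      S.f_w₀_pow (by omega), S.f_w₀_pow (by omega)]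
    have e : i + i = k ↔ Even k ∧ k / 2 + i = k := by
      constructor
      · intro h; exact ⟨⟨i, h.symm⟩, by omega⟩
      · rintro ⟨h, h'⟩; have := hk h; omega
    simp only [e]
    split_ifs <;> simp_all
  · intro i h1 h2
    have hi : i ≠ 0 := by omega
    rw [S.τ_η_pow hi, ← pow_add, S.f_η_pow (by omega)]
    have e : i + i = s ↔ Even s ∧ s / 2 + i = s := by
      constructor
      · intro h; exact ⟨⟨i, h.symm⟩, by omega⟩
      · rintro ⟨h, h'⟩; have := hs' h; omega
    have h3 : Even k → S.f (S.u ^ (k / 2) * S.η ^ i) = 0 := fun h => by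
      rw [S.u_pow_mul_η_pow hi (hk h).1, map_zero]
    have h4 : Even s → S.f (S.ζpow (s / 2) * S.η ^ i) = if s / 2 + i = s then 1 else 0 :=
      fun h => by rw [S.ζpow_mul_η_pow hi (hs' h).1, S.f_η_pow (by omega)]
    simp only [e]
    split_ifs <;> simp_all

theorem w₀_top_mem_squareKernel : S.w₀ ^ k ∈ squareKernel K A := by
  rw [mem_squareKernel, ← pow_add, S.w₀_pow_of_lt (by have := S.k_pos; omega)]
  exact zero_mem _

/-- Some `zⁿ` sends `w₀ ^ k` into the commutators. But `w₀ ^ k * zⁿ` has `f`-value the `n`-th power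
of the vertex coefficient of `z`. -/
theorem τ_fst_of_nilCentral {z : A} (hz : z ∈ nilCentral K A) : (S.τ z).fst = 0 := by
  obtain ⟨hz, n, hn⟩ := hz
  have h1 := S.f_comm_zero (hn _ S.w₀_top_mem_squareKernel)
  have hzn : z ^ n * S.w₀ ^ k = S.w₀ ^ k * z ^ n := Commute.pow_left (hz _) n
  rw [hzn, S.f_top_mul, map_pow, TrivSqZeroExt.fst_pow] at h1
  exact eq_zero_of_pow_eq_zero h1

theorem u_mem_nilCentral : S.u ∈ nilCentral K A :=
  ⟨S.u_central, k + 1, fun x _ => by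
    rw [S.u_pow k.succ_ne_zero, S.w₀_pow_of_lt k.lt_succ_self, S.w₁_pow_of_lt k.lt_succ_self,
      S.w₂_pow_of_lt k.lt_succ_self, add_zero, add_zero, zero_mul]
    exact zero_mem _⟩

theorem w₀_top_mem_nilCentral : S.w₀ ^ k ∈ nilCentral K A := by
  have hk := S.k_pos
  refine ⟨fun a => ?_, 2, fun x _ => ?_⟩
  · rw [S.w₀_top_mul]
    have hk' : k ≠ 0 := by omega
    have ha : a ∈ Algebra.adjoin K {S.e0, S.e1, S.α, S.β, S.γ, S.η} := by
      rw [S.adjoin_eq_top]; trivial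
    induction ha using Algebra.adjoin_induction with
    | mem g hg =>
      rcases hg with rfl | rfl | rfl | rfl | rfl | rfl
      · rw [S.τ_e0, TrivSqZeroExt.fst_one, one_smul, mul_pow_eq_self S.e0_mul_w₀ hk']
      · rw [S.τ_e1, TrivSqZeroExt.fst_zero, zero_smul, mul_pow_eq_zero S.e1_mul_w₀ hk']
      · rw [S.τ_α, DualNumber.fst_eps, zero_smul, mul_pow_eq_zero S.α_mul_w₀ hk']
      · rw [S.τ_β, TrivSqZeroExt.fst_zero, zero_smul, mul_pow_eq_zero S.β_mul_w₀ hk']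
      · rw [S.τ_γ, TrivSqZeroExt.fst_zero, zero_smul, S.γ_mul_w₀_pow]
      · rw [S.τ_η, TrivSqZeroExt.fst_zero, zero_smul, mul_pow_eq_zero S.η_mul_w₀ hk']
    | algebraMap r =>
      rw [AlgHom.commutes, TrivSqZeroExt.algebraMap_eq_inl, TrivSqZeroExt.fst_inl,
        Algebra.smul_def]
    | add a b _ _ ha hb => rw [add_mul, ← ha, ← hb, map_add, TrivSqZeroExt.fst_add, add_smul]
    | mul a b _ _ ha hb =>
      rw [mul_assoc, ← hb, mul_smul_comm, ← ha, map_mul, TrivSqZeroExt.fst_mul, ← mul_smul,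
        mul_comm]
  · rw [← pow_mul, S.w₀_pow_of_lt (by omega), zero_mul]
    exact zero_mem _

theorem ζpow_mem_nilCentral {j : ℕ} (hj : 2 ≤ j) : S.ζpow j ∈ nilCentral K A :=
  ⟨S.ζpow_central (by omega), s + 1, fun x _ => by
    rw [S.ζpow_eq hj, ← pow_mul, S.η_pow_of_lt (by nlinarith), zero_mul]
    exact zero_mem _⟩

/-- For `k = 1` the square of `ζ` may still contain a multiple of `w₀ ^ k`. Squaring again removes
it, so `ζ ^ 4 = η ^ 4`, and this is nilpotent. -/
theorem ζ_mem_nilCentral : S.ζ ∈ nilCentral K A :=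
  ⟨S.ζ_central, (s + 1) * 2 * 2, fun x _ => by
    have e : S.ζ ^ 4 = S.η ^ 4 := by
      have h1 : S.η ^ 2 * S.w₀ ^ k = 0 :=
        mul_pow_eq_zero (pow_mul_eq_zero S.η_mul_w₀ two_ne_zero) (by have := S.k_pos; omega)
      have h2 : S.w₀ ^ k * S.η ^ 2 = 0 := by rw [← S.ηη_central, h1]
      have h3 : S.w₀ ^ k * S.w₀ ^ k = 0 := by
        rw [← pow_add, S.w₀_pow_of_lt (by have := S.k_pos; omega)]
      rw [show 4 = 2 * 2 from rfl, pow_mul, S.ζ_pow_two, pow_mul S.η]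
      split_ifs
      · rw [pow_two (_ + _), add_mul, mul_add, mul_add, mul_smul_comm, h1, smul_mul_assoc, h2,
          smul_mul_smul_comm, h3]
        simp only [smul_zero, add_zero, pow_two]
      · rw [add_zero]
    rw [show (s + 1) * 2 * 2 = 4 * (s + 1) by ring, pow_mul, e, ← pow_mul,
      S.η_pow_of_lt (by omega), zero_mul]
    exact zero_mem _⟩

/-- The second factor from `nilCentral` annihilates `w₀ ^ k`, so it is enough that the first one
brings `x` into the commutators plus that line. -/
theorem mem_secondSocle {x : A} (hx : x ∈ squareKernel K A) (h : ∀ z ∈ nilCentral K A,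
    z * x ∈ commutatorSpan K A ⊔ Submodule.span K {S.w₀ ^ k}) : x ∈ secondSocle K A := by
  refine ⟨hx, fun z hz z' hz' => ?_⟩
  obtain ⟨a, ha, b, hb, hab⟩ := Submodule.mem_sup.1 (h z' hz')
  obtain ⟨r, rfl⟩ := Submodule.mem_span_singleton.1 hb
  rw [← hab, mul_add, mul_smul_comm, hz.1 (S.w₀ ^ k), S.w₀_top_mul, S.τ_fst_of_nilCentral hz, zero_smul,
    smul_zero, add_zero]
  exact central_mul_mem_commutatorSpan hz.1 ha

theorem nilCentral_mul_top {z : A} (hz : z ∈ nilCentral K A) : z * S.w₀ ^ k = 0 := by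
  rw [hz.1, S.w₀_top_mul, S.τ_fst_of_nilCentral hz, zero_smul]

/-- All traces of `mem_of_traces` vanish. Cyclicity brings the two ends of `α w₁ ^ j` together,
where `w₁ * α = 0`; and `ζpow j * α = 0`. For `j = 1` and `k = 1` the latter needs `ν c = 0`,
because there `ζ * α = ν α²`. -/
theorem nilCentral_mul_α (h : c * ν = 0 ∨ k ≠ 1) {z : A} (hz : z ∈ nilCentral K A) :
    z * S.α ∈ commutatorSpan K A ⊔ Submodule.span K {S.w₀ ^ k} := by
  refine S.mem_of_traces ?_ ?_ ?_ ?_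
  · rw [map_mul, S.τ_α]
    ext <;> simp [S.τ_fst_of_nilCentral hz]
  · rw [map_mul, S.ε₁_α, mul_zero]
  · intro j hj _
    rw [← mul_assoc, ← hz.1, mul_assoc, S.u_pow_mul_α (by omega), ← mul_assoc, S.f_comm,
      ← mul_assoc, ← hz.1, mul_assoc, pow_mul_eq_zero S.w₁_mul_α (by omega), mul_zero, map_zero]
  · intro j hj _
    have e : S.ζpow j * S.α = 0 := by
      rcases eq_or_ne j 1 with rfl | h1
      · rw [S.ζpow_one, ζ, add_mul, S.η_mul_α, zero_add, smul_mul_assoc]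
        rcases eq_or_ne (k - 1) 0 with hk | hk
        · have := S.k_pos
          have hc : ν * c = 0 := by
            rw [mul_comm]; exact h.resolve_right (by omega)
          rw [hk, pow_zero, mul_one, S.αα', smul_add, smul_smul, smul_smul, mul_comm ν μ, S.μν, hc,
            zero_smul, zero_smul, add_zero]
        · rw [S.αα_pow_mul hk, smul_zero]
      · rw [S.ζpow_eq (by omega), pow_mul_eq_zero S.η_mul_α (by omega)]
    rw [← mul_assoc, ← hz.1, mul_assoc, e, mul_zero, map_zero]

theorem nilCentral_mul_w₀_pow (hk : 2 ≤ k) {z : A} (hz : z ∈ nilCentral K A) :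
    z * S.w₀ ^ (k - 1) ∈ commutatorSpan K A ⊔ Submodule.span K {S.w₀ ^ k} := by
  refine S.mem_of_traces ?_ ?_ ?_ ?_
  · rw [map_mul, S.τ_w₀_pow (by omega), mul_zero]
  · rw [map_mul, S.ε₁_w₀_pow (by omega), mul_zero]
  · intro j hj _
    rw [← mul_assoc, ← hz.1, mul_assoc, S.u_pow_mul_w₀_pow (by omega)]
    rcases eq_or_ne j 1 with rfl | h1
    · rw [show 1 + (k - 1) = k by omega, S.nilCentral_mul_top hz, map_zero]
    · rw [S.w₀_pow_of_lt (by omega), mul_zero, map_zero]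
  · intro j hj _
    rw [← mul_assoc, ← hz.1, mul_assoc, S.ζpow_mul_w₀_pow _ (by omega), mul_zero, map_zero]

theorem nilCentral_mul_η_pow (hs : 2 ≤ s) {z : A} (hz : z ∈ nilCentral K A) :
    z * S.η ^ (s - 1) ∈ commutatorSpan K A ⊔ Submodule.span K {S.w₀ ^ k} := by
  have hk := S.k_pos
  refine S.mem_of_traces ?_ ?_ ?_ ?_
  · rw [map_mul, S.τ_η_pow (by omega), mul_zero]
  · rw [map_mul, S.ε₁_η_pow (by omega), mul_zero]
  · intro j hj _
    rw [← mul_assoc, ← hz.1, mul_assoc, S.u_pow_mul_η_pow (by omega) (by omega), mul_zero,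
      map_zero]
  · intro j hj _
    rw [← mul_assoc, ← hz.1, mul_assoc, S.ζpow_mul_η_pow (by omega) (by omega)]
    rcases eq_or_ne j 1 with rfl | h1
    · have h2 := central_mul_mem_commutatorSpan hz.1 (S.w₂_pow_sub_mem (i := k) (by omega))
      rw [mul_sub, S.nilCentral_mul_top hz, sub_zero] at h2
      rw [show 1 + (s - 1) = s by omega, S.η_pow_s, S.f_comm_zero h2]
    · rw [S.η_pow_of_lt (by omega), mul_zero, map_zero]

end SDModel

end ModelSocle

/-! ### The case `k ≠ 2` and `s ≠ 2`: dimension of the second socle. -/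

section ModelInvariant

namespace SDModel

section Socle

variable {K A : Type u} [Field K] [CharP K 2] [Ring A] [Algebra K A] {k s : ℕ} {c μ ν : K}
  (S : SDModel K A k s c μ ν)

theorem u_pow_mem_nilCentral {j : ℕ} (hj : j ≠ 0) : S.u ^ j ∈ nilCentral K A :=
  ⟨S.u_pow_central j, k + 1, fun x _ => by
    have h : k < j * (k + 1) := by nlinarith [Nat.pos_of_ne_zero hj]
    rw [← pow_mul, S.u_pow (by omega), S.w₀_pow_of_lt h, S.w₁_pow_of_lt h,
      S.w₂_pow_of_lt h, add_zero, add_zero, zero_mul]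
    exact zero_mem _⟩

theorem τ_fst_of_squareKernel {x : A} (hx : x ∈ squareKernel K A) : (S.τ x).fst = 0 := by
  have h := congrArg TrivSqZeroExt.fst (S.τ_comm hx)
  rw [map_mul, TrivSqZeroExt.fst_mul, TrivSqZeroExt.fst_zero] at h
  exact mul_self_eq_zero.1 h

theorem ε₁_of_squareKernel {x : A} (hx : x ∈ squareKernel K A) : S.ε₁ x = 0 := by
  have h := S.ε₁_comm hx
  rw [map_mul] at h
  exact mul_self_eq_zero.1 h

theorem f_u_pow_of_secondSocle {x : A} (hx : x ∈ secondSocle K A) {j : ℕ} (hj : 2 ≤ j) :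
    S.f (S.u ^ j * x) = 0 := by
  have h := hx.2 S.u S.u_mem_nilCentral (S.u ^ (j - 1)) (S.u_pow_mem_nilCentral (by omega))
  rw [← mul_assoc, ← pow_succ', Nat.sub_add_cancel (by omega)] at h
  exact S.f_comm_zero h

/-- For `j ≥ 3` the element factors as `η ^ 2 * ζpow (j - 2)` inside `nilCentral`. For `j = 2` it is
`ζ ^ 2` up to a multiple of `w₀ ^ k`, which pairs to zero with `squareKernel`. -/
theorem f_ζpow_of_secondSocle {x : A} (hx : x ∈ secondSocle K A) {j : ℕ} (hj : 2 ≤ j) :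
    S.f (S.ζpow j * x) = 0 := by
  rcases hj.eq_or_lt with rfl | hj
  · have h := S.f_comm_zero (hx.2 _ S.ζ_mem_nilCentral _ S.ζ_mem_nilCentral)
    rw [← mul_assoc, ← pow_two, S.ζ_pow_two] at h
    rw [S.ζpow_eq le_rfl]
    split_ifs at h
    · rwa [add_mul, smul_mul_assoc, map_add, map_smul, S.f_top_mul, S.τ_fst_of_squareKernel hx.1,
        smul_zero, add_zero] at h
    · rwa [add_zero] at h
  · obtain ⟨i, rfl⟩ : ∃ i, j = i + 2 := ⟨j - 2, by omega⟩
    have h2 : S.ζpow i ∈ nilCentral K A := by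
      rcases eq_or_ne i 1 with rfl | hi
      · rw [S.ζpow_one]; exact S.ζ_mem_nilCentral
      · exact S.ζpow_mem_nilCentral (by omega)
    have h := hx.2 _ (S.ζpow_mem_nilCentral le_rfl) _ h2
    rw [← mul_assoc, S.ζpow_eq le_rfl, ← S.ζpow_add_two (by omega)] at h
    exact S.f_comm_zero h

/-- The powers that lie in the second socle. -/
def socleVec : Fin 3 → A := ![S.w₀ ^ k, S.w₀ ^ (k - 1), S.η ^ (s - 1)]

theorem powerPart_of_secondSocle {x : A} (hx : x ∈ secondSocle K A) {V : Submodule K A}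
    (hw : 2 ≤ k → S.f (S.u * x) • S.w₀ ^ (k - 1) ∈ V)
    (hη : 2 ≤ s → S.f (S.ζ * x) • S.η ^ (s - 1) ∈ V) :
    S.powerPart x ∈ V := by
  rw [powerPart_apply]
  refine add_mem (Submodule.sum_mem _ fun i hi => ?_) (Submodule.sum_mem _ fun j hj => ?_)
  · have := Finset.mem_Ico.1 hi
    rcases eq_or_ne i (k - 1) with rfl | h
    · rw [show k - (k - 1) = 1 by omega, pow_one]; exact hw (by omega)
    · rw [S.f_u_pow_of_secondSocle hx (by omega), zero_smul]; exact zero_mem _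
  · have := Finset.mem_Ico.1 hj
    rcases eq_or_ne j (s - 1) with rfl | h
    · rw [show s - (s - 1) = 1 by omega, S.ζpow_one]; exact hη (by omega)
    · rw [S.f_ζpow_of_secondSocle hx (by omega), zero_smul]; exact zero_mem _

theorem w₀_pow_mem_squareKernel {i : ℕ} (hi : k < i + i) : S.w₀ ^ i ∈ squareKernel K A := by
  rw [mem_squareKernel, ← pow_add, S.w₀_pow_of_lt hi]
  exact zero_mem _

theorem η_pow_mem_squareKernel {i : ℕ} (hi : s < i + i) : S.η ^ i ∈ squareKernel K A := by
  rw [mem_squareKernel, ← pow_add, S.η_pow_of_lt hi]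
  exact zero_mem _

end Socle

/-- Trace forms dual to a family show its independence modulo commutators. -/
theorem coeff_eq_zero_of_dual {K A : Type u} [Field K] [Ring A] [Algebra K A] {ι : Type*}
    [Fintype ι] [DecidableEq ι] (v : ι → A) (ψ : ι → A →ₗ[K] K)
    (hψ : ∀ i, ∀ x ∈ commutatorSpan K A, ψ i x = 0)
    (hd : ∀ i j, ψ i (v j) = if i = j then 1 else 0) (a : ι → K)
    (ha : ∑ i, a i • v i ∈ commutatorSpan K A) (i : ι) : a i = 0 := by
  have h := hψ i _ ha
  simpa [hd] using h

/-- The path `βγ w₀ ^ (k - 1)` is a commutator for `k ≥ 2`. For `k = 1` it is `βγ ≡ γβ = ν η ^ (s -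
1)`, removed by `μ * ν = 0`. -/
theorem αα_sub_mem {K A : Type u} [Field K] [Ring A] [Algebra K A] {k s : ℕ}
    {c μ ν : K} (S : SDModel K A k s c μ ν) :
    S.α * S.α - c • S.w₀ ^ k ∈ commutatorSpan K A := by
  rw [S.αα', add_sub_cancel_right]
  rcases eq_or_ne (k - 1) 0 with hk | hk
  · have h := Submodule.smul_mem _ μ (mul_sub_mul_mem_commutatorSpan (K := K) S.β S.γ)
    rw [S.γβ', smul_sub, smul_smul, S.μν, zero_smul, sub_zero] at h
    rwa [hk, pow_zero, mul_one]
  · exact Submodule.smul_mem _ _ (S.βγ_w₀_pow_mem hk)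

variable {K A B : Type u} [Field K] [CharP K 2] [Ring A] [Algebra K A] [Ring B] [Algebra K B]
  {k s : ℕ} {μ ν μ' ν' : K}

/-- Modulo commutators the second socle for `c = 0` contains the independent classes of `α`, `w₀ ^
k`, `w₀ ^ (k - 1)` if `k ≥ 3` and `η ^ (s - 1)` if `s ≥ 3`. For `c = 1` it is spanned by these
without `α`, so an injection is impossible. -/
theorem isEmpty_transfer (S : SDModel K A k s 0 μ ν) (S' : SDModel K B k s 1 μ' ν') (hk : k ≠ 2)
    (hs : s ≠ 2) : IsEmpty (StableTransfer K A B) := by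
  refine ⟨fun T => ?_⟩
  have hk1 := S.k_pos
  have hs1 := S.s_pos
  -- For `k = 1` the power `w₀ ^ (k - 1)` is the unit and must not be counted; for `k ≥ 3` its
  -- square is zero. The same holds for `η` and `s`.
  let κ := {t : Fin 3 // (t = 1 → 3 ≤ k) ∧ (t = 2 → 3 ≤ s)}
  let v : Option κ → A := fun o => o.elim S.α fun t => S.socleVec t
  let ψ : Option κ → A →ₗ[K] K := fun o =>
    o.elim ((TrivSqZeroExt.sndHom K K).restrictScalars K ∘ₗ S.τ.toLinearMap) fun t =>
      (![S.f, S.f ∘ₗ LinearMap.mulLeft K S.u, S.f ∘ₗ LinearMap.mulLeft K S.ζ] : Fin 3 → _) t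
  let w : κ → B := fun t => S'.socleVec t
  have hζη : 2 ≤ s → S.ζ * S.η ^ (s - 1) = S.η ^ s := fun h => by
    rw [← S.ζpow_one, S.ζpow_mul_η_pow (by omega) one_ne_zero, show 1 + (s - 1) = s by omega]
  have hζα : S.ζ * S.α = 0 := by
    rw [ζ, add_mul, S.η_mul_α, zero_add, smul_mul_assoc]
    rcases eq_or_ne (k - 1) 0 with h | h
    · rw [h, pow_zero, mul_one, S.αα', zero_smul, add_zero, smul_smul, mul_comm ν, S.μν,
        zero_smul]
    · rw [S.αα_pow_mul h, smul_zero]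
  have hV : ∀ i, v i ∈ secondSocle K A := by
    rintro (_ | ⟨t, h1, h2⟩)
    · refine S.mem_secondSocle ?_ fun z hz => S.nilCentral_mul_α (Or.inl (zero_mul _)) hz
      have h := S.αα_sub_mem
      rwa [zero_smul, sub_zero] at h
    · fin_cases t
      · refine S.mem_secondSocle S.w₀_top_mem_squareKernel fun z hz => ?_
        change z * S.w₀ ^ k ∈ _
        rw [S.nilCentral_mul_top hz]
        exact zero_mem _
      · have h3 : 3 ≤ k := h1 rfl
        exact S.mem_secondSocle (S.w₀_pow_mem_squareKernel (by omega))
          fun z hz => S.nilCentral_mul_w₀_pow (by omega) hz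
      · have h3 : 3 ≤ s := h2 rfl
        exact S.mem_secondSocle (S.η_pow_mem_squareKernel (by omega))
          fun z hz => S.nilCentral_mul_η_pow (by omega) hz
  have hψ : ∀ i, ∀ x ∈ commutatorSpan K A, ψ i x = 0 := by
    rintro (_ | ⟨t, h1, h2⟩) x hx
    · change (S.τ x).snd = 0
      rw [S.τ_comm hx, TrivSqZeroExt.snd_zero]
    · fin_cases t
      · exact S.f_comm_zero hx
      · exact S.f_central_comm S.u_central hx
      · exact S.f_central_comm S.ζ_central hx
  have hd : ∀ i j, ψ i (v j) = if i = j then 1 else 0 := by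
    have htop : S.f (S.w₀ ^ k) = 1 := S.f_top
    rintro (_ | ⟨t, h1, h2⟩) (_ | ⟨t', h1', h2'⟩)
    · change (S.τ S.α).snd = _
      rw [S.τ_α, DualNumber.snd_eps, if_pos rfl]
    · rw [if_neg (by simp)]
      fin_cases t'
      · change (S.τ (S.w₀ ^ k)).snd = 0
        rw [S.τ_w₀_pow (by omega), TrivSqZeroExt.snd_zero]
      · have h3 : 3 ≤ k := h1' rfl
        change (S.τ (S.w₀ ^ (k - 1))).snd = 0
        rw [S.τ_w₀_pow (by omega), TrivSqZeroExt.snd_zero]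
      · have h3 : 3 ≤ s := h2' rfl
        change (S.τ (S.η ^ (s - 1))).snd = 0
        rw [S.τ_η_pow (by omega), TrivSqZeroExt.snd_zero]
    · rw [if_neg (by simp)]
      fin_cases t
      · exact S.f_α
      · change S.f (S.u * S.α) = 0
        rw [← pow_one S.u, S.f_u_pow_mul_α one_ne_zero]
      · change S.f (S.ζ * S.α) = 0
        rw [hζα, map_zero]
    · have e : (some (⟨t, h1, h2⟩ : κ) = some ⟨t', h1', h2'⟩) ↔ t = t' := by simp
      rw [if_congr e rfl rfl]
      have hu : ∀ {i}, i ≠ 0 → S.u * S.w₀ ^ i = S.w₀ ^ (1 + i) := fun {i} hi => by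
        rw [← pow_one S.u, S.u_pow_mul_w₀_pow hi]
      have hζw : ∀ {i}, i ≠ 0 → S.ζ * S.w₀ ^ i = 0 := fun {i} hi =>
        mul_pow_eq_zero S.ζ_mul_w₀ hi
      have huη : ∀ {i}, i ≠ 0 → S.u * S.η ^ i = 0 := fun {i} hi => by
        rw [← pow_one S.u, S.u_pow_mul_η_pow hi one_ne_zero]
      fin_cases t <;> fin_cases t'
      · exact htop
      · have h3 : 3 ≤ k := h1' rfl
        exact S.f_pow _ (by omega) (by omega)
      · have h3 : 3 ≤ s := h2' rfl
        exact S.f_η _ (by omega) (by omega)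
      · change S.f (S.u * S.w₀ ^ k) = 0
        rw [hu (by omega), S.w₀_pow_of_lt (by omega), map_zero]
      · have h3 : 3 ≤ k := h1' rfl
        change S.f (S.u * S.w₀ ^ (k - 1)) = 1
        rw [hu (by omega), show 1 + (k - 1) = k by omega, htop]
      · have h3 : 3 ≤ s := h2' rfl
        change S.f (S.u * S.η ^ (s - 1)) = 0
        rw [huη (by omega), map_zero]
      · change S.f (S.ζ * S.w₀ ^ k) = 0
        rw [hζw (by omega), map_zero]
      · have h3 : 3 ≤ k := h1' rfl
        change S.f (S.ζ * S.w₀ ^ (k - 1)) = 0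
        rw [hζw (by omega), map_zero]
      · have h3 : 3 ≤ s := h2' rfl
        change S.f (S.ζ * S.η ^ (s - 1)) = 1
        rw [hζη (by omega), S.f_η_pow (by omega), if_pos rfl]
  have hw : secondSocle K B ≤ commutatorSpan K B ⊔ Submodule.span K (Set.range w) := by
    intro x hx
    have hτ1 := S'.τ_fst_of_squareKernel hx.1
    have hε := S'.ε₁_of_squareKernel hx.1
    -- With `c = 1` the vanishing of `f (x * x)` bounds the coefficient of `α`: the other terms
    -- involve exponents `k / 2` and `s / 2` that are at least two, where the traces vanish on the
    -- second socle.
    have hτ2 : (S'.τ x).snd = 0 := by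
      have h := S'.f_mul_self (fun h => absurd h hs) x
      rw [S'.f_comm_zero hx.1, one_mul] at h
      have h1 : (if Even k then S'.f (S'.u ^ (k / 2) * x) ^ 2 else 0) = 0 := by
        split_ifs with hev
        · obtain ⟨r, hr⟩ := hev
          rw [S'.f_u_pow_of_secondSocle hx (by omega), zero_pow two_ne_zero]
        · rfl
      have h2 : (if Even s then S'.f (S'.ζpow (s / 2) * x) ^ 2 else 0) = 0 := by
        split_ifs with hev
        · obtain ⟨r, hr⟩ := hev
          rw [S'.f_ζpow_of_secondSocle hx (by omega), zero_pow two_ne_zero]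
        · rfl
      rw [h1, h2, add_zero, add_zero] at h
      exact eq_zero_of_pow_eq_zero h.symm
    have hτ : S'.τ x = 0 := by ext <;> simp [hτ1, hτ2]
    have h0 : S'.w₀ ^ k ∈ Submodule.span K (Set.range w) :=
      Submodule.subset_span ⟨⟨0, by simp, by simp⟩, rfl⟩
    have h1 := S'.sub_powerPart_mem hτ hε
    have h2 : S'.powerPart x ∈ Submodule.span K (Set.range w) := by
      refine S'.powerPart_of_secondSocle hx (fun h => ?_) (fun h => ?_)
      · refine Submodule.smul_mem _ _ (Submodule.subset_span ⟨⟨1, fun _ => by omega, ?_⟩, rfl⟩)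
        simp
      · refine Submodule.smul_mem _ _ (Submodule.subset_span ⟨⟨2, ?_, fun _ => by omega⟩, rfl⟩)
        simp
    have h3 : commutatorSpan K B ⊔ Submodule.span K {S'.w₀ ^ k} ≤
        commutatorSpan K B ⊔ Submodule.span K (Set.range w) :=
      sup_le_sup_left (Submodule.span_le.2 (by simpa using h0)) _
    have h4 := add_mem (h3 h1) (Submodule.mem_sup_right h2)
    rwa [sub_add_cancel] at h4
  have h := StableTransfer.card_le_card T (U := secondSocle K A) (fun x hx => hx.1)
    (fun x hx => StableTransfer.map_mem_secondSocle T hx) v hV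
    (coeff_eq_zero_of_dual v ψ hψ hd) w hw
  rw [Fintype.card_option] at h
  omega

end SDModel

end ModelInvariant

set_option linter.unusedSectionVars false

/-! ### The case `k = 2` or `s = 2`: differentials. -/

section ModelDifferentials

/-- A derivation and a trace form give a functional on differentials. -/
theorem exists_pairing {K A : Type u} [Field K] [Ring A] [Algebra K A] (f : A →ₗ[K] K)
    (hf : ∀ x y, f (x * y) = f (y * x)) (D : A →ₗ[K] A)
    (hD : ∀ x y, D (x * y) = D x * y + x * D y) :
    ∃ g : CyclicDiff K A →ₗ[K] K, ∀ a b, g (cdiff K a b) = f (a * D b) := by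
  let F : A ⊗[K] A →ₗ[K] K := TensorProduct.lift ((LinearMap.mul K A).compr₂ f |>.compl₂ D)
  have hF : ∀ a b, F (a ⊗ₜ b) = f (a * D b) := fun a b => rfl
  refine ⟨(boundarySpan K A).liftQ F (Submodule.span_le.2 ?_), fun a b => rfl⟩
  rintro _ ⟨a, b, c, rfl⟩
  simp only [SetLike.mem_coe, LinearMap.mem_ker, map_add, map_sub, hF, hD, mul_add]
  rw [mul_assoc c a, hf c, mul_assoc a (D b), mul_assoc a b]
  ring

namespace SDModel

section Expansion

variable {K A : Type u} [Field K] [CharP K 2] [Ring A] [Algebra K A] {k s : ℕ}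
  (S : SDModel K A k s 0 1 0)

/-- The differential `x dα`, restricted to the corner at the first vertex. -/
noncomputable def cornerDiff : A →ₗ[K] CyclicDiff K A :=
  (cdiff K).flip S.α ∘ₗ LinearMap.mulLeft K S.e0 ∘ₗ LinearMap.mulRight K S.e0

theorem cornerDiff_apply (x : A) : S.cornerDiff x = cdiff K (S.e0 * (x * S.e0)) S.α := rfl

theorem αα_eq : S.α * S.α = S.β * (S.γ * S.w₀ ^ (k - 1)) := by
  rw [S.αα', one_smul, zero_smul, add_zero, mul_assoc]

theorem γ_mul_w₀_pow_of_le {i : ℕ} (hi : k ≤ i) : S.γ * S.w₀ ^ i = 0 := by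
  obtain ⟨j, rfl⟩ := Nat.exists_eq_add_of_le hi
  rw [pow_add, ← mul_assoc, S.γ_mul_w₀_pow, zero_mul]

/-- Evaluate `w₀ ^ i d(α²)` twice. By Leibniz it is `w₀ ^ i α dα`, as `α * w₀ = 0`. By `α² = β (γ w₀
^ (k - 1))` it is zero, since `w₀ β = 0` and `γ w₀ ^ k = 0`. -/
theorem cdiff_αw₁_pow {i : ℕ} (hi : i ≠ 0) : cdiff K (S.α * S.w₁ ^ i) S.α = 0 := by
  have h := cdiff_mul (K := K) (S.w₀ ^ i) S.α S.α
  rw [mul_pow_eq_zero S.α_mul_w₀ hi, map_zero, LinearMap.zero_apply, add_zero, S.αα_eq, cdiff_mul,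
    pow_mul_eq_zero S.w₀_mul_β hi, map_zero, LinearMap.zero_apply, zero_add, mul_assoc S.γ,
    ← pow_add, S.γ_mul_w₀_pow_of_le (by omega), map_zero, LinearMap.zero_apply] at h
  rw [← S.w₀_pow_α, ← h]

/-- Here `βγ w₀ ^ j d(α²)` is the sum of the two differentials by Leibniz, and it is zero by the
formula for `α²`. -/
theorem cdiff_w₁_pow {i : ℕ} (hi : i ≠ 0) : cdiff K (S.w₁ ^ i) S.α = cdiff K (S.w₀ ^ i) S.α := by
  obtain ⟨j, rfl⟩ := Nat.exists_eq_succ_of_ne_zero hi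
  have h := cdiff_mul (K := K) (S.β * S.γ * S.w₀ ^ j) S.α S.α
  have h1 : S.β * S.γ * S.w₀ ^ j * S.α = S.w₁ ^ (j + 1) := by
    rw [mul_assoc, S.w₀_pow_α, ← mul_assoc, pow_succ']; rfl
  have h2 : S.α * (S.β * S.γ * S.w₀ ^ j) = S.w₀ ^ (j + 1) := by
    rw [pow_succ', w₀]; simp only [mul_assoc]
  have h3 : S.β * S.γ * S.w₀ ^ j * S.β = 0 := by
    rcases eq_or_ne j 0 with rfl | hj
    · rw [pow_zero, mul_one, S.βγβ]
    · rw [mul_assoc, pow_mul_eq_zero S.w₀_mul_β hj, mul_zero]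
  have h4 : S.γ * S.w₀ ^ (k - 1) * (S.β * S.γ * S.w₀ ^ j) = 0 := by
    rw [← S.w₂_pow_γ]
    simp only [mul_assoc]
    rw [← mul_assoc S.β, ← mul_assoc S.γ, ← mul_assoc S.γ, S.γβγ, zero_mul, mul_zero]
  rw [h1, h2, S.αα_eq, cdiff_mul, h3, h4, map_zero, LinearMap.zero_apply, LinearMap.zero_apply,
    add_zero] at h
  rw [← sub_eq_zero, sub_eq_add_of_charTwo K, h]

/-- In characteristic two `d(α³) = 3 α² dα = α² dα`, and `α³ = w₀ ^ k`. -/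
theorem cdiff_αα (h : cdiff K 1 (S.w₀ ^ k) = 0) :
    cdiff K (S.β * S.γ * S.w₀ ^ (k - 1)) S.α = 0 := by
  have e : S.α * (S.α * S.α) = S.w₀ ^ k := by
    have := S.k_pos
    obtain ⟨j, hj⟩ : ∃ j, k - 1 = j ∧ k = j + 1 := ⟨k - 1, rfl, by omega⟩
    have e : S.w₀ ^ k = S.w₀ * S.w₀ ^ j := by rw [← pow_succ', ← hj.2]
    rw [S.αα_eq, hj.1, e, w₀]; simp only [mul_assoc]
  rw [← e, cdiff_mul, one_mul, mul_one, cdiff_mul, add_self_eq_zero_of_charTwo K, zero_add] at h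
  rwa [mul_assoc, ← S.αα_eq]

/-- The expansion of `cornerDiff` in terms of dual elements. -/
noncomputable def cornerExpansion : A →ₗ[K] CyclicDiff K A :=
  ((TrivSqZeroExt.fstHom K K K).toLinearMap ∘ₗ S.τ.toLinearMap).smulRight (S.cornerDiff S.e0) +
  (S.f ∘ₗ LinearMap.mulRight K (S.β * S.γ * S.w₀ ^ (k - 1))).smulRight (S.cornerDiff S.α) +
  ∑ i ∈ Finset.Ico 1 k, (S.f ∘ₗ LinearMap.mulRight K (S.w₀ ^ (k - i) + S.w₁ ^ (k - i))).smulRight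
    (S.cornerDiff (S.w₀ ^ i)) +
  ∑ i ∈ Finset.Ico 0 (k - 1), (S.f ∘ₗ LinearMap.mulRight K (S.α * S.w₁ ^ (k - 1 - i))).smulRight
    (S.cornerDiff (S.β * S.γ * S.w₀ ^ i))

/-- The coefficients come from elements dual under `f` to `e0`, `α`, the powers of `w₀` and `w₁`,
and `βγ w₀ ^ i`. Powers of `w₀` and `w₁` share a coefficient since their differentials agree, and `α
w₁ ^ i` for `i ≥ 1` and `βγ w₀ ^ (k - 1)` are left out, their differentials being zero. -/
theorem cornerExpansion_apply (x : A) : S.cornerExpansion x =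
    (S.τ x).fst • S.cornerDiff S.e0 +
    S.f (x * (S.β * S.γ * S.w₀ ^ (k - 1))) • S.cornerDiff S.α +
    ∑ i ∈ Finset.Ico 1 k, S.f (x * (S.w₀ ^ (k - i) + S.w₁ ^ (k - i))) • S.cornerDiff (S.w₀ ^ i) +
    ∑ i ∈ Finset.Ico 0 (k - 1), S.f (x * (S.α * S.w₁ ^ (k - 1 - i))) •
      S.cornerDiff (S.β * S.γ * S.w₀ ^ i) := by
  simp [cornerExpansion, mul_assoc]

/-- Apart from the vertex coefficient, each coefficient pairs `z` with a commutator. For the powers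
this is so because `w₀ ^ j + w₁ ^ j` is a commutator in characteristic two. -/
theorem cornerExpansion_nilCentral (hk : 2 ≤ k) {z : A} (hz : z ∈ nilCentral K A) :
    S.cornerExpansion z = 0 := by
  rw [cornerExpansion_apply, S.τ_fst_of_nilCentral hz,
    S.f_central_comm hz.1 (S.βγ_w₀_pow_mem (by omega)), zero_smul, zero_smul, Finset.sum_eq_zero,
    Finset.sum_eq_zero]
  · simp
  · intro i hi
    have := Finset.mem_Ico.1 hi
    rw [S.f_central_comm hz.1 (S.αw₁_pow_mem (by omega)), zero_smul]
  · intro i hi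
    have := Finset.mem_Ico.1 hi
    have h := S.w₁_pow_sub_mem (i := k - i) (by omega)
    rw [sub_eq_add_of_charTwo K, add_comm] at h
    rw [S.f_central_comm hz.1 h, zero_smul]

theorem cornerDiff_eq {x : A} (h1 : S.e0 * x = x) (h2 : x * S.e0 = x) :
    S.cornerDiff x = cdiff K x S.α := by
  rw [cornerDiff_apply, h2, h1]

theorem corner_zero {x : A} (h : S.e0 * x = 0 ∨ x * S.e0 = 0) :
    S.cornerDiff x = 0 ∧ S.cornerExpansion x = 0 := by
  have h0 : S.e0 * (x * S.e0) = 0 := by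
    rcases h with h | h
    · rw [← mul_assoc, h, zero_mul]
    · rw [h, mul_zero]
  have hτ : S.τ x = 0 := by
    rcases h with h | h <;> simpa [S.τ_e0] using congrArg S.τ h
  have hf : ∀ {y}, S.e0 * y = y → y * S.e0 = y → S.f (x * y) = 0 := fun {y} h1 h2 => by
    rcases h with h | h
    · rw [S.f_comm, ← h2, mul_assoc, h, mul_zero, map_zero]
    · rw [← h1, ← mul_assoc, h, zero_mul, map_zero]
  refine ⟨by rw [cornerDiff_apply, h0, map_zero, LinearMap.zero_apply], ?_⟩
  have hw₁ : ∀ i, S.α * S.w₁ ^ i * S.e0 = S.α * S.w₁ ^ i := fun i => by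
    rw [← S.w₀_pow_α, mul_assoc, S.α_e0]
  have hw₀ : ∀ i, S.β * S.γ * S.w₀ ^ i * S.e0 = S.β * S.γ * S.w₀ ^ i := fun i => by
    rw [← S.w₁_pow_mul_βγ, mul_assoc, mul_assoc S.β, S.γ_e0]
  rw [cornerExpansion_apply, hτ, hf (by simp only [← mul_assoc, S.e0_β]) (hw₀ _),
    Finset.sum_eq_zero, Finset.sum_eq_zero]
  · simp
  · intro i _
    rw [hf (by simp only [← mul_assoc, S.e0_α]) (hw₁ _), zero_smul]
  · intro i hi
    have := Finset.mem_Ico.1 hi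
    rw [hf, zero_smul]
    · rw [mul_add, mul_pow_eq_self S.e0_mul_w₀ (by omega), mul_pow_eq_self S.e0_mul_w₁ (by omega)]
    · rw [add_mul, pow_mul_eq_self S.w₀_mul_e0 (by omega), pow_mul_eq_self S.w₁_mul_e0 (by omega)]

theorem cornerExpansion_e0 (hk : 2 ≤ k) : S.cornerExpansion S.e0 = S.cornerDiff S.e0 := by
  rw [cornerExpansion_apply, S.τ_e0, TrivSqZeroExt.fst_one, one_smul, ← mul_assoc, ← mul_assoc,
    S.e0_β, S.f_comm_zero (S.βγ_w₀_pow_mem (by omega)), Finset.sum_eq_zero, Finset.sum_eq_zero]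
  · simp
  · intro i hi
    have := Finset.mem_Ico.1 hi
    rw [← mul_assoc, S.e0_α, S.f_comm_zero (S.αw₁_pow_mem (by omega)), zero_smul]
  · intro i hi
    have := Finset.mem_Ico.1 hi
    rw [mul_add, mul_pow_eq_self S.e0_mul_w₀ (by omega), mul_pow_eq_self S.e0_mul_w₁ (by omega),
      map_add, S.f_w₀_pow (by omega), S.f_w₁_pow (by omega), if_neg (by omega), add_zero,
      zero_smul]

theorem sum_Ico_ite {i : ℕ} (hi : i ≠ 0) (g : ℕ → CyclicDiff K A) :
    ∑ j ∈ Finset.Ico 1 k, (if i + (k - j) = k then (1 : K) else 0) • g j =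
      if i < k then g i else 0 := by
  have h : ∀ j ∈ Finset.Ico 1 k, (if i + (k - j) = k then (1 : K) else 0) • g j =
      if i = j then g j else 0 := fun j hj => by
    have := Finset.mem_Ico.1 hj
    rw [ite_smul, one_smul, zero_smul]
    exact if_congr (by omega) rfl rfl
  rw [Finset.sum_congr rfl h, Finset.sum_ite_eq]
  exact if_congr (by rw [Finset.mem_Ico]; omega) rfl rfl

theorem cornerExpansion_w₀_pow {i : ℕ} (hi : i ≠ 0) : S.cornerExpansion (S.w₀ ^ i) =
    if i < k then S.cornerDiff (S.w₀ ^ i) else 0 := by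
  have h1 : ∀ j ∈ Finset.Ico 1 k, S.f (S.w₀ ^ i * (S.w₀ ^ (k - j) + S.w₁ ^ (k - j))) =
      if i + (k - j) = k then 1 else 0 := fun j hj => by
    have := Finset.mem_Ico.1 hj
    rw [mul_add, mul_pow_eq_zero (pow_mul_eq_zero S.w₀_mul_w₁ hi) (by omega), add_zero, ← pow_add,
      S.f_w₀_pow (by omega)]
  rw [cornerExpansion_apply, S.τ_w₀_pow hi, TrivSqZeroExt.fst_zero, zero_smul, zero_add,
    mul_assoc S.β, ← mul_assoc, pow_mul_eq_zero S.w₀_mul_β hi, zero_mul, map_zero, zero_smul,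
    zero_add, Finset.sum_congr rfl fun j hj => by rw [h1 j hj], sum_Ico_ite hi,
    Finset.sum_eq_zero, add_zero]
  intro j hj
  rw [← mul_assoc, S.w₀_pow_α, mul_assoc, ← pow_add, S.f_comm_zero (S.αw₁_pow_mem (by omega)),
    zero_smul]

theorem cornerExpansion_w₁_pow {i : ℕ} (hi : i ≠ 0) : S.cornerExpansion (S.w₁ ^ i) =
    if i < k then S.cornerDiff (S.w₀ ^ i) else 0 := by
  have hk := S.k_pos
  have h1 : ∀ j ∈ Finset.Ico 1 k, S.f (S.w₁ ^ i * (S.w₀ ^ (k - j) + S.w₁ ^ (k - j))) =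
      if i + (k - j) = k then 1 else 0 := fun j hj => by
    have := Finset.mem_Ico.1 hj
    rw [mul_add, mul_pow_eq_zero (pow_mul_eq_zero S.w₁_mul_w₀ hi) (by omega), zero_add, ← pow_add,
      S.f_w₁_pow (by omega)]
  have hτ : S.τ (S.w₁ ^ i) = 0 := by
    rw [map_pow, w₁, map_mul, map_mul, S.τ_β, zero_mul, zero_mul, zero_pow hi]
  rw [cornerExpansion_apply, hτ, TrivSqZeroExt.fst_zero, zero_smul, zero_add, ← mul_assoc,
    S.w₁_pow_mul_βγ, mul_assoc, ← pow_add, S.f_comm_zero (S.βγ_w₀_pow_mem (by omega)), zero_smul,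
    zero_add, Finset.sum_congr rfl fun j hj => by rw [h1 j hj], sum_Ico_ite hi,
    Finset.sum_eq_zero, add_zero]
  intro j hj
  rw [← mul_assoc, pow_mul_eq_zero S.w₁_mul_α hi, zero_mul, map_zero, zero_smul]

theorem cornerExpansion_αw₁_pow (hk : 2 ≤ k) (i : ℕ) : S.cornerExpansion (S.α * S.w₁ ^ i) =
    if i = 0 then S.cornerDiff S.α else 0 := by
  have hτ : (S.τ (S.α * S.w₁ ^ i)).fst = 0 := by
    rw [map_mul, TrivSqZeroExt.fst_mul, S.τ_α, DualNumber.fst_eps, zero_mul]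
  have h0 : S.α * S.w₁ ^ i * (S.β * S.γ * S.w₀ ^ (k - 1)) = S.w₀ ^ (i + k) := by
    rw [← mul_assoc, S.αw₁_pow_mul_βγ, ← pow_add]; congr 1; omega
  rw [cornerExpansion_apply, hτ, zero_smul, zero_add, h0, S.f_w₀_pow (by omega),
    Finset.sum_eq_zero, Finset.sum_eq_zero, add_zero, add_zero, ite_smul, one_smul, zero_smul]
  · exact if_congr (by omega) rfl rfl
  · intro j hj
    have := Finset.mem_Ico.1 hj
    rw [← S.w₀_pow_α i, mul_assoc, S.αα_mul_pow (by omega), mul_zero, map_zero, zero_smul]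
  · intro j hj
    have := Finset.mem_Ico.1 hj
    rw [mul_add, mul_assoc S.α, mul_assoc S.α, ← pow_add, ← mul_assoc, ← S.w₀_pow_α, mul_assoc,
      mul_pow_eq_zero S.α_mul_w₀ (by omega), mul_zero, zero_add,
      S.f_comm_zero (S.αw₁_pow_mem (by omega)), zero_smul]

theorem cornerExpansion_βγ_w₀_pow (hk : 2 ≤ k) (i : ℕ) :
    S.cornerExpansion (S.β * S.γ * S.w₀ ^ i) =
      if i < k - 1 then S.cornerDiff (S.β * S.γ * S.w₀ ^ i) else 0 := by
  have hτ : (S.τ (S.β * S.γ * S.w₀ ^ i)).fst = 0 := by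
    rw [map_mul, map_mul, S.τ_β, zero_mul, zero_mul, TrivSqZeroExt.fst_zero]
  have h0 : S.β * S.γ * S.w₀ ^ i * (S.β * S.γ * S.w₀ ^ (k - 1)) = 0 := by
    rw [← S.w₁_pow_mul_βγ]
    simp only [mul_assoc]
    rw [← mul_assoc S.γ S.β, ← mul_assoc (S.γ * S.β), S.γβγ, zero_mul, mul_zero, mul_zero]
  have h1 : ∀ j ∈ Finset.Ico 0 (k - 1), S.f (S.β * S.γ * S.w₀ ^ i * (S.α * S.w₁ ^ (k - 1 - j))) •
      S.cornerDiff (S.β * S.γ * S.w₀ ^ j) =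
      if i = j then S.cornerDiff (S.β * S.γ * S.w₀ ^ j) else 0 := fun j hj => by
    have := Finset.mem_Ico.1 hj
    have e : S.β * S.γ * S.w₀ ^ i * (S.α * S.w₁ ^ (k - 1 - j)) = S.w₁ ^ (i + (k - 1 - j) + 1) := by
      rw [← mul_assoc, mul_assoc (S.β * S.γ), S.w₀_pow_α, ← mul_assoc, mul_assoc, ← pow_add,
        pow_succ']
      rfl
    rw [e, S.f_w₁_pow (by omega), ite_smul, one_smul, zero_smul]
    exact if_congr (by omega) rfl rfl
  rw [cornerExpansion_apply, hτ, zero_smul, zero_add, h0, map_zero, zero_smul, zero_add,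
    Finset.sum_congr rfl h1, Finset.sum_ite_eq, Finset.sum_eq_zero, zero_add]
  · exact if_congr (by rw [Finset.mem_Ico]; omega) rfl rfl
  · intro j hj
    have := Finset.mem_Ico.1 hj
    have h2 : S.β * S.γ * S.w₀ ^ i * S.w₁ ^ (k - j) = 0 := by
      rw [← S.w₁_pow_mul_βγ, mul_assoc, mul_assoc, mul_pow_eq_zero S.γ_mul_w₁ (by omega), mul_zero,
        mul_zero]
    rw [mul_add, h2, add_zero, mul_assoc (S.β * S.γ), ← pow_add,
      S.f_comm_zero (S.βγ_w₀_pow_mem (by omega)), zero_smul]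

/-- Checking the path basis, the only corner path neither covered by the expansion nor of zero
differential is `w₀ ^ k`. -/
theorem cornerDiff_sub_mem (hk : 2 ≤ k) (h : cdiff K 1 (S.w₀ ^ k) = 0) (x : A) :
    S.cornerDiff x - S.cornerExpansion x ∈ Submodule.span K {cdiff K (S.w₀ ^ k) S.α} := by
  have hx : x ∈ S.pathSpan := by rw [S.pathSpan_eq_top]; trivial
  have hw : ∀ {i}, i ≠ 0 → S.cornerDiff (S.w₀ ^ i) - (if i < k then S.cornerDiff (S.w₀ ^ i) else 0)
      ∈ Submodule.span K {cdiff K (S.w₀ ^ k) S.α} := fun {i} hi => by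
    rcases lt_trichotomy i k with h1 | rfl | h1
    · rw [if_pos h1, sub_self]; exact zero_mem _
    · rw [if_neg (lt_irrefl _), sub_zero, S.cornerDiff_eq (mul_pow_eq_self S.e0_mul_w₀ hi)
        (pow_mul_eq_self S.w₀_mul_e0 hi)]
      exact Submodule.mem_span_singleton_self _
    · rw [if_neg (by omega), S.w₀_pow_of_lt h1, map_zero, sub_zero]; exact zero_mem _
  have hz : ∀ {x}, (S.e0 * x = 0 ∨ x * S.e0 = 0) → S.cornerDiff x - S.cornerExpansion x ∈
      Submodule.span K {cdiff K (S.w₀ ^ k) S.α} := fun {x} hx => by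
    rw [(S.corner_zero hx).1, (S.corner_zero hx).2, sub_zero]; exact zero_mem _
  induction hx using Submodule.span_induction with
  | zero => simp
  | add x y _ _ hx hy =>
    rw [map_add, map_add, add_sub_add_comm]; exact add_mem hx hy
  | smul r x _ hx => rw [map_smul, map_smul, ← smul_sub]; exact Submodule.smul_mem _ _ hx
  | mem x hx =>
    obtain ⟨i, hx⟩ := hx
    rcases hx with rfl | rfl | rfl | rfl | rfl | rfl | rfl | rfl | rfl | rfl
    · rcases i with _ | i
      · rw [pow_zero, mul_one, S.cornerExpansion_e0 hk, sub_self]; exact zero_mem _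
      · rw [mul_pow_eq_self S.e0_mul_w₀ i.succ_ne_zero, S.cornerExpansion_w₀_pow i.succ_ne_zero]
        exact hw i.succ_ne_zero
    · rw [S.cornerExpansion_αw₁_pow hk]
      rcases eq_or_ne i 0 with rfl | hi
      · rw [pow_zero, mul_one, if_pos rfl, sub_self]; exact zero_mem _
      · rw [if_neg hi, S.cornerDiff_eq, S.cdiff_αw₁_pow hi, sub_zero]
        · exact zero_mem _
        · rw [← mul_assoc, S.e0_α]
        · rw [mul_assoc, pow_mul_eq_self S.w₁_mul_e0 hi]
    · refine hz (Or.inr ?_)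
      rw [mul_assoc S.α, ← S.w₁_pow_β, mul_assoc, mul_assoc, S.β_mul_e0, mul_zero, mul_zero]
    · refine hz (Or.inr ?_)
      rw [← S.w₁_pow_β, mul_assoc, S.β_mul_e0, mul_zero]
    · rw [S.cornerExpansion_βγ_w₀_pow hk]
      split_ifs with hi
      · rw [sub_self]; exact zero_mem _
      · rw [S.cornerDiff_eq, sub_zero]
        · rcases eq_or_ne i (k - 1) with rfl | h1
          · rw [S.cdiff_αα h]; exact zero_mem _
          · rw [mul_assoc, S.γ_mul_w₀_pow_of_le (by omega), mul_zero, map_zero,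
              LinearMap.zero_apply]
            exact zero_mem _
        · simp only [← mul_assoc, S.e0_β]
        · rw [mul_assoc, pow_mul_eq_self S.w₀_mul_e0 (by omega)]
    · have e : S.β * S.γ * S.α * S.w₁ ^ i = S.w₁ ^ (i + 1) := by rw [pow_succ']; rfl
      have hi := i.succ_ne_zero
      have e2 : S.cornerDiff (S.w₁ ^ (i + 1)) = S.cornerDiff (S.w₀ ^ (i + 1)) := by
        rw [S.cornerDiff_eq (mul_pow_eq_self S.e0_mul_w₀ hi) (pow_mul_eq_self S.w₀_mul_e0 hi),
          S.cornerDiff_eq (mul_pow_eq_self S.e0_mul_w₁ hi) (pow_mul_eq_self S.w₁_mul_e0 hi),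
          S.cdiff_w₁_pow hi]
      rw [e, S.cornerExpansion_w₁_pow hi, e2]
      exact hw hi
    · refine hz (Or.inl ?_); rw [← mul_assoc, S.e0_mul_γ, zero_mul]
    · refine hz (Or.inl ?_); simp only [← mul_assoc, S.e0_mul_γ, zero_mul]
    · refine hz (Or.inl ?_); simp only [← mul_assoc, S.e0_mul_γ, zero_mul]
    · refine hz (Or.inl ?_); rw [← mul_assoc, S.e0_e1, zero_mul]

/-- This puts all `z dα` on a single line for `c = 0`. Only the corner of `z` at `e0` contributes,
and its expansion vanishes. -/
theorem cdiff_nilCentral_α (hk : 2 ≤ k) (h : cdiff K 1 (S.w₀ ^ k) = 0) {z : A}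
    (hz : z ∈ nilCentral K A) : ∃ r : K, cdiff K z S.α = r • cdiff K (S.w₀ ^ k) S.α := by
  have h1 := S.cornerDiff_sub_mem hk h z
  rw [S.cornerExpansion_nilCentral hk hz, sub_zero, cornerDiff_apply] at h1
  have h2 : cdiff K z S.α = cdiff K (S.e0 * (z * S.e0)) S.α := by
    have e1 : z = S.e0 * (z * S.e0) + z * S.e1 := by
      rw [hz.1 S.e0, ← mul_assoc, S.e0_e0, ← hz.1, ← mul_add, S.e0_add_e1, mul_one]
    have e2 : cdiff K (z * S.e1) S.α = 0 := by
      rw [← S.α_e0, cdiff_mul, mul_assoc, S.e1_mul_α, mul_zero, map_zero, LinearMap.zero_apply,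
        ← mul_assoc, ← hz.1, mul_assoc, S.e0_e1, mul_zero, map_zero, LinearMap.zero_apply,
        add_zero]
    nth_rewrite 1 [e1]
    rw [map_add, LinearMap.add_apply, e2, add_zero]
  obtain ⟨r, hr⟩ := Submodule.mem_span_singleton.1 h1
  exact ⟨r, h2.trans hr.symm⟩

end Expansion

theorem cdiff_sub_mem {K A : Type u} [Field K] [Ring A] [Algebra K A] {z : A}
    (hz : ∀ a, z * a = a * z) {x y : A} (h : x - y ∈ commutatorSpan K A) :
    cdiff K z x = cdiff K z y := by
  rw [← sub_eq_zero, ← map_sub, cdiff_central_commutatorSpan hz h]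

/-- Modulo commutators `w₀ ^ k` is `w₂ ^ k = η ^ s`, which is a square when `k = 2` or `s = 2`. -/
theorem cdiff_w₀_top {K A : Type u} [Field K] [CharP K 2] [Ring A] [Algebra K A] {k s : ℕ}
    {c μ ν : K} (S : SDModel K A k s c μ ν) (h : k = 2 ∨ s = 2) {z : A}
    (hz : ∀ a, z * a = a * z) : cdiff K z (S.w₀ ^ k) = 0 := by
  have hk := S.k_pos
  rw [← cdiff_sub_mem hz (S.w₂_pow_sub_mem (i := k) (by omega))]
  rcases h with rfl | rfl
  · rw [pow_two, cdiff_central_mul_self hz]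
  · rw [← S.η_pow_s, pow_two, cdiff_central_mul_self hz]

theorem cdiff_pow_even {K A : Type u} [Field K] [CharP K 2] [Ring A] [Algebra K A] {z : A}
    (hz : ∀ a, z * a = a * z) (x : A) {n : ℕ} (hn : Even n) : cdiff K z (x ^ n) = 0 := by
  obtain ⟨r, rfl⟩ := hn
  rw [pow_add, cdiff_central_mul_self hz]

/-- Up to a multiple of `α`, an element of the second socle is a combination of commutators, `w₀ ^
k`, `w₀ ^ (k - 1)` and `η ^ (s - 1)`. The odd parameter makes its power even, hence a square with
zero differential. For the parameter equal to two, the remaining coefficient vanishes because `f (x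
* x) = 0`. Only `z dα` remains. -/
theorem exists_cdiff_secondSocle {K A : Type u} [Field K] [CharP K 2] [Ring A] [Algebra K A]
    {k s : ℕ} (S : SDModel K A k s 0 1 0)
    (hks : (k = 2 ∧ 3 ≤ s ∧ Odd s) ∨ (s = 2 ∧ 3 ≤ k ∧ Odd k)) (y : A)
    (hy : y ∈ secondSocle K A) : ∃ L : CyclicDiff K A, ∀ z ∈ nilCentral K A,
      ∃ r : K, cdiff K z y = r • L := by
  have hk2 : 2 ≤ k := by omega
  have h1 : cdiff K (1 : A) (S.w₀ ^ k) = 0 :=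
    S.cdiff_w₀_top (by omega) fun a => by rw [one_mul, mul_one]
  have hα : S.α ∈ secondSocle K A := by
    refine S.mem_secondSocle ?_ fun z hz => S.nilCentral_mul_α (Or.inl (zero_mul _)) hz
    have h := S.αα_sub_mem
    rwa [zero_smul, sub_zero] at h
  refine ⟨cdiff K (S.w₀ ^ k) S.α, fun z hz => ?_⟩
  obtain ⟨r, hr⟩ := S.cdiff_nilCentral_α hk2 h1 hz
  let x := y - (S.τ y).snd • S.α
  have hx : x ∈ secondSocle K A := sub_mem hy (Submodule.smul_mem _ _ hα)
  have hτ : S.τ x = 0 := by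
    have := S.τ_fst_of_squareKernel hy.1
    ext <;> simp [x, S.τ_α, this]
  have hsq := S.f_mul_self (fun _ => rfl) x
  rw [S.f_comm_zero hx.1, zero_mul, zero_add] at hsq
  have hp : cdiff K z (S.powerPart x) = 0 := by
    suffices S.powerPart x ∈ LinearMap.ker (cdiff K z) from this
    refine S.powerPart_of_secondSocle hx (fun _ => ?_) (fun _ => ?_)
    · rcases hks with ⟨hk, _, hs⟩ | ⟨hs, _, hk⟩
      · subst hk
        rw [if_pos even_two, if_neg (Nat.not_even_iff_odd.2 hs), add_zero, Nat.div_self two_pos,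
          pow_one] at hsq
        rw [eq_zero_of_pow_eq_zero hsq.symm, zero_smul]
        exact zero_mem _
      · refine Submodule.smul_mem _ _ (cdiff_pow_even hz.1 _ ?_)
        obtain ⟨m, rfl⟩ := hk
        exact ⟨m, by omega⟩
    · rcases hks with ⟨hk, _, hs⟩ | ⟨hs, _, hk⟩
      · refine Submodule.smul_mem _ _ (cdiff_pow_even hz.1 _ ?_)
        obtain ⟨m, rfl⟩ := hs
        exact ⟨m, by omega⟩
      · subst hs
        rw [if_pos even_two, if_neg (Nat.not_even_iff_odd.2 hk), zero_add, Nat.div_self two_pos,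
          S.ζpow_one] at hsq
        rw [eq_zero_of_pow_eq_zero hsq.symm, zero_smul]
        exact zero_mem _
  obtain ⟨a, ha, b, hb, hab⟩ :=
    Submodule.mem_sup.1 (S.sub_powerPart_mem hτ (S.ε₁_of_squareKernel hx.1))
  obtain ⟨q, rfl⟩ := Submodule.mem_span_singleton.1 hb
  have e : y = (S.τ y).snd • S.α + (a + q • S.w₀ ^ k + S.powerPart x) := by
    rw [hab, sub_add_cancel]; exact (add_sub_cancel _ _).symm
  refine ⟨(S.τ y).snd * r, ?_⟩
  rw [e, map_add, map_add, map_add, map_smul, map_smul, hr, hp,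
    cdiff_central_commutatorSpan hz.1 ha, S.cdiff_w₀_top (by omega) hz.1, smul_zero, add_zero,
    add_zero, add_zero, ← e, smul_smul]

/-- For `c = 1` take `x = α + w₀` or `x = α + η`; its square is a commutator, as the two copies of
`w₀ ^ k` cancel. The derivations `D` and `D'` show that `w₀ ^ k dx` and `z dx` are independent,
against the collinearity that holds for `c = 0`. -/
theorem isEmpty_transfer_of_derivations {K A B : Type u} [Field K] [CharP K 2] [Ring A]
    [Algebra K A] [Ring B] [Algebra K B] {k s : ℕ} (S : SDModel K A k s 0 1 0)
    (S' : SDModel K B k s 1 1 0)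
    (hks : (k = 2 ∧ 3 ≤ s ∧ Odd s) ∨ (s = 2 ∧ 3 ≤ k ∧ Odd k))
    (D : B →ₗ[K] B) (hD : ∀ x y, D (x * y) = D x * y + x * D y) (hα : D S'.α = S'.α + S'.e0)
    (hβ : D S'.β = S'.β) (hγ : D S'.γ = 0) (hη : D S'.η = 0)
    (D' : B →ₗ[K] B) (hD' : ∀ x y, D' (x * y) = D' x * y + x * D' y) (hα' : D' S'.α = 0)
    (hγ' : D' S'.γ = 0) (hβ' : k = 2 → D' S'.β = S'.β) (hη' : s = 2 → D' S'.η = S'.η) :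
    IsEmpty (StableTransfer K B A) := by
  refine ⟨fun T => ?_⟩
  obtain ⟨g, hg⟩ := exists_pairing S'.f S'.f_comm D hD
  obtain ⟨g', hg'⟩ := exists_pairing S'.f S'.f_comm D' hD'
  have hk0 : k ≠ 0 := by omega
  -- The pairings form a triangular matrix: `D'` gives `0` and `1` on `w₀ ^ k dx` and `z dx`, while
  -- `D` gives `1` on the former.
  suffices h : ∃ x ∈ secondSocle K B, ∃ z ∈ nilCentral K B, (S'.τ (D x)).fst = 1 ∧
      (S'.τ (D' x)).fst = 0 ∧ S'.f (z * D' x) = 1 by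
    obtain ⟨x, hx, z, hz, h1, h2, h3⟩ := h
    obtain ⟨r₁, r₂, hr, h4⟩ := StableTransfer.exists_dependent T hx S'.w₀_top_mem_nilCentral hz
      (S.exists_cdiff_secondSocle hks)
    have h5 := congrArg g' h4
    rw [map_add, map_smul, map_smul, hg', hg', S'.f_top_mul, h2, h3, map_zero, smul_zero, zero_add,
      smul_eq_mul, mul_one] at h5
    have h6 := congrArg g h4
    rw [map_add, map_smul, map_smul, hg, hg, S'.f_top_mul, h1, h5, map_zero, zero_smul, add_zero,
      smul_eq_mul, mul_one] at h6
    rcases hr with hr | hr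
    exacts [hr h6, hr h5]
  have hαα : S'.α * S'.α - S'.w₀ ^ k ∈ commutatorSpan K B := by
    have := S'.αα_sub_mem
    rwa [one_smul] at this
  have hτ1 : (S'.τ (S'.α + S'.e0)).fst = 1 := by simp [S'.τ_α, S'.τ_e0]
  rcases hks with ⟨rfl, hs, -⟩ | ⟨rfl, hk, -⟩
  · have hDw : D S'.w₀ = (S'.α + S'.e0) * S'.β * S'.γ + S'.α * S'.β * S'.γ := by
      rw [w₀, hD, hD, hα, hβ, hγ, mul_zero, add_zero, add_mul]
    have hDw' : D' S'.w₀ = S'.w₀ := by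
      rw [w₀, hD', hD', hα', hβ' rfl, hγ', zero_mul, mul_zero, zero_add, add_zero]
    refine ⟨S'.α + S'.w₀, S'.mem_secondSocle ?_ fun z hz => ?_, S'.u, S'.u_mem_nilCentral,
      ?_, ?_, ?_⟩
    · have e : (S'.α + S'.w₀) * (S'.α + S'.w₀) =
          (S'.α * S'.α - S'.w₀ ^ 2) + S'.α * S'.w₁ ^ 1 := by
        rw [← S'.w₀_pow_α, pow_one, add_mul, mul_add, mul_add, S'.α_mul_w₀, add_zero, ← pow_two S'.w₀,
          sub_eq_add_of_charTwo K]
        abel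
      rw [mem_squareKernel, e]
      exact add_mem hαα (S'.αw₁_pow_mem one_ne_zero)
    · rw [mul_add]
      have := S'.nilCentral_mul_w₀_pow le_rfl hz
      rw [show 2 - 1 = 1 from rfl, pow_one] at this
      exact add_mem (S'.nilCentral_mul_α (Or.inl (mul_zero _)) hz) this
    · rw [map_add, hα, hDw, map_add, TrivSqZeroExt.fst_add, hτ1]
      simp [S'.τ_β]
    · rw [map_add, hα', hDw', zero_add, S'.τ_w₀, TrivSqZeroExt.fst_zero]
    · rw [map_add, hα', hDw', zero_add]
      have := S'.u_pow_mul_w₀_pow (i := 1) (j := 1) one_ne_zero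
      rw [pow_one, pow_one] at this
      rw [this]
      exact S'.f_top
  · refine ⟨S'.α + S'.η, S'.mem_secondSocle ?_ fun z hz => ?_, S'.ζ, S'.ζ_mem_nilCentral,
      ?_, ?_, ?_⟩
    · have e : (S'.α + S'.η) * (S'.α + S'.η) =
          (S'.α * S'.α - S'.w₀ ^ k) + (S'.w₂ ^ k - S'.w₀ ^ k) := by
        rw [add_mul, mul_add, mul_add, S'.α_mul_η, S'.η_mul_α, ← pow_two S'.η, S'.η_pow_s,
          add_zero, zero_add, sub_eq_add_of_charTwo K, sub_eq_add_of_charTwo K,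
          add_add_add_comm, add_comm (S'.w₀ ^ k), add_assoc,
          add_self_eq_zero_of_charTwo K, add_zero]
      rw [mem_squareKernel, e]
      exact add_mem hαα (S'.w₂_pow_sub_mem hk0)
    · rw [mul_add]
      have := S'.nilCentral_mul_η_pow le_rfl hz
      rw [show 2 - 1 = 1 from rfl, pow_one] at this
      exact add_mem (S'.nilCentral_mul_α (Or.inl (mul_zero _)) hz) this
    · rw [map_add, hα, hη, add_zero, hτ1]
    · rw [map_add, hα', hη' rfl, zero_add, S'.τ_η, TrivSqZeroExt.fst_zero]
    · rw [map_add, hα', hη' rfl, zero_add]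
      have := S'.ζpow_mul_η_pow (i := 1) (j := 1) one_ne_zero one_ne_zero
      rw [pow_one, S'.ζpow_one] at this
      rw [this, S'.f_η_pow two_ne_zero, if_pos rfl]

end SDModel

end ModelDifferentials

/-! ### Polynomial representations of the path algebra. -/

section Representations

open Matrix Polynomial

variable (K : Type u) [Field K]

/-- The three-dimensional representation with `αβγ` acting by the variable. -/
noncomputable def repGen : Gen2B → Matrix (Fin 3) (Fin 3) K[X]
  | .e0 => single 0 0 1 + single 1 1 1
  | .e1 => single 2 2 1
  | .α => single 0 1 1
  | .β => single 1 2 1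
  | .γ => single 2 0 X
  | .η => 0

/-- The one-dimensional representation at the first vertex with `α` acting by the variable. -/
noncomputable def repGen₀ : Gen2B → K[X]
  | .e0 => 1
  | .α => X
  | _ => 0

/-- The one-dimensional representation at the second vertex with `η` acting by the variable. -/
noncomputable def repGen₁ : Gen2B → K[X]
  | .e1 => 1
  | .η => X
  | _ => 0

theorem isQuiverRep_repGen : IsQuiverRep (repGen K) := by
  constructor <;> simp [repGen, mul_add, add_mul]
  ext i j
  fin_cases i <;> fin_cases j <;> simp

theorem isQuiverRep_repGen₀ : IsQuiverRep (repGen₀ K) := by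
  constructor <;> simp [repGen₀]

theorem isQuiverRep_repGen₁ : IsQuiverRep (repGen₁ K) := by
  constructor <;> simp [repGen₁]

/-- The three-dimensional representation with `αβγ` acting by the variable. -/
noncomputable def rep : PathAlg2B K →ₐ[K] Matrix (Fin 3) (Fin 3) K[X] :=
  PathAlg2B.lift (isQuiverRep_repGen K)

/-- The one-dimensional representation at the first vertex with `α` acting by the variable. -/
noncomputable def rep₀ : PathAlg2B K →ₐ[K] K[X] := PathAlg2B.lift (isQuiverRep_repGen₀ K)

/-- The one-dimensional representation at the second vertex with `η` acting by the variable. -/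
noncomputable def rep₁ : PathAlg2B K →ₐ[K] K[X] := PathAlg2B.lift (isQuiverRep_repGen₁ K)

theorem rep_of (g : Gen2B) : rep K (PathAlg2B.of K g) = repGen K g := PathAlg2B.lift_of _ _
theorem rep₀_of (g : Gen2B) : rep₀ K (PathAlg2B.of K g) = repGen₀ K g := PathAlg2B.lift_of _ _
theorem rep₁_of (g : Gen2B) : rep₁ K (PathAlg2B.of K g) = repGen₁ K g := PathAlg2B.lift_of _ _

/-- The representations do not satisfy the relations; a trace form is assembled from coefficients of
several of them. These identities between low coefficients make the contributions match across a
relation. -/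
theorem rep_coeff_zero (x : PathAlg2B K) :
    (rep K x 1 0).coeff 0 = 0 ∧ (rep K x 2 0).coeff 0 = 0 ∧ (rep K x 2 1).coeff 0 = 0 ∧
    (rep K x 1 1).coeff 0 = (rep K x 0 0).coeff 0 ∧ (rep₀ K x).coeff 0 = (rep K x 0 0).coeff 0 ∧
    (rep₀ K x).coeff 1 = (rep K x 0 1).coeff 0 ∧ (rep₁ K x).coeff 0 = (rep K x 2 2).coeff 0 := by
  induction x using PathAlg2B.induction with
  | hof g => cases g <;> simp [rep_of, rep₀_of, rep₁_of, repGen, repGen₀, repGen₁, coeff_one]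
  | halg r =>
    simp [Matrix.algebraMap_matrix_apply]
  | hadd x y hx hy =>
    obtain ⟨h1, h2, h3, h4, h5, h6, h7⟩ := hx
    obtain ⟨h1', h2', h3', h4', h5', h6', h7'⟩ := hy
    simp [h1, h2, h3, h4, h5, h6, h7, h1', h2', h3', h4', h5', h6', h7']
  | hmul x y hx hy =>
    obtain ⟨h1, h2, h3, h4, h5, h6, h7⟩ := hx
    obtain ⟨h1', h2', h3', h4', h5', h6', h7'⟩ := hy
    simp [Matrix.mul_apply, Fin.sum_univ_three, mul_coeff_zero, mul_coeff_one,
      h1, h2, h3, h4, h5, h6, h7, h1', h2', h3', h4', h5', h6', h7']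

theorem single_pow_succ {n R : Type*} [Fintype n] [DecidableEq n] [Semiring R] (i : n) (c : R)
    (m : ℕ) : (single i i c : Matrix n n R) ^ (m + 1) = single i i (c ^ (m + 1)) := by
  induction m with
  | zero => simp
  | succ m ih => rw [pow_succ, ih, single_mul_single_same, ← pow_succ]

/-- The linear form sending a polynomial matrix to the `i`-th coefficient of its trace. -/
noncomputable def traceCoeff {n : Type} [Fintype n] (i : ℕ) : Matrix n n K[X] →ₗ[K] K :=
  lcoeff K i ∘ₗ (Matrix.traceLinearMap n K K[X])

theorem traceCoeff_apply {n : Type} [Fintype n] (i : ℕ) (M : Matrix n n K[X]) :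
    traceCoeff K i M = M.trace.coeff i := rfl

theorem traceCoeff_mul_comm {n : Type} [Fintype n] (i : ℕ) (M N : Matrix n n K[X]) :
    traceCoeff K i (M * N) = traceCoeff K i (N * M) := by
  rw [traceCoeff_apply, traceCoeff_apply, Matrix.trace_mul_comm]

theorem traceCoeff_single_mul {n : Type} [Fintype n] [DecidableEq n] (m : ℕ) (i j : n) (p : K[X])
    (M : Matrix n n K[X]) : traceCoeff K m (single i j p * M) = (p * M j i).coeff m := by
  rw [traceCoeff_apply, Matrix.trace_single_mul, smul_eq_mul]

end Representations

/-! ### The first algebra as an instance of the model. -/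

section FirstAlgebra

open Matrix Polynomial

variable (K : Type u) [Field K] (k s : ℕ) (c : K)

/-- The trace form of `SD(2B)₁` on the path algebra. -/
noncomputable def traceFormOne : PathAlg2B K →ₗ[K] K :=
  traceCoeff K k ∘ₗ (rep K).toLinearMap + lcoeff K s ∘ₗ (rep₁ K).toLinearMap +
    (c • lcoeff K 2 + lcoeff K 3) ∘ₗ (rep₀ K).toLinearMap

theorem traceFormOne_apply (x : PathAlg2B K) : traceFormOne K k s c x =
    traceCoeff K k (rep K x) + (rep₁ K x).coeff s +
      (c * (rep₀ K x).coeff 2 + (rep₀ K x).coeff 3) := rfl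

theorem traceFormOne_mul_comm (x y : PathAlg2B K) :
    traceFormOne K k s c (x * y) = traceFormOne K k s c (y * x) := by
  simp only [traceFormOne_apply, map_mul, traceCoeff_mul_comm K k (rep K x), mul_comm (rep₁ K x),
    mul_comm (rep₀ K x)]

variable {k s}

/-- On paths the form is `1` on the rotations of `(αβγ) ^ k`, on `η ^ s` and on `α ^ 3`, `c` on `α ^
2`, and `0` on the rest. The value on `α ^ 3` is forced by `α³ = (αβγ) ^ k`. -/
theorem traceFormOne_rel (hk : 1 ≤ k) (hs : 1 ≤ s) (a b : PathAlg2B K) (h : SD2BOneRel K k s c a b)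
    (x : PathAlg2B K) : traceFormOne K k s c (a * x) = traceFormOne K k s c (b * x) := by
  obtain ⟨h1, h2, h3, h4, h5, h6, h7⟩ := rep_coeff_zero K x
  obtain ⟨m, rfl⟩ : ∃ m, k = m + 1 := ⟨k - 1, by omega⟩
  obtain ⟨n, rfl⟩ : ∃ n, s = n + 1 := ⟨s - 1, by omega⟩
  have hβγα : (single (1 : Fin 3) (1 : Fin 3) (X : K[X])) ^ m * single 1 0 X =
      single 1 0 (X ^ (m + 1)) := by
    rcases m with _ | m
    · simp
    · rw [single_pow_succ, single_mul_single_same, ← pow_succ]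
  simp only [traceFormOne_apply, map_mul]
  cases h <;> simp only [PathAlg2B.α, PathAlg2B.β, PathAlg2B.γ, PathAlg2B.η, rep_of, rep₀_of,
    rep₁_of, repGen, repGen₀, repGen₁, map_mul, map_pow, map_add, map_smul, map_zero]
  · simp
  · simp
  · simp
  · simp [single_pow_succ, hβγα, add_mul, traceCoeff_single_mul, pow_two (single _ _ _),
      coeff_X_pow_mul', h5, h6, add_comm]
  · simp [single_pow_succ, traceCoeff_single_mul, coeff_X_pow_mul', h7]
  · simp [single_pow_succ, traceCoeff_single_mul, coeff_X_pow_mul', h4]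

variable (k s) in
theorem exists_model_one (hk : 1 ≤ k) (hs : 1 ≤ s) :
    ∃ S : SDModel K (SD2BOne K k s c) k s c 1 0,
      S.e0 = quotGen (SD2BOneRel K k s c) .e0 ∧ S.e1 = quotGen (SD2BOneRel K k s c) .e1 ∧
      S.α = quotGen (SD2BOneRel K k s c) .α ∧ S.β = quotGen (SD2BOneRel K k s c) .β ∧
      S.γ = quotGen (SD2BOneRel K k s c) .γ ∧ S.η = quotGen (SD2BOneRel K k s c) .η := by
  have hk0 : k ≠ 0 := by omega
  have hs0 : s ≠ 0 := by omega
  obtain ⟨f, hf, hff⟩ := RingQuot.exists_trace (traceFormOne K k s c)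
    (traceFormOne_mul_comm K k s c) (traceFormOne_rel K c hk hs)
  obtain ⟨τ, hτ⟩ := exists_algHom_quotGen (K := K) (r := SD2BOneRel K k s c) (R := DualNumber K)
    (v := fun | .e0 => 1 | .α => DualNumber.eps | _ => 0) (by constructor <;> simp) (by
      intro a b h
      cases h <;> simp [PathAlg2B.α, PathAlg2B.β, PathAlg2B.γ, PathAlg2B.η, PathAlg2B.lift_of,
        hk0, hs0, pow_two])
  obtain ⟨ε₁, hε⟩ := exists_algHom_quotGen (K := K) (r := SD2BOneRel K k s c) (R := K)
    (v := fun | .e1 => 1 | _ => 0) (by constructor <;> simp) (by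
      intro a b h
      cases h <;> simp [PathAlg2B.α, PathAlg2B.β, PathAlg2B.γ, PathAlg2B.η, PathAlg2B.lift_of,
        hk0, hs0])
  have hq := isQuiverRep_quotGen (SD2BOneRel K k s c)
  have hadj := adjoin_range_quotGen (SD2BOneRel K k s c)
  have R {a b} (h : SD2BOneRel K k s c a b) := RingQuot.mkAlgHom_rel K h
  have hfg : ∀ x, f (RingQuot.mkAlgHom K _ x) = traceFormOne K k s c x := hf
  generalize hg : quotGen (SD2BOneRel K k s c) = g at *
  have hgx : ∀ x, RingQuot.mkAlgHom K (SD2BOneRel K k s c) (PathAlg2B.of K x) = g x := fun x => by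
    rw [← hg]; rfl
  have hγβ : g .γ * g .β = 0 := by
    have h := R .γβ
    rwa [map_mul, map_zero, PathAlg2B.γ, PathAlg2B.β, hgx, hgx] at h
  have hηγ : g .η * g .γ = 0 := by
    have h := R .ηγ
    rwa [map_mul, map_zero, PathAlg2B.γ, PathAlg2B.η, hgx, hgx] at h
  have hβη : g .β * g .η = 0 := by
    have h := R .βη
    rwa [map_mul, map_zero, PathAlg2B.β, PathAlg2B.η, hgx, hgx] at h
  have hαα : g .α * g .α = (g .β * g .γ * g .α) ^ (k - 1) * (g .β * g .γ) +
      c • (g .α * g .β * g .γ) ^ k := by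
    have h := R .αα
    simp only [map_mul, map_add, map_pow, map_smul, PathAlg2B.α, PathAlg2B.β, PathAlg2B.γ,
      hgx] at h
    rw [← pow_two, h]
  have hηs : g .η ^ s = (g .γ * g .α * g .β) ^ k := by
    have h := R .η_pow
    simpa only [map_mul, map_pow, PathAlg2B.α, PathAlg2B.β, PathAlg2B.γ, PathAlg2B.η, hgx] using h
  have hsoc : (g .α * g .β * g .γ) ^ k = (g .β * g .γ * g .α) ^ k := by
    have h := R .socle
    simpa only [map_mul, map_pow, PathAlg2B.α, PathAlg2B.β, PathAlg2B.γ, hgx] using h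
  have hβγβ : g .β * g .γ * g .β = 0 := by rw [mul_assoc, hγβ, mul_zero]
  have hγβγ : g .γ * g .β * g .γ = 0 := by rw [hγβ, zero_mul]
  have hγw : g .γ * (g .α * g .β * g .γ) ^ k = 0 := by
    rw [hsoc]
    exact SDModel.mul_pow_eq_zero (by rw [← mul_assoc, ← mul_assoc, hγβ, zero_mul, zero_mul]) hk0
  have hcoeff : ∀ i, 1 ≤ i → f ((g .α * g .β * g .γ) ^ i) = if k = i then 1 else 0 := fun i hi => by
    obtain ⟨j, rfl⟩ : ∃ j, i = j + 1 := ⟨i - 1, by omega⟩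
    simp only [← hgx, ← map_mul, ← map_pow]
    rw [hfg, traceFormOne_apply]
    simp [rep_of, rep₀_of, rep₁_of, repGen, repGen₀, repGen₁, single_pow_succ, traceCoeff_apply,
      coeff_X_pow]
  refine ⟨{
    e0 := g .e0
    e1 := g .e1
    α := g .α
    β := g .β
    γ := g .γ
    η := g .η
    adjoin_eq_top := by
      rw [← hadj]
      congr 1
      ext x
      constructor
      · rintro (rfl | rfl | rfl | rfl | rfl | rfl) <;> exact ⟨_, rfl⟩
      · rintro ⟨y, rfl⟩
        cases y <;> simp
    k_pos := hk
    s_pos := hs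
    μν := mul_zero _
    e0_e0 := hq.e0_e0
    e1_e1 := hq.e1_e1
    e0_e1 := hq.e0_e1
    e1_e0 := hq.e1_e0
    e0_add_e1 := hq.e0_add_e1
    e0_α := hq.e0_α
    α_e0 := hq.α_e0
    e0_β := hq.e0_β
    β_e1 := hq.β_e1
    e1_γ := hq.e1_γ
    γ_e0 := hq.γ_e0
    e1_η := hq.e1_η
    η_e1 := hq.η_e1
    βγβ := hβγβ
    γβγ := hγβγ
    ααβ := by
      obtain ⟨j, hj⟩ : ∃ j, k = j + 1 := ⟨k - 1, by omega⟩
      rw [hαα, add_mul, mul_assoc, hβγβ, mul_zero, zero_add, smul_mul_assoc,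
        SDModel.pow_mul_eq_zero (by rw [mul_assoc, mul_assoc, ← mul_assoc (g .β), hβγβ, mul_zero])
          hk0, smul_zero]
    γαα := by
      rw [mul_assoc, hαα, mul_add, mul_smul_comm, hγw, smul_zero, add_zero]
      rcases eq_or_ne (k - 1) 0 with h | h
      · rw [h, pow_zero, one_mul, ← mul_assoc, hγβγ]
      · rw [← mul_assoc, SDModel.mul_pow_eq_zero
          (by rw [← mul_assoc, ← mul_assoc, hγβ, zero_mul, zero_mul]) h, zero_mul]
    ηγα := by rw [hηγ, zero_mul]
    αβη := by rw [mul_assoc, hβη, mul_zero]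
    βηη := by rw [hβη, zero_mul]
    ηηγ := by rw [mul_assoc, hηγ, mul_zero]
    γβ := by rw [hγβ, zero_smul]
    βη := by rw [hβη, zero_smul]
    ηγ := by rw [hηγ, zero_smul]
    αα := by rw [hαα, one_smul]
    η_pow := hηs
    socle := hsoc
    γ_pow := hγw
    f := f
    f_comm := hff
    f_e0 := by
      rw [← hgx, hfg, traceFormOne_apply]
      simp [rep_of, rep₀_of, rep₁_of, repGen, repGen₀, repGen₁, traceCoeff_apply, coeff_one, hk0]
    f_e1 := by
      rw [← hgx, hfg, traceFormOne_apply]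
      simp [rep_of, rep₀_of, rep₁_of, repGen, repGen₀, repGen₁, traceCoeff_apply, coeff_one, hk0,
        hs0]
    f_α := by
      rw [← hgx, hfg, traceFormOne_apply]
      simp [rep_of, rep₀_of, rep₁_of, repGen, repGen₀, repGen₁, traceCoeff_apply, coeff_X]
    f_pow := fun i h1 h2 => by rw [hcoeff i h1, if_neg (by omega)]
    f_top := by rw [hcoeff k hk, if_pos rfl]
    f_η := fun j h1 h2 => by
      simp only [← hgx, ← map_pow]
      rw [hfg, traceFormOne_apply]
      have : j ≠ 0 := by omega
      simp [rep_of, rep₀_of, rep₁_of, repGen, repGen₀, repGen₁, traceCoeff_apply, coeff_X_pow,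
        this]
      omega
    τ := τ
    τ_e0 := hτ _
    τ_e1 := hτ _
    τ_α := hτ _
    τ_β := hτ _
    τ_γ := hτ _
    τ_η := hτ _
    ε₁ := ε₁
    ε₁_e0 := hε _
    ε₁_e1 := hε _
    ε₁_α := hε _
    ε₁_β := hε _
    ε₁_γ := hε _
    ε₁_η := hε _ }, rfl, rfl, rfl, rfl, rfl, rfl⟩

end FirstAlgebra

/-! ### Derivations as maps to square-zero extensions. -/

section Derivations

open TrivSqZeroExt

/-- A derivation is the second component of an algebra homomorphism to the trivial square-zero
extension lifting the identity. The first components respect the relations automatically. -/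
theorem exists_derivation {K : Type u} [Field K] {r : PathAlg2B K → PathAlg2B K → Prop}
    (d : Gen2B → RingQuot r)
    (hv : IsQuiverRep fun x => (inl (quotGen r x) + inr (d x) :
      TrivSqZeroExt (RingQuot r) (RingQuot r)))
    (h : ∀ a b, r a b → (PathAlg2B.lift (K := K) hv a).snd = (PathAlg2B.lift (K := K) hv b).snd) :
    ∃ D : RingQuot r →ₗ[K] RingQuot r, (∀ x y, D (x * y) = D x * y + x * D y) ∧
      ∀ x, D (quotGen r x) = d x := by
  let φ := PathAlg2B.lift (K := K) hv
  have hfst : ∀ a, (φ a).fst = RingQuot.mkAlgHom K r a := fun a => by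
    induction a using PathAlg2B.induction with
    | hof x =>
      change (PathAlg2B.lift (K := K) hv _).fst = _
      rw [PathAlg2B.lift_of, fst_add, fst_inl, fst_inr, add_zero]
      rfl
    | halg c =>
      rw [AlgHom.commutes, AlgHom.commutes, algebraMap_eq_inl']
      rfl
    | hadd x y hx hy => rw [map_add, map_add, fst_add, hx, hy]
    | hmul x y hx hy => rw [map_mul, map_mul, fst_mul, hx, hy]
  let Φ : RingQuot r →ₐ[K] TrivSqZeroExt (RingQuot r) (RingQuot r) :=
    RingQuot.liftAlgHom K ⟨φ, fun a b hab => by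
      ext
      · rw [hfst, hfst, RingQuot.mkAlgHom_rel K hab]
      · exact h a b hab⟩
  have hΦ : ∀ a, Φ (RingQuot.mkAlgHom K r a) = φ a := fun a =>
    RingQuot.liftAlgHom_mkAlgHom_apply _ _ _ _
  have hΦ1 : ∀ x, (Φ x).fst = x := fun x => by
    obtain ⟨a, rfl⟩ := RingQuot.mkAlgHom_surjective K r x
    rw [hΦ, hfst]
  refine ⟨⟨⟨fun x => (Φ x).snd, fun x y => by rw [map_add, snd_add]⟩,
    fun c x => by simp⟩, fun x y => ?_, fun x => ?_⟩
  · change (Φ (x * y)).snd = (Φ x).snd * y + x * (Φ y).snd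
    rw [map_mul, snd_mul, hΦ1, hΦ1, smul_eq_mul, op_smul_eq_mul, add_comm]
  · change (Φ (RingQuot.mkAlgHom K r (PathAlg2B.of K x))).snd = d x
    rw [hΦ]
    change (PathAlg2B.lift (K := K) hv _).snd = _
    rw [PathAlg2B.lift_of, snd_add, snd_inl, snd_inr, zero_add]

theorem snd_pow_succ_left {A : Type*} [Ring A] {x : TrivSqZeroExt A A} (h : x.fst * x.snd = 0)
    (n : ℕ) : (x ^ (n + 1)).snd = x.snd * x.fst ^ n := by
  induction n with
  | zero => simp
  | succ n ih =>
    rw [pow_succ, snd_mul, fst_pow, ih, smul_eq_mul, op_smul_eq_mul, pow_succ, mul_assoc, h,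
      mul_zero, zero_add, mul_assoc]

theorem snd_pow_succ_right {A : Type*} [Ring A] {x : TrivSqZeroExt A A} (h : x.snd * x.fst = 0)
    (n : ℕ) : (x ^ (n + 1)).snd = x.fst ^ n * x.snd := by
  induction n with
  | zero => simp
  | succ n ih =>
    have h1 : x.snd * x.fst ^ (n + 1) = 0 := by rw [pow_succ', ← mul_assoc, h, zero_mul]
    rw [pow_succ' x, snd_mul, fst_pow, ih, smul_eq_mul, op_smul_eq_mul, h1, add_zero, ← mul_assoc,
      ← pow_succ']

end Derivations

/-! ### Two derivations compatible with the relations for `c = 1`. -/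

section ModelDerivations

open TrivSqZeroExt

namespace SDModel

variable {K A : Type u} [Field K] [CharP K 2] [Ring A] [Algebra K A] {k s : ℕ}
  (S : SDModel K A k s 1 1 0)

/-- For `α ↦ α + e0`, `β ↦ β`, `γ ↦ 0`, `η ↦ 0`, characteristic two gives `w₀ ↦ βγ`, `w₁ ↦ βγ`, `w₂
↦ 0` and `α² ↦ 0`. Both terms on the right of the relation for `α²` then map to `βγ w₀ ^ (k - 1)`
and cancel. -/
theorem snd_relations_loop {a b g h : TrivSqZeroExt A A} (ha : a = inl S.α + inr (S.α + S.e0))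
    (hb : b = inl S.β + inr S.β) (hg : g = inl S.γ) (hh : h = inl S.η) :
    (g * b).snd = 0 ∧ (h * g).snd = 0 ∧ (b * h).snd = 0 ∧
    (a ^ 2).snd = ((b * g * a) ^ (k - 1) * (b * g) + (1 : K) • (a * b * g) ^ k).snd ∧
    (h ^ s).snd = ((g * a * b) ^ k).snd ∧ ((a * b * g) ^ k).snd = ((b * g * a) ^ k).snd := by
  have h2 : ∀ x : A, x + x = 0 := add_self_eq_zero_of_charTwo K
  have hγβ : S.γ * S.β = 0 := by rw [S.γβ, zero_smul]
  have hβη : S.β * S.η = 0 := by rw [S.βη, zero_smul]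
  have f0 : (a * b * g).fst = S.w₀ := by simp [ha, hb, hg, w₀]
  have f1 : (b * g * a).fst = S.w₁ := by simp [ha, hb, hg, w₁]
  have d0 : (a * b * g).snd = S.β * S.γ := by
    simp only [ha, hb, hg, snd_mul, fst_mul, snd_add, snd_inl, snd_inr, fst_add, fst_inl, fst_inr,
      smul_eq_mul, op_smul_eq_mul, add_zero, zero_add, mul_zero, zero_mul, add_mul, S.e0_β]
    rw [← add_assoc, h2, zero_add]
  have d1 : (b * g * a).snd = S.β * S.γ := by
    simp only [ha, hb, hg, snd_mul, fst_mul, snd_add, snd_inl, snd_inr, fst_add, fst_inl, fst_inr,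
      smul_eq_mul, op_smul_eq_mul, add_zero, zero_add, mul_zero, mul_add]
    rw [mul_assoc S.β S.γ S.e0, S.γ_e0, ← add_assoc, h2, zero_add]
  have d2 : (g * a * b).snd = 0 := by
    simp only [ha, hb, hg, snd_mul, fst_mul, snd_add, snd_inl, snd_inr, fst_inl, fst_inr,
      smul_eq_mul, op_smul_eq_mul, add_zero, zero_add, mul_zero, mul_add, add_mul, zero_mul]
    rw [S.γ_e0, hγβ, add_zero, h2]
  obtain ⟨j, rfl⟩ : ∃ j, k = j + 1 := ⟨k - 1, by have := S.k_pos; omega⟩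
  obtain ⟨i, rfl⟩ : ∃ i, s = i + 1 := ⟨s - 1, by have := S.s_pos; omega⟩
  have p0 : ((a * b * g) ^ (j + 1)).snd = S.β * S.γ * S.w₀ ^ j := by
    rw [snd_pow_succ_left, d0, f0]
    rw [f0, d0, ← mul_assoc, S.w₀_mul_β, zero_mul]
  have p1 : ((b * g * a) ^ (j + 1)).snd = S.β * S.γ * S.w₀ ^ j := by
    rw [snd_pow_succ_right, d1, f1, S.w₁_pow_mul_βγ]
    rw [f1, d1, mul_assoc, S.γ_mul_w₁, mul_zero]
  refine ⟨?_, ?_, ?_, ?_, ?_, ?_⟩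
  · simp [hg, hb, hγβ]
  · simp [hg, hh]
  · simp [hb, hh, hβη]
  · have e1 : (a ^ 2).snd = 0 := by
      simp only [pow_two, ha, snd_mul, snd_add, snd_inl, snd_inr, fst_inl, fst_inr,
        smul_eq_mul, op_smul_eq_mul, add_zero, zero_add, mul_add, add_mul, S.α_e0, S.e0_α,
        mul_zero, zero_mul]
      exact h2 _
    have e2 : ((b * g * a) ^ j * (b * g)).snd = S.β * S.γ * S.w₀ ^ j := by
      have e3 : (b * g).snd = S.β * S.γ := by simp [hb, hg]
      have e4 : (b * g).fst = S.β * S.γ := by simp [hb, hg]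
      rw [snd_mul, e3, e4, fst_pow, f1, smul_eq_mul, op_smul_eq_mul, S.w₁_pow_mul_βγ]
      rcases j with _ | j
      · simp
      · have e5 : S.w₁ ^ j * (S.β * S.γ) * (S.β * S.γ) = 0 := by
          rw [mul_assoc, ← mul_assoc _ S.β, S.βγβ, zero_mul, mul_zero]
        rw [snd_pow_succ_right, d1, f1, e5, add_zero]
        rw [f1, d1, mul_assoc, S.γ_mul_w₁, mul_zero]
    rw [e1, snd_add, Nat.add_sub_cancel, e2, one_smul, p0, h2]
  · rw [snd_pow_succ_left, snd_pow_succ_left, d2, hh, snd_inl, zero_mul, zero_mul]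
    · rw [d2, mul_zero]
    · rw [hh, snd_inl, mul_zero]
  · rw [p0, p1]

/-- The derivation counts `β` when `k = 2` and `η` when `s = 2`. In the relations with nonzero terms
these then occur an even number of times, which is zero in `K`. -/
theorem snd_relations_double {a b g h : TrivSqZeroExt A A} (ha : a = inl S.α)
    (hb : b = inl S.β + inr (if k = 2 then S.β else 0)) (hg : g = inl S.γ)
    (hh : h = inl S.η + inr (if s = 2 then S.η else 0)) :
    (g * b).snd = 0 ∧ (h * g).snd = 0 ∧ (b * h).snd = 0 ∧
    (a ^ 2).snd = ((b * g * a) ^ (k - 1) * (b * g) + (1 : K) • (a * b * g) ^ k).snd ∧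
    (h ^ s).snd = ((g * a * b) ^ k).snd ∧ ((a * b * g) ^ k).snd = ((b * g * a) ^ k).snd := by
  have h2 : ∀ x : A, x + x = 0 := add_self_eq_zero_of_charTwo K
  have hγβ : S.γ * S.β = 0 := by rw [S.γβ, zero_smul]
  have hβη : S.β * S.η = 0 := by rw [S.βη, zero_smul]
  have hηγ : S.η * S.γ = 0 := by rw [S.ηγ, zero_smul]
  have hsq : ∀ x : TrivSqZeroExt A A, x.snd = x.fst → (x ^ 2).snd = 0 := fun x hx => by
    rw [pow_two, snd_mul, hx, smul_eq_mul, op_smul_eq_mul, h2]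
  have hz : ∀ x : TrivSqZeroExt A A, x.snd = 0 → ∀ n, (x ^ n).snd = 0 := fun x hx n => by
    rcases n with _ | n
    · simp
    · rw [snd_pow_succ_left (by rw [hx, mul_zero]), hx, zero_mul]
  have hh' : (h ^ s).snd = 0 := by
    split_ifs at hh with h3
    · rw [h3]; exact hsq h (by simp [hh])
    · exact hz h (by simp [hh]) s
  by_cases hk : k = 2
  · rw [if_pos hk] at hb
    rw [hh', hk]
    refine ⟨by simp [hg, hb, hγβ], ?_, ?_, ?_, ?_, ?_⟩
    · split_ifs at hh <;> simp [hg, hh, hηγ]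
    · split_ifs at hh <;> simp [hb, hh, hβη]
    · rw [hz a (by simp [ha]), snd_add, one_smul, hsq (a * b * g) (by simp [ha, hb, hg]), add_zero,
        show 2 - 1 = 1 from rfl, pow_one, snd_mul]
      simp [ha, hb, hg, mul_assoc, h2]
    · rw [hsq (g * a * b) (by simp [ha, hb, hg])]
    · rw [hsq (a * b * g) (by simp [ha, hb, hg]), hsq (b * g * a) (by simp [ha, hb, hg])]
  · rw [if_neg hk, inr_zero, add_zero] at hb
    rw [hh']
    refine ⟨by simp [hg, hb], ?_, ?_, ?_, ?_, ?_⟩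
    · split_ifs at hh <;> simp [hg, hh, hηγ]
    · split_ifs at hh <;> simp [hb, hh, hβη]
    · rw [hz a (by simp [ha]), snd_add, one_smul, hz (a * b * g) (by simp [ha, hb, hg]), add_zero,
        snd_mul, hz (b * g * a) (by simp [ha, hb, hg])]
      simp [hb, hg]
    · rw [hz (g * a * b) (by simp [ha, hb, hg])]
    · rw [hz (a * b * g) (by simp [ha, hb, hg]), hz (b * g * a) (by simp [ha, hb, hg])]

end SDModel

end ModelDerivations

/-! ### Conclusion for the first algebra. -/

section FirstAlgebraDerivations

open TrivSqZeroExt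

variable {K : Type u} [Field K] [CharP K 2] {k s : ℕ}

theorem exists_derivation_loop
    (S : SDModel K (SD2BOne K k s 1) k s 1 1 0)
    (h0 : S.e0 = quotGen (SD2BOneRel K k s 1) .e0) (h1 : S.e1 = quotGen (SD2BOneRel K k s 1) .e1)
    (hα : S.α = quotGen (SD2BOneRel K k s 1) .α) (hβ : S.β = quotGen (SD2BOneRel K k s 1) .β)
    (hγ : S.γ = quotGen (SD2BOneRel K k s 1) .γ) (hη : S.η = quotGen (SD2BOneRel K k s 1) .η) :
    ∃ D : SD2BOne K k s 1 →ₗ[K] SD2BOne K k s 1, (∀ x y, D (x * y) = D x * y + x * D y) ∧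
      D S.α = S.α + S.e0 ∧ D S.β = S.β ∧ D S.γ = 0 ∧ D S.η = 0 := by
  let d : Gen2B → SD2BOne K k s 1
    | .α => S.α + S.e0
    | .β => S.β
    | _ => 0
  have hv : IsQuiverRep fun x => (inl (quotGen (SD2BOneRel K k s 1) x) + inr (d x) :
      TrivSqZeroExt (SD2BOne K k s 1) (SD2BOne K k s 1)) := by
    constructor <;> ext <;> simp [d, ← h0, ← h1, ← hα, ← hβ, ← hγ, ← hη, S.e0_e0, S.e1_e1,
      S.e0_e1, S.e1_e0, S.e0_α, S.α_e0, S.e0_β, S.β_e1, S.e1_γ, S.γ_e0, S.e1_η, S.η_e1,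
      S.e0_add_e1, mul_add, add_mul]
  obtain ⟨D, hD, hDx⟩ := exists_derivation d hv (by
    obtain ⟨r1, r2, r3, r4, r5, r6⟩ := S.snd_relations_loop rfl rfl rfl rfl
    have ha := PathAlg2B.lift_of (K := K) hv .α
    have hb := PathAlg2B.lift_of (K := K) hv .β
    have hg := PathAlg2B.lift_of (K := K) hv .γ
    have hh := PathAlg2B.lift_of (K := K) hv .η
    simp only [← hα, ← hβ, ← hγ, ← hη, d, inr_zero, add_zero] at ha hb hg hh
    intro a b h
    cases h <;> simp only [PathAlg2B.α, PathAlg2B.β, PathAlg2B.γ, PathAlg2B.η, map_mul, map_pow,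
      map_add, map_smul, map_zero, ha, hb, hg, hh]
    exacts [r1, r2, r3, r4, r5, r6])
  exact ⟨D, hD, (congrArg D hα).trans (hDx _), (congrArg D hβ).trans (hDx _),
    (congrArg D hγ).trans (hDx _), (congrArg D hη).trans (hDx _)⟩

theorem exists_derivation_double
    (S : SDModel K (SD2BOne K k s 1) k s 1 1 0)
    (h0 : S.e0 = quotGen (SD2BOneRel K k s 1) .e0) (h1 : S.e1 = quotGen (SD2BOneRel K k s 1) .e1)
    (hα : S.α = quotGen (SD2BOneRel K k s 1) .α) (hβ : S.β = quotGen (SD2BOneRel K k s 1) .β)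
    (hγ : S.γ = quotGen (SD2BOneRel K k s 1) .γ) (hη : S.η = quotGen (SD2BOneRel K k s 1) .η) :
    ∃ D : SD2BOne K k s 1 →ₗ[K] SD2BOne K k s 1, (∀ x y, D (x * y) = D x * y + x * D y) ∧
      D S.α = 0 ∧ D S.γ = 0 ∧ (k = 2 → D S.β = S.β) ∧ (s = 2 → D S.η = S.η) := by
  let d : Gen2B → SD2BOne K k s 1
    | .β => if k = 2 then S.β else 0
    | .η => if s = 2 then S.η else 0
    | _ => 0
  have hv : IsQuiverRep fun x => (inl (quotGen (SD2BOneRel K k s 1) x) + inr (d x) :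
      TrivSqZeroExt (SD2BOne K k s 1) (SD2BOne K k s 1)) := by
    constructor <;> ext <;> simp [d, ← h0, ← h1, ← hα, ← hβ, ← hγ, ← hη, S.e0_e0, S.e1_e1,
      S.e0_e1, S.e1_e0, S.e0_α, S.α_e0, S.e0_β, S.β_e1, S.e1_γ, S.γ_e0, S.e1_η, S.η_e1,
      S.e0_add_e1, mul_add, add_mul] <;>
      split_ifs <;> simp [S.e0_β, S.β_e1, S.e1_η, S.η_e1]
  obtain ⟨D, hD, hDx⟩ := exists_derivation d hv (by
    obtain ⟨r1, r2, r3, r4, r5, r6⟩ := S.snd_relations_double rfl rfl rfl rfl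
    have ha := PathAlg2B.lift_of (K := K) hv .α
    have hb := PathAlg2B.lift_of (K := K) hv .β
    have hg := PathAlg2B.lift_of (K := K) hv .γ
    have hh := PathAlg2B.lift_of (K := K) hv .η
    simp only [← hα, ← hβ, ← hγ, ← hη, d, inr_zero, add_zero] at ha hb hg hh
    intro a b h
    cases h <;> simp only [PathAlg2B.α, PathAlg2B.β, PathAlg2B.γ, PathAlg2B.η, map_mul, map_pow,
      map_add, map_smul, map_zero, ha, hb, hg, hh]
    exacts [r1, r2, r3, r4, r5, r6])
  refine ⟨D, hD, (congrArg D hα).trans (hDx _), (congrArg D hγ).trans (hDx _), fun h => ?_,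
    fun h => ?_⟩
  · exact ((congrArg D hβ).trans (hDx _)).trans (if_pos h)
  · exact ((congrArg D hη).trans (hDx _)).trans (if_pos h)

theorem not_stablyEquivalent_one (hk : 1 ≤ k) (hs : 1 ≤ s) (h2 : k = 2 → 3 ≤ s ∧ Odd s)
    (h2' : s = 2 → 3 ≤ k ∧ Odd k) :
    ¬ StablyEquivalentOfMoritaType K (SD2BOne K k s 0) (SD2BOne K k s 1) := by
  intro h
  obtain ⟨S, -⟩ := exists_model_one K k s 0 hk hs
  obtain ⟨S', e0, e1, eα, eβ, eγ, eη⟩ := exists_model_one K k s 1 hk hs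
  have hA : Module.Finite K (SD2BOne K k s 0) := S.finite
  have hB : Module.Finite K (SD2BOne K k s 1) := S'.finite
  by_cases hks : k ≠ 2 ∧ s ≠ 2
  · obtain ⟨T⟩ := h.exists_transfer
    exact (S.isEmpty_transfer S' hks.1 hks.2).false T
  -- The differentials are carried from `c = 1`, where two are independent, to `c = 0`, where they
  -- are collinear.
  · obtain ⟨T⟩ := h.symm.exists_transfer
    obtain ⟨D, hD, hα, hβ, hγ, hη⟩ := exists_derivation_loop S' e0 e1 eα eβ eγ eη
    obtain ⟨D', hD', hα', hγ', hβ', hη'⟩ := exists_derivation_double S' e0 e1 eα eβ eγ eη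
    refine (S.isEmpty_transfer_of_derivations S' ?_ D hD hα hβ hγ hη D' hD' hα' hγ' hβ' hη').false T
    by_cases hk2 : k = 2
    · exact Or.inl ⟨hk2, h2 hk2⟩
    · have hs2 : s = 2 := by by_contra hne; exact hks ⟨hk2, hne⟩
      exact Or.inr ⟨hs2, h2' hs2⟩

end FirstAlgebraDerivations

/-! ### The second algebra for `s ≥ 3` as an instance of the model. -/

section SecondAlgebra

open Matrix Polynomial

variable (K : Type u) [Field K]

/-- The three-dimensional representation with `βηγ` acting by the variable. -/
noncomputable def repGenη : Gen2B → Matrix (Fin 3) (Fin 3) K[X]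
  | .e0 => single 0 0 1
  | .e1 => single 1 1 1 + single 2 2 1
  | .α => 0
  | .β => single 0 1 1
  | .γ => single 2 0 X
  | .η => single 1 2 1

theorem isQuiverRep_repGenη : IsQuiverRep (repGenη K) := by
  constructor <;> simp [repGenη, mul_add, add_mul]
  ext i j
  fin_cases i <;> fin_cases j <;> simp

/-- The three-dimensional representation with `βηγ` acting by the variable. -/
noncomputable def repη : PathAlg2B K →ₐ[K] Matrix (Fin 3) (Fin 3) K[X] :=
  PathAlg2B.lift (isQuiverRep_repGenη K)

theorem repη_of (g : Gen2B) : repη K (PathAlg2B.of K g) = repGenη K g := PathAlg2B.lift_of _ _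

theorem repη_coeff_zero (x : PathAlg2B K) :
    (repη K x 1 0).coeff 0 = 0 ∧ (repη K x 2 0).coeff 0 = 0 ∧ (repη K x 2 1).coeff 0 = 0 ∧
    (repη K x 0 0).coeff 0 = (rep K x 0 0).coeff 0 ∧
    (repη K x 1 1).coeff 0 = (rep K x 2 2).coeff 0 ∧
    (repη K x 2 2).coeff 0 = (rep K x 2 2).coeff 0 ∧
    (repη K x 0 1).coeff 0 = (rep K x 1 2).coeff 0 ∧
    (repη K x 1 2).coeff 0 = (rep₁ K x).coeff 1 ∧
    (repη K x 2 0).coeff 1 = (rep K x 2 0).coeff 1 := by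
  induction x using PathAlg2B.induction with
  | hof g => cases g <;> simp [repη_of, rep_of, rep₁_of, repGenη, repGen, repGen₁, coeff_one]
  | halg r =>
    simp [Matrix.algebraMap_matrix_apply]
  | hadd x y hx hy =>
    obtain ⟨h1, h2, h3, h4, h5, h6, h7, h8, h9⟩ := hx
    obtain ⟨h1', h2', h3', h4', h5', h6', h7', h8', h9'⟩ := hy
    simp [h1, h2, h3, h4, h5, h6, h7, h8, h9, h1', h2', h3', h4', h5', h6', h7', h8', h9']
  | hmul x y hx hy =>
    obtain ⟨h1, h2, h3, h4, h5, h6, h7, h8, h9⟩ := hx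
    obtain ⟨h1', h2', h3', h4', h5', h6', h7', h8', h9'⟩ := hy
    obtain ⟨a1, a2, a3, a4, a5, a6, a7⟩ := rep_coeff_zero K x
    obtain ⟨b1, b2, b3, b4, b5, b6, b7⟩ := rep_coeff_zero K y
    simp [Matrix.mul_apply, Fin.sum_univ_three, mul_coeff_zero, mul_coeff_one,
      h1, h2, h3, h4, h5, h6, h7, h8, h9, h1', h2', h3', h4', h5', h6', h7', h8', h9',
      a1, a2, a3, a4, a7, b1, b2, b7]

variable (k s : ℕ) (c : K)

/-- The trace form of `SD(2B)₂` on the path algebra. -/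
noncomputable def traceFormTwo : PathAlg2B K →ₗ[K] K :=
  traceCoeff K k ∘ₗ (rep K).toLinearMap + lcoeff K s ∘ₗ (rep₁ K).toLinearMap +
    (traceCoeff K 1 ∘ₗ (repη K).toLinearMap + (c • lcoeff K 2) ∘ₗ (rep₀ K).toLinearMap)

theorem traceFormTwo_apply (x : PathAlg2B K) : traceFormTwo K k s c x =
    traceCoeff K k (rep K x) + (rep₁ K x).coeff s +
      (traceCoeff K 1 (repη K x) + c * (rep₀ K x).coeff 2) := rfl

theorem traceFormTwo_mul_comm (x y : PathAlg2B K) :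
    traceFormTwo K k s c (x * y) = traceFormTwo K k s c (y * x) := by
  simp only [traceFormTwo_apply, map_mul, traceCoeff_mul_comm K k (rep K x),
    traceCoeff_mul_comm K 1 (repη K x), mul_comm (rep₁ K x), mul_comm (rep₀ K x)]

variable {k s}

/-- The form is `1` on the rotations of `(αβγ) ^ k`, on `η ^ s` and on the rotations of `βηγ`, `c`
on `α ^ 2`, and `0` on other paths. The bound on `s` keeps `η ^ (s - 1)` of exponent at least two,
so that it acts by zero in `repη`. -/
theorem traceFormTwo_rel (hk : 1 ≤ k) (hs : 3 ≤ s) (a b : PathAlg2B K) (h : SD2BTwoRel K k s c a b)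
    (x : PathAlg2B K) : traceFormTwo K k s c (a * x) = traceFormTwo K k s c (b * x) := by
  obtain ⟨h1, h2, h3, h4, h5, h6, h7⟩ := rep_coeff_zero K x
  obtain ⟨g1, g2, g3, g4, g5, g6, g7, g8, g9⟩ := repη_coeff_zero K x
  obtain ⟨m, rfl⟩ : ∃ m, k = m + 1 := ⟨k - 1, by omega⟩
  obtain ⟨n, rfl⟩ : ∃ n, s = n + 3 := ⟨s - 3, by omega⟩
  have hαβ : (single (0 : Fin 3) (0 : Fin 3) (X : K[X])) ^ m * single 0 2 1 =
      single 0 2 (X ^ m) := by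
    rcases m with _ | m
    · simp
    · rw [single_pow_succ, single_mul_single_same, mul_one]
  have hγα : (single (2 : Fin 3) (2 : Fin 3) (X : K[X])) ^ m * single 2 1 X =
      single 2 1 (X ^ (m + 1)) := by
    rcases m with _ | m
    · simp
    · rw [single_pow_succ, single_mul_single_same, ← pow_succ]
  have hη : (single (1 : Fin 3) (2 : Fin 3) (1 : K[X])) ^ (n + 2) = 0 := by
    rw [pow_add, pow_two]; simp
  simp only [traceFormTwo_apply, map_mul]
  cases h <;> simp only [PathAlg2B.α, PathAlg2B.β, PathAlg2B.γ, PathAlg2B.η, PathAlg2B.e1, rep_of,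
    rep₀_of, rep₁_of, repη_of, repGen, repGen₀, repGen₁, repGenη, map_mul, map_pow, map_smul,
    map_zero, Nat.add_sub_cancel, show n + 3 - 1 = n + 2 from rfl]
  · simp [hαβ, traceCoeff_single_mul, coeff_X_pow_mul', g9]
  · simp [hγα, traceCoeff_single_mul, coeff_X_pow_mul', g7]
  · simp [hη, traceCoeff_single_mul, coeff_X_pow_mul', g8]
  · simp [single_pow_succ, traceCoeff_single_mul, pow_two (single _ _ _), coeff_X_pow_mul', h5]
  · simp [pow_two (single _ _ _)]
  · simp [pow_two (single _ _ _)]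

variable (k s) in
theorem exists_model_two (hk : 1 ≤ k) (hs : 3 ≤ s) :
    Nonempty (SDModel K (SD2BTwo K k s c) k s c 0 1) := by
  have hk0 : k ≠ 0 := by omega
  have hs0 : s ≠ 0 := by omega
  have hs1 : s - 1 ≠ 0 := by omega
  obtain ⟨f, hf, hff⟩ := RingQuot.exists_trace (traceFormTwo K k s c)
    (traceFormTwo_mul_comm K k s c) (traceFormTwo_rel K c hk hs)
  obtain ⟨τ, hτ⟩ := exists_algHom_quotGen (K := K) (r := SD2BTwoRel K k s c) (R := DualNumber K)
    (v := fun | .e0 => 1 | .α => DualNumber.eps | _ => 0) (by constructor <;> simp) (by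
      intro a b h
      cases h <;> simp [PathAlg2B.α, PathAlg2B.β, PathAlg2B.γ, PathAlg2B.η, PathAlg2B.e1,
        PathAlg2B.lift_of, hk0, pow_two])
  obtain ⟨ε₁, hε⟩ := exists_algHom_quotGen (K := K) (r := SD2BTwoRel K k s c) (R := K)
    (v := fun | .e1 => 1 | _ => 0) (by constructor <;> simp) (by
      intro a b h
      cases h <;> simp [PathAlg2B.α, PathAlg2B.β, PathAlg2B.γ, PathAlg2B.η, PathAlg2B.e1,
        PathAlg2B.lift_of, hk0, hs1])
  have hq := isQuiverRep_quotGen (SD2BTwoRel K k s c)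
  have hadj := adjoin_range_quotGen (SD2BTwoRel K k s c)
  have R {a b} (h : SD2BTwoRel K k s c a b) := RingQuot.mkAlgHom_rel K h
  have hfg : ∀ x, f (RingQuot.mkAlgHom K _ x) = traceFormTwo K k s c x := hf
  generalize hg : quotGen (SD2BTwoRel K k s c) = g at *
  have hgx : ∀ x, RingQuot.mkAlgHom K (SD2BTwoRel K k s c) (PathAlg2B.of K x) = g x := fun x => by
    rw [← hg]; rfl
  have hβη : g .β * g .η = (g .α * g .β * g .γ) ^ (k - 1) * (g .α * g .β) := by
    have h := R .βη
    simpa only [map_mul, map_pow, PathAlg2B.α, PathAlg2B.β, PathAlg2B.γ, PathAlg2B.η, hgx] using h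
  have hηγ : g .η * g .γ = (g .γ * g .α * g .β) ^ (k - 1) * (g .γ * g .α) := by
    have h := R .ηγ
    simpa only [map_mul, map_pow, PathAlg2B.α, PathAlg2B.β, PathAlg2B.γ, PathAlg2B.η, hgx] using h
  have hγβ : g .γ * g .β = g .η ^ (s - 1) := by
    have h := R .γβ
    simp only [map_mul, map_pow, PathAlg2B.β, PathAlg2B.γ, PathAlg2B.η, PathAlg2B.e1, hgx] at h
    rw [h, SDModel.mul_pow_eq_self hq.e1_η hs1]
  have hαα : g .α * g .α = c • (g .α * g .β * g .γ) ^ k := by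
    have h := R .αα
    simp only [map_mul, map_pow, map_smul, PathAlg2B.α, PathAlg2B.β, PathAlg2B.γ, hgx] at h
    rw [← pow_two, h]
  have hβηη : g .β * g .η * g .η = 0 := by
    have h := R .βηη
    simp only [map_mul, map_pow, map_zero, PathAlg2B.β, PathAlg2B.η, hgx] at h
    rw [mul_assoc, ← pow_two, h]
  have hηηγ : g .η * g .η * g .γ = 0 := by
    have h := R .ηηγ
    simp only [map_mul, map_pow, map_zero, PathAlg2B.γ, PathAlg2B.η, hgx] at h
    rw [← pow_two, h]
  obtain ⟨i, hi⟩ : ∃ i, s = i + 3 := ⟨s - 3, by omega⟩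
  obtain ⟨j, hj1⟩ : ∃ j, k - 1 = j := ⟨_, rfl⟩
  have hi1 : s - 1 = i + 2 := by omega
  have hpow : ∀ y : RingQuot (SD2BTwoRel K k s c), y ^ k = y ^ j * y := fun y => by
    rw [← hj1, pow_sub_one_mul hk0]
  have hβγβ : g .β * g .γ * g .β = 0 := by
    rw [mul_assoc, hγβ, hi1, pow_succ', pow_succ', ← mul_assoc, ← mul_assoc, hβηη, zero_mul]
  have hγβγ : g .γ * g .β * g .γ = 0 := by
    rw [hγβ, hi1, pow_succ, pow_succ, mul_assoc, mul_assoc, ← mul_assoc (g .η), hηηγ, mul_zero]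
  have hcyc : g .γ * (g .α * g .β * g .γ) ^ j = (g .γ * g .α * g .β) ^ j * g .γ :=
    (SemiconjBy.pow_right (show SemiconjBy (g .γ) (g .α * g .β * g .γ) (g .γ * g .α * g .β) by
      simp only [SemiconjBy, mul_assoc]) j)
  have hcyc' : g .β * (g .γ * g .α * g .β) ^ j = (g .β * g .γ * g .α) ^ j * g .β :=
    (SemiconjBy.pow_right (show SemiconjBy (g .β) (g .γ * g .α * g .β) (g .β * g .γ * g .α) by
      simp only [SemiconjBy, mul_assoc]) j)
  -- The relation for `ηγ` collapses this path to `ηγβγ`, and `γβγ = η ^ (s - 1) γ` is zero because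
  -- `s - 1 ≥ 2`.
  have hγw : g .γ * (g .α * g .β * g .γ) ^ k = 0 := by
    have : g .γ * (g .α * g .β * g .γ) ^ k = g .η * g .γ * g .β * g .γ := by
      rw [hηγ, hj1, hpow, ← mul_assoc, hcyc]
      simp only [mul_assoc]
    rw [this, mul_assoc, mul_assoc, ← mul_assoc (g .γ), hγβγ, mul_zero]
  have hααβ : g .α * g .α * g .β = 0 := by
    rw [hαα, smul_mul_assoc, SDModel.pow_mul_eq_zero (by
      rw [mul_assoc, mul_assoc, ← mul_assoc (g .β), hβγβ, mul_zero]) hk0, smul_zero]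
  have hγαα : g .γ * g .α * g .α = 0 := by rw [mul_assoc, hαα, mul_smul_comm, hγw, smul_zero]
  have hsoc : (g .α * g .β * g .γ) ^ k = (g .β * g .γ * g .α) ^ k := by
    have h1 : (g .α * g .β * g .γ) ^ k = g .β * g .η * g .γ := by
      rw [hβη, hj1, hpow]
      simp only [mul_assoc]
    have h2 : (g .β * g .γ * g .α) ^ k = g .β * (g .η * g .γ) := by
      rw [hηγ, hj1, hpow, ← mul_assoc (g .β), hcyc']
      simp only [mul_assoc]
    rw [h1, h2, mul_assoc]
  have hηs : g .η ^ s = (g .γ * g .α * g .β) ^ k := by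
    rw [← mul_pow_sub_one hs0, ← hγβ, ← mul_assoc, hηγ, hj1, hpow]
    simp only [mul_assoc]
  have hcoeff : ∀ i, 1 ≤ i → f ((g .α * g .β * g .γ) ^ i) = if k = i then 1 else 0 := fun i hi => by
    obtain ⟨j, rfl⟩ : ∃ j, i = j + 1 := ⟨i - 1, by omega⟩
    simp only [← hgx, ← map_mul, ← map_pow]
    rw [hfg, traceFormTwo_apply]
    simp [rep_of, rep₀_of, rep₁_of, repη_of, repGen, repGen₀, repGen₁, repGenη, single_pow_succ,
      traceCoeff_apply, coeff_X_pow]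
  exact ⟨{
    e0 := g .e0
    e1 := g .e1
    α := g .α
    β := g .β
    γ := g .γ
    η := g .η
    adjoin_eq_top := by
      rw [← hadj]
      congr 1
      ext x
      constructor
      · rintro (rfl | rfl | rfl | rfl | rfl | rfl) <;> exact ⟨_, rfl⟩
      · rintro ⟨y, rfl⟩
        cases y <;> simp
    k_pos := hk
    s_pos := by omega
    μν := zero_mul _
    e0_e0 := hq.e0_e0
    e1_e1 := hq.e1_e1
    e0_e1 := hq.e0_e1
    e1_e0 := hq.e1_e0
    e0_add_e1 := hq.e0_add_e1
    e0_α := hq.e0_α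
    α_e0 := hq.α_e0
    e0_β := hq.e0_β
    β_e1 := hq.β_e1
    e1_γ := hq.e1_γ
    γ_e0 := hq.γ_e0
    e1_η := hq.e1_η
    η_e1 := hq.η_e1
    βγβ := hβγβ
    γβγ := hγβγ
    ααβ := hααβ
    γαα := hγαα
    ηγα := by rw [hηγ, mul_assoc, hγαα, mul_zero]
    αβη := by
      rw [mul_assoc, hβη]
      rcases eq_or_ne (k - 1) 0 with h | h
      · rw [h, pow_zero, one_mul, ← mul_assoc, hααβ]
      · rw [← mul_assoc, SDModel.mul_pow_eq_zero
          (by rw [← mul_assoc, ← mul_assoc, hααβ, zero_mul]) h, zero_mul]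
    βηη := hβηη
    ηηγ := hηηγ
    γβ := by rw [hγβ, one_smul]
    βη := by rw [hβη, one_smul]
    ηγ := by rw [hηγ, one_smul]
    αα := by rw [hαα, zero_smul, zero_add]
    η_pow := hηs
    socle := hsoc
    γ_pow := hγw
    f := f
    f_comm := hff
    f_e0 := by
      rw [← hgx, hfg, traceFormTwo_apply]
      simp [rep_of, rep₀_of, rep₁_of, repη_of, repGen, repGen₀, repGen₁, repGenη, traceCoeff_apply,
        coeff_one, hk0]
    f_e1 := by
      rw [← hgx, hfg, traceFormTwo_apply]
      simp [rep_of, rep₀_of, rep₁_of, repη_of, repGen, repGen₀, repGen₁, repGenη, traceCoeff_apply,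
        coeff_one, hk0, hs0]
    f_α := by
      rw [← hgx, hfg, traceFormTwo_apply]
      simp [rep_of, rep₀_of, rep₁_of, repη_of, repGen, repGen₀, repGen₁, repGenη, traceCoeff_apply,
        coeff_X]
    f_pow := fun i h1 h2 => by rw [hcoeff i h1, if_neg (by omega)]
    f_top := by rw [hcoeff k hk, if_pos rfl]
    f_η := fun j h1 h2 => by
      simp only [← hgx, ← map_pow]
      rw [hfg, traceFormTwo_apply]
      have hj0 : j ≠ 0 := by omega
      have hη : (single (1 : Fin 3) (2 : Fin 3) (1 : K[X]) ^ j).trace = 0 := by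
        obtain ⟨m, rfl⟩ : ∃ m, j = m + 1 := ⟨j - 1, by omega⟩
        rcases m with _ | m
        · simp
        · rw [pow_succ, pow_succ, mul_assoc]; simp
      simp [rep_of, rep₀_of, rep₁_of, repη_of, repGen, repGen₀, repGen₁, repGenη, traceCoeff_apply,
        coeff_X_pow, hj0, hη]
      omega
    τ := τ
    τ_e0 := hτ _
    τ_e1 := hτ _
    τ_α := hτ _
    τ_β := hτ _
    τ_γ := hτ _
    τ_η := hτ _
    ε₁ := ε₁
    ε₁_e0 := hε _
    ε₁_e1 := hε _
    ε₁_α := hε _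
    ε₁_β := hε _
    ε₁_γ := hε _
    ε₁_η := hε _ }⟩

theorem not_stablyEquivalent_two_of_three_le [CharP K 2] (hk : Odd k) (hs : 3 ≤ s) :
    ¬ StablyEquivalentOfMoritaType K (SD2BTwo K k s 0) (SD2BTwo K k s 1) := by
  intro h
  obtain ⟨S⟩ := exists_model_two K k s 0 hk.pos hs
  obtain ⟨S'⟩ := exists_model_two K k s 1 hk.pos hs
  have hA : Module.Finite K (SD2BTwo K k s 0) := S.finite
  have hB : Module.Finite K (SD2BTwo K k s 1) := S'.finite
  obtain ⟨T⟩ := h.exists_transfer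
  refine (S.isEmpty_transfer S' ?_ (by omega)).false T
  rintro rfl
  exact absurd hk (by decide)

end SecondAlgebra

/-! ### The second algebra for `s = 1`: words and finite dimension. -/

section IdempotentModel

/-- Generators satisfying the relations of `SD(2B)₂` for `s = 1`, where `βγ` is idempotent. -/
structure IsIdempotentModel (K : Type u) {A : Type u} [Field K] [Ring A] [Algebra K A] (k : ℕ)
    (c : K) (e0 e1 α β γ η : A) : Prop where
  adjoin_eq_top : Algebra.adjoin K {e0, e1, α, β, γ, η} = ⊤
  k_pos : 1 ≤ k
  e0_e0 : e0 * e0 = e0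
  e0_e1 : e0 * e1 = 0
  e1_e0 : e1 * e0 = 0
  e0_add_e1 : e0 + e1 = 1
  e0_α : e0 * α = α
  α_e0 : α * e0 = α
  e0_β : e0 * β = β
  β_e1 : β * e1 = β
  e1_γ : e1 * γ = γ
  γ_e0 : γ * e0 = γ
  e1_η : e1 * η = η
  γβ : γ * β = e1
  βη : β * η = (α * β * γ) ^ (k - 1) * (α * β)
  ηγ : η * γ = (γ * α * β) ^ (k - 1) * (γ * α)
  αα : α * α = c • (α * β * γ) ^ k
  βηη : β * η * η = 0

namespace IsIdempotentModel

variable {K A : Type u} [Field K] [Ring A] [Algebra K A] {k : ℕ} {c : K} {e0 e1 α β γ η : A}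
  (h : IsIdempotentModel K k c e0 e1 α β γ η)

include h

theorem βγβ : β * γ * β = β := by rw [mul_assoc, h.γβ, h.β_e1]
theorem γβγ : γ * β * γ = γ := by rw [h.γβ, h.e1_γ]

theorem q_mul_p : α * β * γ * (β * γ) = α * β * γ := by
  rw [mul_assoc (α * β), ← mul_assoc γ, h.γβγ]

theorem e0_mul_γ : e0 * γ = 0 := by rw [← h.e1_γ, ← mul_assoc, h.e0_e1, zero_mul]
theorem α_mul_γ : α * γ = 0 := by rw [← h.α_e0, mul_assoc, h.e0_mul_γ, mul_zero]
theorem γ_mul_γ : γ * γ = 0 := by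
  nth_rewrite 1 [← h.γ_e0]; rw [mul_assoc, h.e0_mul_γ, mul_zero]
theorem β_mul_e0 : β * e0 = 0 := by rw [← h.β_e1, mul_assoc, h.e1_e0, mul_zero]

theorem e0_mul_q_pow (i : ℕ) : e0 * (α * β * γ) ^ (i + 1) = (α * β * γ) ^ (i + 1) :=
  SDModel.mul_pow_eq_self (by rw [← mul_assoc, ← mul_assoc, h.e0_α]) i.succ_ne_zero

theorem q_pow_mul_p (i : ℕ) : (α * β * γ) ^ (i + 1) * (β * γ) = (α * β * γ) ^ (i + 1) := by
  rw [pow_succ, mul_assoc, h.q_mul_p]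

theorem q_pow_mul_e0 (i : ℕ) : (α * β * γ) ^ (i + 1) * e0 = (α * β * γ) ^ (i + 1) := by
  rw [pow_succ, mul_assoc, mul_assoc _ γ, h.γ_e0]

theorem top_mul_p : (α * β * γ) ^ k * (β * γ) = (α * β * γ) ^ k := by
  rw [← pow_sub_one_mul (by have := h.k_pos; omega : k ≠ 0), mul_assoc, h.q_mul_p]

theorem βηγ : β * η * γ = (α * β * γ) ^ k := by
  rw [h.βη, mul_assoc, pow_sub_one_mul (by have := h.k_pos; omega : k ≠ 0)]

/-- For `s = 1` the loop `η` is redundant: `γβ = e1` allows it to be recovered from `βη`. -/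
theorem η_eq : η = γ * (α * β * γ) ^ k * β := by
  have h1 : η = γ * (β * η) := by rw [← mul_assoc, h.γβ, h.e1_η]
  rw [h1, h.βη, ← pow_sub_one_mul (by have := h.k_pos; omega : k ≠ 0) (α * β * γ), mul_assoc γ,
    mul_assoc _ (α * β * γ) β, mul_assoc (α * β) γ β, h.γβ, mul_assoc α β e1, h.β_e1]

theorem top_eq : (β * γ * α) ^ k = (α * β * γ) ^ k := by
  have h1 : β * (γ * α * β) ^ (k - 1) = (β * γ * α) ^ (k - 1) * β :=
    SemiconjBy.pow_right (show SemiconjBy β (γ * α * β) (β * γ * α) by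
      simp only [SemiconjBy, mul_assoc]) _
  rw [← h.βηγ, mul_assoc β η, h.ηγ, ← mul_assoc, h1, mul_assoc _ β, ← mul_assoc β,
    pow_sub_one_mul (by have := h.k_pos; omega : k ≠ 0)]

theorem p_mul_top : β * γ * (α * β * γ) ^ k = (α * β * γ) ^ k := by
  rw [← h.βηγ, ← mul_assoc, ← mul_assoc, h.βγβ]

theorem α_mul_top : α * (α * β * γ) ^ k = (α * β * γ) ^ k * α := by
  nth_rewrite 1 [← h.top_eq]
  exact SemiconjBy.pow_right (show SemiconjBy α (β * γ * α) (α * β * γ) by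
    simp only [SemiconjBy, mul_assoc]) _

theorem top_mul_top : (α * β * γ) ^ k * (α * β * γ) ^ k = 0 := by
  rw [← h.βηγ, mul_assoc, ← mul_assoc γ, ← mul_assoc γ, h.γβ, h.e1_η, ← mul_assoc, h.βηη, zero_mul]

theorem α_mul_q_pow (i : ℕ) : α * (α * β * γ) ^ (i + 1) = c • (α * β * γ) ^ (k + i) := by
  have h1 : α * (α * β * γ) = c • (α * β * γ) ^ k := by
    rw [show α * (α * β * γ) = α * α * (β * γ) by simp only [mul_assoc], h.αα, smul_mul_assoc,
      h.top_mul_p]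
  rw [pow_succ', ← mul_assoc, h1, smul_mul_assoc, pow_add]

/-- Put `q = αβγ`. Then `q ^ (2 * k) = 0`, and `α q ^ k = q ^ k α` gives `q ^ (k + 1) = c q ^ (2 * k
- 1)`. For `k ≥ 3`, applying this twice reaches exponent `3 * k - 3 ≥ 2 * k`. For `k = 2` the
exponents `k + 1` and `2 * k - 1` coincide and nothing follows. -/
theorem q_pow_succ_top (hk : k ≠ 2) : (α * β * γ) ^ (k + 1) = 0 := by
  have hk' := h.k_pos
  have h0 : ∀ i, (α * β * γ) ^ (2 * k + i) = 0 := fun i => by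
    rw [pow_add, two_mul, pow_add, h.top_mul_top, zero_mul]
  rcases eq_or_ne k 1 with rfl | hk1
  · exact h0 0
  · obtain ⟨j, rfl⟩ : ∃ j, k = j + 3 := ⟨k - 3, by omega⟩
    have h1 : (α * β * γ) ^ (j + 3) * α = c • (α * β * γ) ^ (j + 3 + (j + 2)) := by
      rw [← h.α_mul_top, h.α_mul_q_pow]
    have h2 : (α * β * γ) ^ (j + 3 + 1) = c • (α * β * γ) ^ (j + 3 + (j + 2)) := by
      rw [pow_succ, ← mul_assoc, ← mul_assoc, h1, mul_assoc, smul_mul_assoc,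
        show j + 3 + (j + 2) = (j + 3 + (j + 1)) + 1 by omega, h.q_pow_mul_p]
    rw [h2, show j + 3 + (j + 2) = (j + 3 + 1) + (j + 1) by omega, pow_add, h2, smul_mul_assoc,
      ← pow_add, show j + 3 + (j + 2) + (j + 1) = 2 * (j + 3) + j by omega, h0, smul_zero,
      smul_zero]

theorem q_pow_eq_zero (hk : k ≠ 2) {i : ℕ} (hi : k < i) : (α * β * γ) ^ i = 0 := by
  obtain ⟨j, rfl⟩ := Nat.exists_eq_add_of_lt hi
  rw [show k + j + 1 = (k + 1) + j by omega, pow_add, h.q_pow_succ_top hk, zero_mul]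

omit h in
/-- The words in the generators that span the algebra. -/
def word (e0 α β γ : A) (a b c d : Bool) (i : ℕ) : A :=
  (if a then γ else e0) * ((if b then β * γ else e0) * (α * β * γ) ^ i * (if c then α else e0)) *
    (if d then β else e0)

omit h in
/-- The span of the words of bounded length. -/
def wordSpan (K : Type u) {A : Type u} [Field K] [Ring A] [Algebra K A] (k : ℕ) (e0 α β γ : A) :
    Submodule K A :=
  Submodule.span K (Set.range fun x : Bool × Bool × Bool × Bool × Fin (k + 1) =>
    word e0 α β γ x.1 x.2.1 x.2.2.1 x.2.2.2.1 x.2.2.2.2)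

theorem word_mem (hk : k ≠ 2) (a b c d : Bool) (i : ℕ) :
    word e0 α β γ a b c d i ∈ wordSpan K k e0 α β γ := by
  rcases Nat.lt_or_ge k i with hi | hi
  · rw [word, h.q_pow_eq_zero hk hi, mul_zero, zero_mul, mul_zero, zero_mul]
    exact zero_mem _
  · exact Submodule.subset_span ⟨(a, b, c, d, ⟨i, by omega⟩), rfl⟩

theorem α_mul_word (hk : k ≠ 2) (b c d : Bool) (i : ℕ) :
    α * word e0 α β γ false b c d i ∈ wordSpan K k e0 α β γ := by
  have h1 : α * (e0 * ((α * β * γ) ^ i * if c then α else e0)) ∈ Submodule.span K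
      (Set.range fun x : Bool × ℕ => e0 * (e0 * (α * β * γ) ^ x.2 * if x.1 then α else e0)) := by
    rw [← mul_assoc, h.α_e0]
    rcases i with _ | i
    · rw [pow_zero, one_mul]
      rcases c
      · exact Submodule.subset_span ⟨(true, 0), by
          simp [h.α_e0, h.e0_α]⟩
      · rw [if_pos rfl, h.αα]
        refine Submodule.smul_mem _ _ (Submodule.subset_span ⟨(false, k), ?_⟩)
        obtain ⟨j, rfl⟩ : ∃ j, k = j + 1 := ⟨k - 1, by have := h.k_pos; omega⟩
        simp only [h.e0_mul_q_pow, Bool.false_eq_true, if_false, h.q_pow_mul_e0]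
    · rw [← mul_assoc, h.α_mul_q_pow, smul_mul_assoc]
      refine Submodule.smul_mem _ _ (Submodule.subset_span ⟨(c, k + i), ?_⟩)
      obtain ⟨j, hj⟩ : ∃ j, k + i = j + 1 := ⟨k + i - 1, by have := h.k_pos; omega⟩
      simp only [← mul_assoc, hj, h.e0_mul_q_pow]
  rcases b
  · have h2 : α * word e0 α β γ false false c d i =
        α * (e0 * ((α * β * γ) ^ i * if c then α else e0)) * (if d then β else e0) := by
      simp only [word, Bool.false_eq_true, if_false, ← mul_assoc, h.α_e0]
    rw [h2]
    have h3 : ∀ y ∈ Submodule.span K (Set.range fun x : Bool × ℕ =>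
        e0 * (e0 * (α * β * γ) ^ x.2 * if x.1 then α else e0)),
        y * (if d then β else e0) ∈ wordSpan K k e0 α β γ := fun y hy => by
      induction hy using Submodule.span_induction with
      | mem y hy =>
        obtain ⟨x, rfl⟩ := hy
        exact h.word_mem hk false false x.1 d x.2
      | zero => rw [zero_mul]; exact zero_mem _
      | add x y _ _ hx hy => rw [add_mul]; exact add_mem hx hy
      | smul r x _ hx => rw [smul_mul_assoc]; exact Submodule.smul_mem _ _ hx
    exact h3 _ h1
  · have h2 : α * word e0 α β γ false true c d i = word e0 α β γ false false c d (i + 1) := by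
      simp only [word, Bool.false_eq_true, if_false, if_true, ← mul_assoc, h.α_e0,
        h.e0_α, pow_succ']
    rw [h2]
    exact h.word_mem hk _ _ _ _ _

/-- The elements whose left multiplication preserves the span form a subalgebra. It contains all
generators, and the span contains `1`. -/
theorem wordSpan_eq_top (hk : k ≠ 2) : wordSpan K k e0 α β γ = ⊤ := by
  have hp (b c d : Bool) (i : ℕ) :
      β * γ * word e0 α β γ false b c d i = word e0 α β γ false true c d i := by
    have e1 : β * γ * e0 = β * γ := by rw [mul_assoc, h.γ_e0]
    have e2 : β * γ * β * γ = β * γ := by rw [h.βγβ]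
    have e3 : e0 * β * γ = β * γ := by rw [h.e0_β]
    cases b <;> simp only [word, Bool.false_eq_true, if_false, if_true, ← mul_assoc, e1, e2, e3]
  let B : Subalgebra K A :=
    { carrier := {a | ∀ x ∈ wordSpan K k e0 α β γ, a * x ∈ wordSpan K k e0 α β γ}
      mul_mem' := fun {a b} ha hb x hx => by rw [mul_assoc]; exact ha _ (hb _ hx)
      one_mem' := fun x hx => by rwa [one_mul]
      add_mem' := fun {a b} ha hb x hx => by rw [add_mul]; exact add_mem (ha x hx) (hb x hx)
      zero_mem' := fun x _ => by rw [zero_mul]; exact zero_mem _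
      algebraMap_mem' := fun r x hx => by
        rw [← Algebra.smul_def]; exact Submodule.smul_mem _ _ hx }
  have hB : ∀ a, (∀ s b c d i, a * word e0 α β γ s b c d i ∈ wordSpan K k e0 α β γ) → a ∈ B := by
    intro a ha x hx
    induction hx using Submodule.span_induction with
    | mem x hx => obtain ⟨y, rfl⟩ := hx; exact ha _ _ _ _ _
    | zero => rw [mul_zero]; exact zero_mem _
    | add x y _ _ hx hy => rw [mul_add]; exact add_mem hx hy
    | smul r x _ hx => rw [mul_smul_comm]; exact Submodule.smul_mem _ _ hx
  have hα : α ∈ B := hB α fun s b c d i => by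
    cases s
    · exact h.α_mul_word hk b c d i
    · simp only [word, if_true, ← mul_assoc, h.α_mul_γ, zero_mul]
      exact zero_mem _
  have hβ : β ∈ B := hB β fun s b c d i => by
    cases s
    · simp only [word, Bool.false_eq_true, if_false, ← mul_assoc, h.β_mul_e0, zero_mul]
      exact zero_mem _
    · have : β * word e0 α β γ true b c d i = word e0 α β γ false true c d i := by
        rw [← hp b]
        simp only [word, Bool.false_eq_true, if_false, if_true, ← mul_assoc, mul_assoc β γ e0,
          h.γ_e0]
      rw [this]
      exact h.word_mem hk _ _ _ _ _
  have hγ : γ ∈ B := hB γ fun s b c d i => by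
    cases s
    · have : γ * word e0 α β γ false b c d i = word e0 α β γ true b c d i := by
        simp only [word, Bool.false_eq_true, if_false, if_true, ← mul_assoc, h.γ_e0]
      rw [this]
      exact h.word_mem hk _ _ _ _ _
    · simp only [word, if_true, ← mul_assoc, h.γ_mul_γ, zero_mul]
      exact zero_mem _
  have he1 : e1 ∈ B := h.γβ ▸ mul_mem hγ hβ
  have he0 : e0 ∈ B := by
    rw [eq_sub_of_add_eq h.e0_add_e1]
    exact sub_mem (one_mem _) he1
  have hη : η ∈ B := by
    rw [h.η_eq]
    exact mul_mem (mul_mem hγ (pow_mem (mul_mem (mul_mem hα hβ) hγ) _)) hβ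
  have hBtop : B = ⊤ := by
    rw [eq_top_iff, ← h.adjoin_eq_top, Algebra.adjoin_le_iff]
    rintro x (rfl | rfl | rfl | rfl | rfl | rfl)
    exacts [he0, he1, hα, hβ, hγ, hη]
  have h1 : (1 : A) ∈ wordSpan K k e0 α β γ := by
    rw [← h.e0_add_e1]
    refine add_mem ?_ ?_
    · have := h.word_mem hk false false false false 0
      simpa [word, h.e0_e0] using this
    · have := h.word_mem hk true false false true 0
      simpa [word, h.e0_e0, h.γ_e0, h.γβ] using this
  rw [eq_top_iff]
  rintro x -
  have hx : x ∈ B := hBtop ▸ Algebra.mem_top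
  simpa using hx 1 h1

theorem finite (hk : k ≠ 2) : Module.Finite K A :=
  ⟨by rw [← h.wordSpan_eq_top hk]; exact Submodule.fg_span (Set.finite_range _)⟩

end IsIdempotentModel

end IdempotentModel

/-! ### The second algebra for `s = 1`: dimension of the square kernel. -/

section IdempotentModelInvariant

/-- In characteristic two, `x ↦ f (x * x)` is additive for every trace form `f`. -/
def squareTrace {K A : Type u} [Field K] [CharP K 2] [Ring A] [Algebra K A] (f : A →ₗ[K] K)
    (hf : ∀ x y, f (x * y) = f (y * x)) : A →+ K where
  toFun x := f (x * x)
  map_zero' := by simp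
  map_add' x y := by
    have h := hf x y
    have h2 := add_self_eq_zero_of_charTwo K (f (y * x))
    simp only [add_mul, mul_add, map_add]
    linear_combination h + h2

theorem squareTrace_smul {K A : Type u} [Field K] [CharP K 2] [Ring A] [Algebra K A]
    (f : A →ₗ[K] K) (hf : ∀ x y, f (x * y) = f (y * x)) (r : K) (x : A) :
    squareTrace f hf (r • x) = r ^ 2 * f (x * x) := by
  change f (r • x * r • x) = _
  rw [smul_mul_smul_comm, map_smul, smul_eq_mul, pow_two]

namespace IsIdempotentModel

variable {K A : Type u} [Field K] [Ring A] [Algebra K A] {k : ℕ} {c : K} {e0 e1 α β γ η : A}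

/-- The representatives of the elements modulo commutators. -/
def classVec (e0 e1 α β γ : A) (k : ℕ) : Option (Option (Option (Fin k))) → A
  | none => e0
  | some none => e1
  | some (some none) => α
  | some (some (some i)) => (α * β * γ) ^ (i.val + 1)

/-- Rotating words, the idempotent `βγ` is absorbed through `γβ = e1` and `q * βγ = q`, where `q =
αβγ`; a word ending in a different vertex than it starts is a commutator. -/
theorem exists_class (h : IsIdempotentModel K k c e0 e1 α β γ η) (hk : k ≠ 2) (x : A) :
    ∃ (a b d : K) (t : Fin k → K), x - (a • e0 + (b • e1 + (d • α +
      ∑ i, t i • (α * β * γ) ^ (i.val + 1)))) ∈ commutatorSpan K A := by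
  let V := Submodule.span K (Set.range (classVec e0 e1 α β γ k))
  have hcomm : commutatorSpan K A ≤ commutatorSpan K A ⊔ V := le_sup_left
  have hcyc : ∀ x y : A, y * x ∈ commutatorSpan K A ⊔ V → x * y ∈ commutatorSpan K A ⊔ V :=
    fun x y hxy => by
      rw [← sub_add_cancel (x * y) (y * x)]
      exact add_mem (hcomm (mul_sub_mul_mem_commutatorSpan x y)) hxy
  have hV : ∀ i, classVec e0 e1 α β γ k i ∈ commutatorSpan K A ⊔ V := fun i =>
    Submodule.mem_sup_right (Submodule.subset_span ⟨i, rfl⟩)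
  have hq : ∀ i, (α * β * γ) ^ (i + 1) ∈ commutatorSpan K A ⊔ V := fun i => by
    rcases Nat.lt_or_ge i k with hi | hi
    · exact hV (some (some (some ⟨i, hi⟩)))
    · rw [h.q_pow_eq_zero hk (by omega)]
      exact zero_mem _
  have h1 : ∀ (b d : Bool) (i : ℕ), (if b then β * γ else e0) * (α * β * γ) ^ i * (if d then α else e0) ∈
      commutatorSpan K A ⊔ V := by
    intro b d i
    rcases b <;> rcases d <;> simp only [Bool.false_eq_true, if_false, if_true]
    · rcases i with _ | i
      · rw [pow_zero, mul_one, h.e0_e0]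
        exact hV none
      · rw [h.e0_mul_q_pow, h.q_pow_mul_e0]
        exact hq i
    · rcases i with _ | i
      · rw [pow_zero, mul_one, h.e0_α]
        exact hV (some (some none))
      · rw [h.e0_mul_q_pow]
        apply hcyc
        obtain ⟨j, hj⟩ : ∃ j, k + i = j + 1 := ⟨k + i - 1, by have := h.k_pos; omega⟩
        rw [h.α_mul_q_pow, hj]
        exact Submodule.smul_mem _ _ (hq j)
    · rcases i with _ | i
      · rw [pow_zero, mul_one, mul_assoc, h.γ_e0]
        apply hcyc
        rw [h.γβ]
        exact hV (some none)
      · rw [mul_assoc, h.q_pow_mul_e0]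
        apply hcyc
        rw [h.q_pow_mul_p]
        exact hq i
    · apply hcyc
      rw [← mul_assoc, ← mul_assoc, ← pow_succ']
      exact hq i
  have he0 : ∀ (b d : Bool) (i : ℕ),
      e0 * ((if b then β * γ else e0) * (α * β * γ) ^ i * (if d then α else e0)) * e0 =
      (if b then β * γ else e0) * (α * β * γ) ^ i * (if d then α else e0) := by
    intro b d i
    rcases b <;> rcases d <;> simp only [Bool.false_eq_true, if_false, if_true, mul_assoc, h.α_e0,
      h.e0_e0] <;> simp only [← mul_assoc, h.e0_e0, h.e0_β]
  have h2 : ∀ a b d f i, word e0 α β γ a b d f i ∈ commutatorSpan K A ⊔ V := by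
    intro a b d f i
    rw [word, ← he0]
    generalize hm : (if b then β * γ else e0) * (α * β * γ) ^ i * (if d then α else e0) = m
    rcases a <;> rcases f <;> simp only [Bool.false_eq_true, if_false, if_true]
    · rw [← hm, he0, he0]
      exact h1 b d i
    · refine hcomm (SDModel.mem_commutatorSpan_of_idempotent (e := e1) ?_ ?_)
      · rw [mul_assoc, h.β_e1]
      · simp only [← mul_assoc, h.e1_e0, zero_mul]
    · refine hcomm (SDModel.mem_commutatorSpan_of_idempotent (e := e0) ?_ ?_)
      · simp only [mul_assoc, h.e0_e0]
      · simp only [← mul_assoc, h.e0_mul_γ, zero_mul]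
    · apply hcyc
      have hb : β * γ * (if b then β * γ else e0) = β * γ := by
        rcases b
        · simp only [Bool.false_eq_true, if_false, mul_assoc, h.γ_e0]
        · simp only [if_true, ← mul_assoc, h.βγβ]
      rw [← hm, he0, ← mul_assoc, ← mul_assoc, ← mul_assoc, hb]
      exact h1 true d i
  have hx : x ∈ commutatorSpan K A ⊔ V := by
    have hx' : x ∈ wordSpan K k e0 α β γ := by rw [h.wordSpan_eq_top hk]; trivial
    refine (Submodule.span_le.2 ?_ : wordSpan K k e0 α β γ ≤ _) hx'
    rintro _ ⟨y, rfl⟩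
    exact h2 _ _ _ _ _
  obtain ⟨y, hy, z, hz, rfl⟩ := Submodule.mem_sup.1 hx
  obtain ⟨t, rfl⟩ := (Submodule.mem_span_range_iff_exists_fun K).1 hz
  refine ⟨t none, t (some none), t (some (some none)), fun i => t (some (some (some i))), ?_⟩
  rw [Fintype.sum_option, Fintype.sum_option, Fintype.sum_option]
  simpa [classVec] using hy

variable [CharP K 2]

/-- Mixed products cancel under a trace form in characteristic two, so only the squares of the
representatives remain. -/
theorem trace_mul_self (f : A →ₗ[K] K) (hf : ∀ x y, f (x * y) = f (y * x)) {x : A} {a b d : K}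
    {t : Fin k → K} (h : IsIdempotentModel K k c e0 e1 α β γ η)
    (hx : x - (a • e0 + (b • e1 + (d • α + ∑ i, t i • (α * β * γ) ^ (i.val + 1)))) ∈
      commutatorSpan K A) :
    f (x * x) = a ^ 2 * f e0 + (b ^ 2 * f e1 + (d ^ 2 * (c * f ((α * β * γ) ^ k)) +
      ∑ i, t i ^ 2 * f ((α * β * γ) ^ (2 * (i.val + 1))))) := by
  have e1_e1 : e1 * e1 = e1 := by
    nth_rewrite 2 [eq_sub_of_add_eq' h.e0_add_e1]
    rw [mul_sub, mul_one, h.e1_e0, sub_zero]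
  obtain ⟨y, hy⟩ : ∃ y, y = a • e0 + (b • e1 + (d • α +
    ∑ i, t i • (α * β * γ) ^ (i.val + 1))) := ⟨_, rfl⟩
  rw [← hy] at hx
  have h1 : squareTrace f hf (x - y) = 0 :=
    trace_eq_zero_of_mem_commutatorSpan f hf (square_mem_commutatorSpan hx)
  rw [map_sub, sub_eq_zero, hy, map_add, map_add, map_add, map_sum] at h1
  change f (x * x) = _ at h1
  rw [h1]
  simp only [squareTrace_smul, h.e0_e0, e1_e1, h.αα, map_smul, smul_eq_mul, ← pow_add, two_mul]

/-- Several trace forms, applied to `x * x`, isolate the coefficients one at a time: `τ` for `e0`,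
the form with `j = 0` for `e1`, the forms with `j = 2 * (i + 1)` for low powers of `αβγ`, and that
with `j = k` for `α`. Oddness of `k` keeps squares of powers away from the exponent `k`. -/
theorem squareKernel_le (h : IsIdempotentModel K k 1 e0 e1 α β γ η) (hk : Odd k)
    (τ : A →ₐ[K] DualNumber K) (τ_e0 : τ e0 = 1) (τ_e1 : τ e1 = 0) (τ_β : τ β = 0)
    (hF : ∀ j ≤ k, j < k ∨ 2 < k → ∃ f : A →ₗ[K] K, (∀ x y, f (x * y) = f (y * x)) ∧ f e0 = 0 ∧
      f e1 = (if j = 0 then 1 else 0) ∧ ∀ i, f ((α * β * γ) ^ (i + 1)) =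
        (if i + 1 = j then 1 else 0) + if j = k ∧ i + 1 = 2 then 1 else 0) :
    squareKernel K A ≤ commutatorSpan K A ⊔ Submodule.span K
      (Set.range fun i : {i : Fin k // k < 2 * (i.val + 1)} =>
        if k = 1 then α else (α * β * γ) ^ (i.val.val + 1)) := by
  intro x hx
  have hk2 : k ≠ 2 := by rintro rfl; exact absurd hk (by decide)
  have hk1 := h.k_pos
  have hodd : ∀ i, 2 * i ≠ k := fun i hi => by obtain ⟨r, hr⟩ := hk; omega
  obtain ⟨a, b, d, t, hxc⟩ := h.exists_class hk2 x
  have hxx : ∀ f : A →ₗ[K] K, (∀ x y, f (x * y) = f (y * x)) →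
      0 = a ^ 2 * f e0 + (b ^ 2 * f e1 + (d ^ 2 * (1 * f ((α * β * γ) ^ k)) +
        ∑ i, t i ^ 2 * f ((α * β * γ) ^ (2 * (i.val + 1))))) := fun f hf =>
    (trace_eq_zero_of_mem_commutatorSpan f hf hx).symm.trans (h.trace_mul_self f hf hxc)
  have hτq : ∀ i, τ ((α * β * γ) ^ (i + 1)) = 0 := fun i => by
    rw [map_pow, map_mul, map_mul, τ_β, mul_zero, zero_mul, zero_pow i.succ_ne_zero]
  have ha : a = 0 := by
    have h1 := hxx ((TrivSqZeroExt.fstHom K K K).toLinearMap ∘ₗ τ.toLinearMap) fun x y => by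
      simp [mul_comm]
    have h2 : τ ((α * β * γ) ^ k) = 0 := by
      have := hτq (k - 1); rwa [Nat.sub_add_cancel hk1] at this
    have h3 : ∀ i, τ ((α * β * γ) ^ (2 * (i + 1))) = 0 := fun i => hτq (2 * i + 1)
    simp only [LinearMap.comp_apply, AlgHom.toLinearMap_apply, τ_e0, τ_e1, h2, h3, map_zero,
      map_one, mul_zero, Finset.sum_const_zero, add_zero, mul_one] at h1
    exact eq_zero_of_pow_eq_zero h1.symm
  have hb : b = 0 := by
    obtain ⟨f, hf, f0, f1, fq⟩ := hF 0 (Nat.zero_le _) (Or.inl hk1)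
    have h1 := hxx f hf
    have h2 : f ((α * β * γ) ^ k) = 0 := by
      have := fq (k - 1)
      rw [Nat.sub_add_cancel hk1] at this
      rw [this, if_neg (by omega), if_neg (by omega), add_zero]
    have h3 : ∀ i, f ((α * β * γ) ^ (2 * (i + 1))) = 0 := fun i => by
      have := fq (2 * i + 1)
      rwa [if_neg (by omega), if_neg (by omega), add_zero] at this
    rw [ha, f1, if_pos rfl, h2] at h1
    simp only [h3, mul_zero, Finset.sum_const_zero, add_zero, mul_one, f0, zero_add] at h1
    exact eq_zero_of_pow_eq_zero h1.symm
  rw [ha, hb, zero_smul, zero_smul, zero_add, zero_add] at hxc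
  rw [← sub_add_cancel x (d • α + ∑ i, t i • (α * β * γ) ^ (i.val + 1))]
  refine add_mem (Submodule.mem_sup_left hxc) (Submodule.mem_sup_right ?_)
  rcases eq_or_ne k 1 with rfl | hk3
  · have hq : (α * β * γ) ^ 1 = 0 := by
      have h1 := h.α_mul_q_pow 0
      have h2 := h.top_mul_top
      rw [one_smul, zero_add] at h1
      nth_rewrite 1 [pow_one] at h2
      have h3 : α * β * γ * (α * β * γ) ^ 1 = α * (β * γ * (α * β * γ) ^ 1) := by
        simp only [mul_assoc]
      rwa [h3, h.p_mul_top, h1] at h2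
    refine add_mem (Submodule.smul_mem _ _ (Submodule.subset_span ⟨⟨0, by simp⟩, if_pos rfl⟩))
      (Submodule.sum_mem _ fun i _ => Submodule.smul_mem _ _ ?_)
    rw [pow_add, hq, mul_zero]
    exact zero_mem _
  · have hk4 : 3 ≤ k := by omega
    have ht : ∀ i : Fin k, 2 * (i.val + 1) < k → t i = 0 := fun i hi => by
      obtain ⟨f, hf, f0, f1, fq⟩ := hF (2 * (i.val + 1)) hi.le (Or.inr hk4)
      have h1 := hxx f hf
      have h2 : f ((α * β * γ) ^ k) = 0 := by
        have := fq (k - 1)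
        rw [Nat.sub_add_cancel hk1] at this
        rw [this, if_neg (by omega), if_neg (by omega), add_zero]
      have h3 : ∀ j : Fin k, f ((α * β * γ) ^ (2 * (j.val + 1))) = if j = i then 1 else 0 :=
        fun j => by
          have := fq (2 * j.val + 1)
          rw [if_neg (by omega : ¬ (2 * (i.val + 1) = k ∧ _)), add_zero] at this
          rw [show 2 * (j.val + 1) = 2 * j.val + 1 + 1 by omega, this]
          refine if_congr ?_ rfl rfl
          rw [Fin.ext_iff]
          omega
      rw [ha, hb, h2] at h1
      simp only [h3, mul_ite, mul_one, mul_zero, Finset.sum_ite_eq', Finset.mem_univ, if_true, f0,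
        zero_pow two_ne_zero, zero_mul, zero_add] at h1
      exact eq_zero_of_pow_eq_zero h1.symm
    -- The form with `j = k` has an extra value at exponent two. It only meets the first
    -- coefficient, which is already known to vanish as `2 < k`.
    have hd : d = 0 := by
      obtain ⟨f, hf, f0, f1, fq⟩ := hF k le_rfl (Or.inr hk4)
      have h1 := hxx f hf
      have h2 : f ((α * β * γ) ^ k) = 1 := by
        have := fq (k - 1)
        rw [Nat.sub_add_cancel hk1] at this
        rw [this, if_pos rfl, if_neg (by omega), add_zero]
      have h3 : ∀ j : Fin k, t j ^ 2 * f ((α * β * γ) ^ (2 * (j.val + 1))) = 0 := fun j => by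
        rcases Nat.lt_or_ge (2 * (j.val + 1)) k with hj | hj
        · rw [ht j hj, zero_pow two_ne_zero, zero_mul]
        · have := fq (2 * j.val + 1)
          have h4 := hodd (j.val + 1)
          rw [if_neg (by omega), if_neg (by omega), add_zero] at this
          rw [show 2 * (j.val + 1) = 2 * j.val + 1 + 1 by omega, this, mul_zero]
      rw [ha, hb, h2] at h1
      simp only [h3, Finset.sum_const_zero, zero_pow two_ne_zero, zero_mul, zero_add, add_zero,
        mul_one] at h1
      exact eq_zero_of_pow_eq_zero h1.symm
    rw [hd, zero_smul, zero_add]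
    refine Submodule.sum_mem _ fun i _ => ?_
    have h4 := hodd (i.val + 1)
    rcases Nat.lt_or_ge (2 * (i.val + 1)) k with hi | hi
    · rw [ht i hi, zero_smul]
      exact zero_mem _
    · exact Submodule.smul_mem _ _
        (Submodule.subset_span ⟨⟨i, lt_of_le_of_ne hi h4.symm⟩, if_neg hk3⟩)

/-- For `c = 0` both `α` and the powers of `αβγ` with exponent above `k / 2` have square zero and
are independent modulo commutators. For `c = 1` as many classes as there are such powers already
span. -/
theorem isEmpty_transfer {B : Type u} [Ring B] [Algebra K B] {e0' e1' α' β' γ' η' : B}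
    (h : IsIdempotentModel K k 0 e0 e1 α β γ η) (h' : IsIdempotentModel K k 1 e0' e1' α' β' γ' η')
    (hk : Odd k)
    (τ : A →ₐ[K] DualNumber K) (τ_α : τ α = DualNumber.eps) (τ_β : τ β = 0)
    (hF : ∀ j ≤ k, ∃ f : A →ₗ[K] K, (∀ x y, f (x * y) = f (y * x)) ∧ f α = 0 ∧
      ∀ i, f ((α * β * γ) ^ (i + 1)) = if i + 1 = j then 1 else 0)
    (τ' : B →ₐ[K] DualNumber K) (τ_e0' : τ' e0' = 1) (τ_e1' : τ' e1' = 0) (τ_β' : τ' β' = 0)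
    (hF' : ∀ j ≤ k, j < k ∨ 2 < k → ∃ f : B →ₗ[K] K, (∀ x y, f (x * y) = f (y * x)) ∧ f e0' = 0 ∧
      f e1' = (if j = 0 then 1 else 0) ∧ ∀ i, f ((α' * β' * γ') ^ (i + 1)) =
        (if i + 1 = j then 1 else 0) + if j = k ∧ i + 1 = 2 then 1 else 0) :
    IsEmpty (StableTransfer K A B) := by
  refine ⟨fun T => ?_⟩
  have hk2 : k ≠ 2 := by rintro rfl; exact absurd hk (by decide)
  let κ := {i : Fin k // k < 2 * (i.val + 1)}
  choose! F hFc hFα hFq using hF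
  let v : Option κ → A := fun o => o.elim α fun i => (α * β * γ) ^ (i.val.val + 1)
  let ψ : Option κ → A →ₗ[K] K := fun o =>
    o.elim ((TrivSqZeroExt.sndHom K K).restrictScalars K ∘ₗ τ.toLinearMap) fun i =>
      F (i.val.val + 1)
  have hτq : ∀ i, τ ((α * β * γ) ^ (i + 1)) = 0 := fun i => by
    rw [map_pow, map_mul, map_mul, τ_β, mul_zero, zero_mul, zero_pow i.succ_ne_zero]
  have hv : ∀ i, v i ∈ squareKernel K A := by
    rintro (_ | ⟨i, hi⟩)
    · change α * α ∈ commutatorSpan K A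
      rw [h.αα, zero_smul]
      exact zero_mem _
    · change (α * β * γ) ^ (i.val + 1) * (α * β * γ) ^ (i.val + 1) ∈ commutatorSpan K A
      rw [← pow_add, h.q_pow_eq_zero hk2 (by omega)]
      exact zero_mem _
  have hψ : ∀ i, ∀ x ∈ commutatorSpan K A, ψ i x = 0 := by
    rintro (_ | ⟨i, hi⟩) x hx
    · exact trace_eq_zero_of_mem_commutatorSpan _ (fun x y => by
        change (τ (x * y)).snd = (τ (y * x)).snd
        rw [map_mul, map_mul, mul_comm]) hx
    · exact trace_eq_zero_of_mem_commutatorSpan _ (hFc _ i.isLt) hx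
  have hd : ∀ i j, ψ i (v j) = if i = j then 1 else 0 := by
    rintro (_ | ⟨i, hi⟩) (_ | ⟨j, hj⟩)
    · change (τ α).snd = _
      rw [τ_α, DualNumber.snd_eps, if_pos rfl]
    · change (τ ((α * β * γ) ^ (j.val + 1))).snd = _
      rw [hτq, TrivSqZeroExt.snd_zero, if_neg (by simp)]
    · change F (i.val + 1) α = _
      rw [hFα _ i.isLt, if_neg (by simp)]
    · change F (i.val + 1) ((α * β * γ) ^ (j.val + 1)) = _
      rw [hFq _ i.isLt]
      refine if_congr ?_ rfl rfl
      rw [Option.some_inj, Subtype.mk.injEq, Fin.ext_iff]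
      omega
  have hcard := StableTransfer.card_le_card T le_rfl (fun x hx => T.map_square x hx) v hv
    (SDModel.coeff_eq_zero_of_dual v ψ hψ hd) _
    (h'.squareKernel_le hk τ' τ_e0' τ_e1' τ_β' hF')
  rw [Fintype.card_option] at hcard
  exact absurd hcard (Nat.not_succ_le_self _)

end IsIdempotentModel

end IdempotentModelInvariant

/-! ### Trace forms for `s = 1` and the conclusion. -/

section IdempotentRepresentations

open Matrix Polynomial

variable (K : Type u) [Field K] (k : ℕ)

/-- A three-dimensional representation in which `βγ` is idempotent and `αβγ` acts with trace the
variable. -/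
noncomputable def rhoGen : Gen2B → Matrix (Fin 3) (Fin 3) K[X]
  | .e0 => single 0 0 1 + single 1 1 1
  | .e1 => single 2 2 1
  | .α => single 0 0 X + single 0 1 X + single 1 0 X + single 1 1 X
  | .β => single 0 2 1
  | .γ => single 2 0 1
  | .η => single 2 2 (X ^ k)

/-- A two-dimensional representation in which `βγ` is idempotent and `α` acts with trace the
variable. -/
noncomputable def sigmaGen : Gen2B → Matrix (Fin 2) (Fin 2) K[X]
  | .e0 => single 0 0 1
  | .e1 => single 1 1 1
  | .α => single 0 0 X
  | .β => single 0 1 1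
  | .γ => single 1 0 1
  | .η => single 1 1 (X ^ k)

theorem isQuiverRep_rhoGen : IsQuiverRep (rhoGen K k) := by
  constructor <;> simp [rhoGen, mul_add, add_mul]
  · ext i j
    fin_cases i <;> fin_cases j <;> simp
  · abel

theorem isQuiverRep_sigmaGen : IsQuiverRep (sigmaGen K k) := by
  constructor <;> simp [sigmaGen]
  ext i j
  fin_cases i <;> fin_cases j <;> simp

/-- A three-dimensional representation in which `βγ` is idempotent and `αβγ` acts with trace the
variable. -/
noncomputable def rho : PathAlg2B K →ₐ[K] Matrix (Fin 3) (Fin 3) K[X] :=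
  PathAlg2B.lift (isQuiverRep_rhoGen K k)

/-- A two-dimensional representation in which `βγ` is idempotent and `α` acts with trace the
variable. -/
noncomputable def sigma : PathAlg2B K →ₐ[K] Matrix (Fin 2) (Fin 2) K[X] :=
  PathAlg2B.lift (isQuiverRep_sigmaGen K k)

theorem rho_of (g : Gen2B) : rho K k (PathAlg2B.of K g) = rhoGen K k g := PathAlg2B.lift_of _ _
theorem sigma_of (g : Gen2B) : sigma K k (PathAlg2B.of K g) = sigmaGen K k g :=
  PathAlg2B.lift_of _ _

variable {k}

/-- At `X = 0` the middle basis vector of `rho` splits off and what remains agrees with `sigma`.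
This matches the two summands of the trace form. -/
theorem rho_coeff_zero (x : PathAlg2B K) :
    (rho K k x 0 1).coeff 0 = 0 ∧ (rho K k x 1 0).coeff 0 = 0 ∧ (rho K k x 1 2).coeff 0 = 0 ∧
    (rho K k x 2 1).coeff 0 = 0 ∧ (sigma K k x 0 0).coeff 0 = (rho K k x 0 0).coeff 0 ∧
    (sigma K k x 0 1).coeff 0 = (rho K k x 0 2).coeff 0 ∧
    (sigma K k x 1 0).coeff 0 = (rho K k x 2 0).coeff 0 ∧
    (sigma K k x 1 1).coeff 0 = (rho K k x 2 2).coeff 0 := by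
  induction x using PathAlg2B.induction with
  | hof g => cases g <;> simp [rho_of, sigma_of, rhoGen, sigmaGen, coeff_one]
  | halg r =>
    simp [Matrix.algebraMap_matrix_apply]
  | hadd x y hx hy =>
    obtain ⟨h1, h2, h3, h4, h5, h6, h7, h8⟩ := hx
    obtain ⟨h1', h2', h3', h4', h5', h6', h7', h8'⟩ := hy
    simp [h1, h2, h3, h4, h5, h6, h7, h8, h1', h2', h3', h4', h5', h6', h7', h8']
  | hmul x y hx hy =>
    obtain ⟨h1, h2, h3, h4, h5, h6, h7, h8⟩ := hx
    obtain ⟨h1', h2', h3', h4', h5', h6', h7', h8'⟩ := hy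
    simp [Matrix.mul_apply, Fin.sum_univ_three, mul_coeff_zero,
      h1, h2, h3, h4, h5, h6, h7, h8, h1', h2', h3', h4', h5', h6', h7', h8']

variable (k) (c : K) (j : ℕ)

/-- The coefficients of the trace form of `SD(2B)₂` for `s = 1` on the path algebra. -/
noncomputable def idempotentForm : PathAlg2B K →ₗ[K] K :=
  traceCoeff K j ∘ₗ (rho K k).toLinearMap +
    (if j = k then c else 0) • traceCoeff K 2 ∘ₗ (sigma K k).toLinearMap

theorem idempotentForm_apply (x : PathAlg2B K) : idempotentForm K k c j x =
    traceCoeff K j (rho K k x) + (if j = k then c else 0) * traceCoeff K 2 (sigma K k x) := rfl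

theorem idempotentForm_mul_comm (x y : PathAlg2B K) :
    idempotentForm K k c j (x * y) = idempotentForm K k c j (y * x) := by
  simp only [idempotentForm_apply, map_mul, traceCoeff_mul_comm K j (rho K k x),
    traceCoeff_mul_comm K 2 (sigma K k x)]

variable {k}

theorem rho_αβγ_pow (i : ℕ) :
    (rhoGen K k .α * rhoGen K k .β * rhoGen K k .γ) ^ (i + 1) =
      single 0 0 (X ^ (i + 1)) + single 1 0 (X ^ (i + 1)) := by
  induction i with
  | zero => simp [rhoGen, add_mul]
  | succ i ih =>
    rw [pow_succ, ih]
    simp [rhoGen, add_mul, mul_add, ← pow_succ]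

theorem rho_αβγ_pow_mul (i : ℕ) :
    (rhoGen K k .α * rhoGen K k .β * rhoGen K k .γ) ^ i * (rhoGen K k .α * rhoGen K k .β) =
      single 0 2 (X ^ (i + 1)) + single 1 2 (X ^ (i + 1)) := by
  rcases i with _ | i
  · simp [rhoGen, add_mul]
  · rw [rho_αβγ_pow]
    simp [rhoGen, add_mul, mul_add, ← pow_succ]

theorem rho_γαβ_pow_mul (i : ℕ) :
    (rhoGen K k .γ * rhoGen K k .α * rhoGen K k .β) ^ i * (rhoGen K k .γ * rhoGen K k .α) =
      single 2 0 (X ^ (i + 1)) + single 2 1 (X ^ (i + 1)) := by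
  have h : rhoGen K k .γ * rhoGen K k .α * rhoGen K k .β = single 2 2 X := by
    simp [rhoGen, mul_add, add_mul]
  rw [h]
  rcases i with _ | i
  · simp [rhoGen, mul_add]
  · rw [single_pow_succ]
    simp [rhoGen, mul_add, ← pow_succ]

theorem sigma_αβγ_pow (i : ℕ) :
    (sigmaGen K k .α * sigmaGen K k .β * sigmaGen K k .γ) ^ (i + 1) = single 0 0 (X ^ (i + 1)) := by
  simp [sigmaGen, single_pow_succ]

theorem sigma_αβγ_pow_mul (i : ℕ) :
    (sigmaGen K k .α * sigmaGen K k .β * sigmaGen K k .γ) ^ i *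
      (sigmaGen K k .α * sigmaGen K k .β) = single 0 1 (X ^ (i + 1)) := by
  rcases i with _ | i
  · simp [sigmaGen]
  · rw [sigma_αβγ_pow]
    simp [sigmaGen, ← pow_succ]

theorem sigma_γαβ_pow_mul (i : ℕ) :
    (sigmaGen K k .γ * sigmaGen K k .α * sigmaGen K k .β) ^ i *
      (sigmaGen K k .γ * sigmaGen K k .α) = single 1 0 (X ^ (i + 1)) := by
  have h : sigmaGen K k .γ * sigmaGen K k .α * sigmaGen K k .β = single 1 1 X := by
    simp [sigmaGen]
  rw [h]
  rcases i with _ | i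
  · simp [sigmaGen]
  · rw [single_pow_succ]
    simp [sigmaGen, ← pow_succ]

variable {j} [CharP K 2]

/-- On the two-dimensional space at the first vertex `α` acts as `X` times the all-ones matrix `J`,
and `J² = 2J = 0`. -/
theorem rho_α_sq : rhoGen K k .α ^ 2 = 0 := by
  have h : (X * X + X * X : K[X]) = 0 := add_self_eq_zero_of_charTwo K _
  rw [pow_two]
  ext i j : 1
  fin_cases i <;> fin_cases j <;> simp [rhoGen, Matrix.mul_apply, Fin.sum_univ_three, h]

/-- The representation `rho` violates the relations only by multiples of `X ^ k`, so for `j ≤ k`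
just constant coefficients of `x` can matter, and most of these vanish. The exception is `α² = c q ^
k`, with `q = αβγ`, at `j = k`: `rho` gives zero on the left, and the coefficient of `X ^ 2` in
`sigma` supplies the missing `c`. The condition `hjk` prevents that coefficient from seeing other
multiples of `X ^ k`. -/
theorem idempotentForm_rel (hk : 1 ≤ k) (hj : j ≤ k) (hjk : j < k ∨ 2 < k ∨ c = 0)
    (a b : PathAlg2B K) (h : SD2BTwoRel K k 1 c a b) (x : PathAlg2B K) :
    idempotentForm K k c j (a * x) = idempotentForm K k c j (b * x) := by
  obtain ⟨h1, h2, h3, h4, h5, h6, h7, h8⟩ := rho_coeff_zero K (k := k) x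
  have hX : ∀ (n : ℕ) (p : K[X]), k ≤ n → (X ^ n * p).coeff j = if j = n then p.coeff 0 else 0 :=
    fun n p hn => by
      rw [coeff_X_pow_mul']
      split_ifs with h h' h'
      · rw [h', Nat.sub_self]
      · omega
      · omega
      · rfl
  have hkk : k - 1 + 1 = k := by omega
  obtain ⟨m, hm⟩ : ∃ m, k = m + 1 := ⟨k - 1, by omega⟩
  have h0 : ∀ n p, k ≤ n → (if j = k then c else 0) * (X ^ n * p : K[X]).coeff 2 = 0 :=
    fun n p hn => by
      rcases hjk with hjk | hjk | hjk
      · rw [if_neg hjk.ne, zero_mul]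
      · rw [coeff_X_pow_mul', if_neg (show ¬ n ≤ 2 by omega), mul_zero]
      · rw [hjk, ite_self, zero_mul]
  simp only [idempotentForm_apply, map_mul]
  cases h <;> simp only [PathAlg2B.α, PathAlg2B.β, PathAlg2B.γ, PathAlg2B.η, PathAlg2B.e1, rho_of,
    sigma_of, map_mul, map_pow, map_smul, map_zero, rho_αβγ_pow_mul, rho_γαβ_pow_mul,
    sigma_αβγ_pow_mul, sigma_γαβ_pow_mul, rho_α_sq, hkk]
  · simp [rhoGen, sigmaGen, add_mul, traceCoeff_single_mul, hX, h4]
  · simp [rhoGen, sigmaGen, add_mul, traceCoeff_single_mul, hX, h3]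
  · simp [rhoGen, sigmaGen]
  · have hr := rho_αβγ_pow K (k := k) m
    have hs := sigma_αβγ_pow K (k := k) m
    rw [← hm] at hr hs
    have hα : sigmaGen K k .α ^ 2 = single 0 0 (X ^ 2) := by
      simp [sigmaGen, pow_two]
    rw [hr, hs, hα]
    simp only [smul_mul_assoc, map_smul, smul_eq_mul, traceCoeff_single_mul, zero_mul, map_zero,
      add_mul, map_add, hX _ _ le_rfl, h1, ite_self, mul_left_comm _ c, h0 _ _ le_rfl, mul_zero]
    simp [coeff_X_pow_mul', h5]
  · simp only [rhoGen, sigmaGen, pow_two, ← pow_add, single_mul_single_same, one_mul,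
      traceCoeff_single_mul, hX _ _ (le_add_left le_rfl : k ≤ k + k),
      h0 _ _ (le_add_left le_rfl : k ≤ k + k), zero_mul, map_zero, mul_zero]
    rw [if_neg (by omega), add_zero]
  · simp only [rhoGen, sigmaGen, pow_two, ← pow_add, single_mul_single_same, mul_one,
      traceCoeff_single_mul, hX _ _ (le_add_left le_rfl : k ≤ k + k),
      h0 _ _ (le_add_left le_rfl : k ≤ k + k), zero_mul, map_zero, mul_zero]
    rw [if_neg (by omega), add_zero]

omit [CharP K 2] in
variable (k) in
theorem exists_idempotentModel (hk : 1 ≤ k) :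
    IsIdempotentModel K k c (quotGen (SD2BTwoRel K k 1 c) .e0) (quotGen (SD2BTwoRel K k 1 c) .e1)
      (quotGen (SD2BTwoRel K k 1 c) .α) (quotGen (SD2BTwoRel K k 1 c) .β)
      (quotGen (SD2BTwoRel K k 1 c) .γ) (quotGen (SD2BTwoRel K k 1 c) .η) := by
  have hq := isQuiverRep_quotGen (SD2BTwoRel K k 1 c)
  have hadj := adjoin_range_quotGen (SD2BTwoRel K k 1 c)
  have R {a b} (h : SD2BTwoRel K k 1 c a b) := RingQuot.mkAlgHom_rel K h
  have hgx : ∀ x, RingQuot.mkAlgHom K (SD2BTwoRel K k 1 c) (PathAlg2B.of K x) =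
      quotGen (SD2BTwoRel K k 1 c) x := fun x => rfl
  refine ⟨?_, hk, hq.e0_e0, hq.e0_e1, hq.e1_e0, hq.e0_add_e1, hq.e0_α, hq.α_e0, hq.e0_β, hq.β_e1,
    hq.e1_γ, hq.γ_e0, hq.e1_η, ?_, ?_, ?_, ?_, ?_⟩
  · rw [← hadj]
    congr 1
    ext x
    constructor
    · rintro (rfl | rfl | rfl | rfl | rfl | rfl) <;> exact ⟨_, rfl⟩
    · rintro ⟨y, rfl⟩
      cases y <;> simp
  · have h := R .γβ
    simpa only [map_mul, map_pow, PathAlg2B.β, PathAlg2B.γ, PathAlg2B.η, PathAlg2B.e1, hgx,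
      Nat.sub_self, pow_zero, mul_one] using h
  · have h := R .βη
    simpa only [map_mul, map_pow, PathAlg2B.α, PathAlg2B.β, PathAlg2B.γ, PathAlg2B.η, hgx] using h
  · have h := R .ηγ
    simpa only [map_mul, map_pow, PathAlg2B.α, PathAlg2B.β, PathAlg2B.γ, PathAlg2B.η, hgx] using h
  · have h := R .αα
    simp only [map_mul, map_pow, map_smul, PathAlg2B.α, PathAlg2B.β, PathAlg2B.γ, hgx] at h
    rw [← pow_two, h]
  · have h := R .βηη
    simp only [map_mul, map_pow, map_zero, PathAlg2B.β, PathAlg2B.η, hgx] at h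
    rw [mul_assoc, ← pow_two, h]

/-- For `j = 0` the two dimensions at the first vertex cancel in characteristic two, leaving the
value `1` at the second. The extra value `c` at exponent two comes from `sigma`, where `αβγ` has
trace `X`. -/
theorem exists_idempotentForm (hk : 1 ≤ k) (hj : j ≤ k) (hjk : j < k ∨ 2 < k ∨ c = 0) :
    ∃ f : SD2BTwo K k 1 c →ₗ[K] K, (∀ x y, f (x * y) = f (y * x)) ∧
      f (quotGen _ .e0) = 0 ∧ f (quotGen _ .e1) = (if j = 0 then 1 else 0) ∧
      f (quotGen _ .α) = 0 ∧
      ∀ i, f ((quotGen _ .α * quotGen _ .β * quotGen _ .γ) ^ (i + 1)) =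
        (if i + 1 = j then 1 else 0) + if j = k ∧ i + 1 = 2 then c else 0 := by
  obtain ⟨f, hf, hff⟩ := RingQuot.exists_trace (idempotentForm K k c j)
    (idempotentForm_mul_comm K k c j) (idempotentForm_rel K c hk hj hjk)
  have h2 : ∀ x : K, x + x = 0 := add_self_eq_zero_of_charTwo K
  refine ⟨f, hff, ?_, ?_, ?_, fun i => ?_⟩
  · rw [quotGen, hf, idempotentForm_apply, rho_of, sigma_of]
    simp [rhoGen, sigmaGen, traceCoeff_apply, coeff_one, h2]
  · rw [quotGen, hf, idempotentForm_apply, rho_of, sigma_of]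
    simp [rhoGen, sigmaGen, traceCoeff_apply, coeff_one, eq_comm]
  · rw [quotGen, hf, idempotentForm_apply, rho_of, sigma_of]
    simp [rhoGen, sigmaGen, traceCoeff_apply, coeff_X, h2]
  · simp only [quotGen, ← map_mul, ← map_pow]
    rw [hf, idempotentForm_apply]
    simp only [map_mul, map_pow, rho_of, sigma_of, rho_αβγ_pow, sigma_αβγ_pow]
    simp [traceCoeff_apply, coeff_X_pow, eq_comm, ite_and]
    split_ifs <;> rfl

omit [CharP K 2] in
variable (k) in
theorem exists_loopHom (hk : 1 ≤ k) : ∃ τ : SD2BTwo K k 1 c →ₐ[K] DualNumber K,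
    τ (quotGen _ .e0) = 1 ∧ τ (quotGen _ .e1) = 0 ∧ τ (quotGen _ .α) = DualNumber.eps ∧
      τ (quotGen _ .β) = 0 := by
  have hk0 : k ≠ 0 := by omega
  obtain ⟨τ, hτ⟩ := exists_algHom_quotGen (K := K) (r := SD2BTwoRel K k 1 c) (R := DualNumber K)
    (v := fun | .e0 => 1 | .α => DualNumber.eps | _ => 0) (by constructor <;> simp) (by
      intro a b h
      cases h <;> simp [PathAlg2B.α, PathAlg2B.β, PathAlg2B.γ, PathAlg2B.η, PathAlg2B.e1,
        PathAlg2B.lift_of, hk0, pow_two])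
  exact ⟨τ, hτ _, hτ _, hτ _, hτ _⟩

theorem not_stablyEquivalent_two_of_one (hk : Odd k) :
    ¬ StablyEquivalentOfMoritaType K (SD2BTwo K k 1 0) (SD2BTwo K k 1 1) := by
  intro hst
  have hk1 : 1 ≤ k := hk.pos
  have hk2 : k ≠ 2 := by rintro rfl; exact absurd hk (by decide)
  have h := exists_idempotentModel K k 0 hk1
  have h' := exists_idempotentModel K k 1 hk1
  have hA : Module.Finite K (SD2BTwo K k 1 0) := h.finite hk2
  have hB : Module.Finite K (SD2BTwo K k 1 1) := h'.finite hk2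
  obtain ⟨T⟩ := hst.exists_transfer
  obtain ⟨τ, -, -, τ_α, τ_β⟩ := exists_loopHom K k 0 hk1
  obtain ⟨τ', τ_e0', τ_e1', -, τ_β'⟩ := exists_loopHom K k 1 hk1
  refine (h.isEmpty_transfer h' hk τ τ_α τ_β (fun j hj => ?_) τ' τ_e0' τ_e1' τ_β'
    fun j hj hjk => ?_).false T
  · obtain ⟨f, hf, -, -, hα, hq⟩ := exists_idempotentForm K 0 hk1 hj (Or.inr (Or.inr rfl))
    refine ⟨f, hf, hα, fun i => ?_⟩
    rw [hq, ite_self, add_zero]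
  · obtain ⟨f, hf, h0, h1, -, hq⟩ := exists_idempotentForm K 1 hk1 hj (hjk.imp_right Or.inl)
    exact ⟨f, hf, h0, h1, hq⟩

theorem not_stablyEquivalent_two {s : ℕ} (hk : Odd k) (hs : Odd s) :
    ¬ StablyEquivalentOfMoritaType K (SD2BTwo K k s 0) (SD2BTwo K k s 1) := by
  rcases eq_or_ne s 1 with rfl | hs1
  · exact not_stablyEquivalent_two_of_one K hk
  · obtain ⟨r, hr⟩ := hs
    exact not_stablyEquivalent_two_of_three_le K hk (by omega)

end IdempotentRepresentations

theorem corollary7p5 (K : Type u) [Field K] [IsAlgClosed K] [CharP K 2] :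
    (∀ k s : ℕ, 1 ≤ k → 1 ≤ s → (k = 2 → 3 ≤ s ∧ Odd s) → (s = 2 → 3 ≤ k ∧ Odd k) →
      ¬ StablyEquivalentOfMoritaType K (SD2BOne K k s 0) (SD2BOne K k s 1)) ∧
    (∀ k s : ℕ, 1 ≤ k → 1 ≤ s → Odd k → Odd s →
      ¬ StablyEquivalentOfMoritaType K (SD2BTwo K k s 0) (SD2BTwo K k s 1)) :=
  ⟨fun _ _ hk hs h h' => not_stablyEquivalent_one hk hs h h',
    fun _ _ _ _ hk hs => not_stablyEquivalent_two K hk hs⟩
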